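/- Let $N\ge 2$ and consider a fixed-gain amplify-and-forward link with $N$ hops, channel coefficients $h_1,\dots,h_N$ and fixed gains $A_0,\dots,A_{N-1}$. Assume that the amplified channel powers $X_n=A_{n-1}^2|h_n|^2$ are independent and that $X_n$ has the Rician power density $$f_{X_n}(x)=\frac{K_n+1}{\theta_n}\,e^{-K_n-(K_n+1)x/\theta_n}\,I_0\!\left(\sqrt{\frac{4K_n(K_n+1)x}{\theta_n}}\right),\qquad x\ge 0,$$ with $K_n\ge 0$, $\theta_n>0$. Let $\rho_n>0$ and let $\gamma_{th}>0$. The end-to-end SNR and the outage probability are $$\mathsf{SNR}=\frac{\prod_{n=1}^N X_n}{\sum_{n=1}^N\rho_n\prod_{j=n+1}^N X_j}\,\bar\gamma ,\qquad P_o=P_o(\bar\gamma)=P(\mathsf{SNR}<\gamma_{th}).$$ Below, $f\sim g$ means asymptotic equivalence as $\bar\gamma\to\infty$ (ratio tending to $1$), and $o(\cdot)$ refers to $\bar\gamma\to\infty$. Let $L_1,\dots,L_{N-1}\ge 1$ be integers. For $\ell=(\ell_1,\dots,\ell_{N-1})$ with $0\le\ell_n\le L_n-1$ put $\lambda_n=\sum_{k=1}^n\ell_k$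 ($\lambda_0=0$). For $1\le r\le N$ let $\mathcal L_r$ be the set of these $\ell$ with $\lambda_{r-1}=0$ and, if $r\le N-1$, $\lambda_r>0$. Put $M[f;s]=\int_0^\infty x^{s-1}f(x)\,dx$, $$I_L(\bar\gamma)=1-\sum_{\ell}(-1)^{\lambda_{N-1}}\prod_{n=1}^{N-1}\frac1{\ell_n!}\Big(\frac{\rho_n}{\rho_N}\Big)^{\ell_n}\cdot\frac1{2\pi i}\int_{-\kappa_\ell-i\infty}^{-\kappa_\ell+i\infty}\Big(\frac{\rho_N\gamma_{th}}{\bar\gamma}\Big)^{s}\frac{\Gamma(\lambda_{N-1}-s)}{\Gamma(1-s)}\prod_{n=1}^N M[f_{X_n};1+\lambda_{n-1}-s]\,ds$$ with arbitrary $\kappa_\ell>\lambda_{N-1}$, and $$S_L(\bar\gamma)=a\sum_{r=1}^{N}\sum_{\ell\in\mathcal L_r}(-1)^{\lambda_{N-1}}\zeta_\ell\sum_{l=0}^{r-1}\frac{\varrho^{(r-1-l)}(1)}{(r-1-l)!\,l!}\sum_{p=0}^{l}\binom lp(-1)^p(\log a)^{l-p}\,\frac{(\log\bar\gamma)^p}{\bar\gamma},$$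 where $a=\rho_N\gamma_{th}\prod_{n=1}^N\frac{K_n+1}{\theta_n}$, $$\zeta_\ell=e^{-K_N}\prod_{n=1}^{N-1}\frac{e^{-K_n}}{\ell_n!}\Big(\frac{\rho_n}{\rho_N}\Big)^{\ell_n}\Big(\frac{\theta_{n+1}}{K_{n+1}+1}\Big)^{\lambda_n},$$ $$\varrho(s)=(s-1)^r\,\frac{\Gamma(\lambda_{N-1}-s)}{\Gamma(1-s)}\prod_{n=1}^{N}\Gamma(1+\lambda_{n-1}-s)\;{}_1F_1(1+\lambda_{n-1}-s,1;K_n)$$ (which depends on $r$ and $\ell$), and $\varrho^{(k)}(1)=\lim_{s\to1}\varrho^{(k)}(s)$ is the derivative after removing the removable singularity at $s=1$. Then the contour integrals converge absolutely for every $\bar\gamma>0$ and: 1. $P_o\sim I_L$, and $I_L=S_L+o(\bar\gamma^{-1})$. Thus $P_o\sim S_L+o(\bar\gamma^{-1})$, where the $o(\bar\gamma^{-1})$ term is $I_L-S_L$; also $P_o\sim S_L$. 2. If $L_n\ge 2$ for all $n$, then moreover $P_o=S_L+o\big((\log\bar\gamma)^{N-2}/\bar\gamma\big)$; for $N=2$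 the error is $o(\bar\gamma^{-1})$. 3. To leading order, $$P_o\sim\frac{\rho_N\gamma_{th}}{(N-1)!}\prod_{n=1}^N\frac{K_n+1}{\theta_n e^{K_n}}\;\frac{(\log\bar\gamma)^{N-1}}{\bar\gamma}.$$ -/

import Mathlib

open MeasureTheory ProbabilityTheory Filter Topology Asymptotics

noncomputable section

namespace MultihopRelay

/-! ### The Rician channel power law -/

/-- The modified Bessel function of the first kind of order zero. -/
def besselI0 (x : ℝ) : ℝ := ∑' k : ℕ, (x / 2) ^ (2 * k) / ((k.factorial : ℝ)) ^ 2

/-- Probability density of the power of a Rician channel with `K`-factor `K` and scale `θ`. -/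
def ricianPDF (K θ x : ℝ) : ℝ :=
  if 0 ≤ x then
    θ⁻¹ * (K + 1) * Real.exp (-(K + θ⁻¹ * (K + 1) * x)) *
      besselI0 (Real.sqrt (4 * K * (K + 1) * x / θ))
  else 0

/-- The law on `ℝ` with density `ricianPDF K θ`. -/
def ricianLaw (K θ : ℝ) : Measure ℝ :=
  volume.withDensity fun x => ENNReal.ofReal (ricianPDF K θ x)

/-! ### The fixed-gain amplify-and-forward link

There are `M` relays and `M + 1` hops, and hops are numbered from `0` to `M`. So hop `n : Fin (M + 1)`
is the `(n + 1)`-st hop, and `A n` is the gain applied by the node that transmits over it. -/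

/-- The amplified channel power of each hop: squared gain times squared channel modulus. -/
def channelPower {M : ℕ} {Ω : Type*} (A : Fin (M + 1) → ℝ) (h : Fin (M + 1) → Ω → ℂ)
    (n : Fin (M + 1)) (ω : Ω) : ℝ :=
  A n ^ 2 * ‖h n ω‖ ^ 2

/-- The instantaneous end-to-end signal-to-noise ratio when the noise variance at the receiver of
hop `n` is `ρ n / γ`. -/
def snr {M : ℕ} {Ω : Type*} (A : Fin (M + 1) → ℝ) (h : Fin (M + 1) → Ω → ℂ)
    (ρ : Fin (M + 1) → ℝ) (γ : ℝ) (ω : Ω) : ℝ :=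
  (∏ n, channelPower A h n ω) /
    (∑ n, ρ n * ∏ j ∈ Finset.Ioi n, channelPower A h j ω) * γ

/-- The outage probability: the probability that the end-to-end SNR is below the threshold `γth`. -/
def outageProb {M : ℕ} {Ω : Type*} [MeasurableSpace Ω] (μ : Measure Ω)
    (A : Fin (M + 1) → ℝ) (h : Fin (M + 1) → Ω → ℂ) (ρ : Fin (M + 1) → ℝ) (γth γ : ℝ) : ℝ :=
  μ.real {ω | snr A h ρ γ ω < γth}

/-! ### Multi-indices -/

/-- `lam ℓ n` is the sum of the first `n` entries of the tuple `ℓ`. -/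
def lam {M : ℕ} (ℓ : Fin M → ℕ) (n : ℕ) : ℕ :=
  ∑ k ∈ Finset.univ.filter (fun k : Fin M => (k : ℕ) < n), ℓ k

/-- The tuples `ℓ` with `0 ≤ ℓ k ≤ L k - 1` for every `k`. -/
def box {M : ℕ} (L : Fin M → ℕ) : Finset (Fin M → ℕ) :=
  Fintype.piFinset fun k => Finset.range (L k)

/-- The tuples in the box whose first `r - 1` entries vanish and whose `r`-th entry (if there is
one) does not, in terms of the partial sums. -/
def indexSet {M : ℕ} (L : Fin M → ℕ) (r : ℕ) : Finset (Fin M → ℕ) :=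
  (box L).filter fun ℓ => lam ℓ (r - 1) = 0 ∧ (r ≤ M → 0 < lam ℓ r)

/-! ### The contour-integral expression of the outage probability -/

/-- The integrand, with `M[f; s]` the Mellin transform `mellin f s`. -/
def contourIntegrand {M : ℕ} (K θ ρ : Fin (M + 1) → ℝ) (γth : ℝ) (ℓ : Fin M → ℕ) (γ : ℝ)
    (s : ℂ) : ℂ :=
  ((ρ (Fin.last M) * γth / γ : ℝ) : ℂ) ^ s *
    (Complex.Gamma ((lam ℓ M : ℂ) - s) / Complex.Gamma (1 - s)) *
    ∏ n : Fin (M + 1),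
      mellin (fun x => (ricianPDF (K n) (θ n) x : ℂ)) (1 + (lam ℓ n : ℂ) - s)

/-- `(1 / (2 π i)) ∫ F(s) ds` along the upward vertical line with real part `c`. -/
def verticalIntegral (F : ℂ → ℂ) (c : ℝ) : ℂ :=
  (1 / (2 * Real.pi) : ℂ) * ∫ t : ℝ, F (c + t * Complex.I)

/-- The contour-integral approximation of order `L` of the outage probability; the contour for the
index `ℓ` is the line with real part `-κ ℓ`. -/
def contourOutage {M : ℕ} (K θ ρ : Fin (M + 1) → ℝ) (γth : ℝ) (L : Fin M → ℕ)
    (κ : (Fin M → ℕ) → ℝ) (γ : ℝ) : ℂ :=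
  1 - ∑ ℓ ∈ box L, (-1) ^ lam ℓ M *
    (∏ k : Fin M, (1 / ((ℓ k).factorial : ℂ)) *
      ((ρ k.castSucc / ρ (Fin.last M) : ℝ) : ℂ) ^ ℓ k) *
    verticalIntegral (contourIntegrand K θ ρ γth ℓ γ) (-κ ℓ)

/-! ### The high-SNR expansion -/

/-- The confluent hypergeometric function `₁F₁(a, b; x)`. -/
def kummer (a b x : ℝ) : ℝ :=
  ∑' k : ℕ, (ascPochhammer ℝ k).eval a / (ascPochhammer ℝ k).eval b * x ^ k / (k.factorial : ℝ)

/-- The function `ϱ`; it has a removable singularity at `s = 1`. -/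
def varrho {M : ℕ} (K : Fin (M + 1) → ℝ) (ℓ : Fin M → ℕ) (r : ℕ) (s : ℝ) : ℝ :=
  (s - 1) ^ r * (Real.Gamma ((lam ℓ M : ℝ) - s) / Real.Gamma (1 - s)) *
    ∏ n : Fin (M + 1),
      (Real.Gamma (1 + (lam ℓ n : ℝ) - s) * kummer (1 + (lam ℓ n : ℝ) - s) 1 (K n))

/-- The `k`-th derivative at `1` of `ϱ`, its removable singularity there being removed, that is, the
limit of the `k`-th derivative at `s` as `s → 1`, `s ≠ 1`. -/
def varrhoDeriv {M : ℕ} (K : Fin (M + 1) → ℝ) (ℓ : Fin M → ℕ) (r k : ℕ) : ℝ :=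
  limUnder (𝓝[≠] (1 : ℝ)) (iteratedDeriv k (varrho K ℓ r))

/-- The coefficient `ζ_ℓ`. -/
def zetaCoeff {M : ℕ} (K θ ρ : Fin (M + 1) → ℝ) (ℓ : Fin M → ℕ) : ℝ :=
  Real.exp (-K (Fin.last M)) *
    ∏ k : Fin M, Real.exp (-K k.castSucc) / ((ℓ k).factorial : ℝ) *
      (ρ k.castSucc / ρ (Fin.last M)) ^ ℓ k *
      (θ k.succ / (K k.succ + 1)) ^ lam ℓ ((k : ℕ) + 1)

/-- The constant `ρ_N γ_th ∏ (K_n + 1) / ∏ θ_n`. -/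
def baseConst {M : ℕ} (K θ ρ : Fin (M + 1) → ℝ) (γth : ℝ) : ℝ :=
  ρ (Fin.last M) * γth * (∏ n, (K n + 1)) / ∏ n, θ n

/-- The expansion of the outage probability in the functions `(log γ) ^ p / γ`. -/
def riceExpansion {M : ℕ} (K θ ρ : Fin (M + 1) → ℝ) (γth : ℝ) (L : Fin M → ℕ) (γ : ℝ) : ℝ :=
  baseConst K θ ρ γth *
    ∑ r ∈ Finset.Icc 1 (M + 1), ∑ ℓ ∈ indexSet L r,
      (-1) ^ lam ℓ M * zetaCoeff K θ ρ ℓ *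
        ∑ l ∈ Finset.range r,
          varrhoDeriv K ℓ r (r - 1 - l) / (((r - 1 - l).factorial : ℝ) * (l.factorial : ℝ)) *
            ∑ p ∈ Finset.range (l + 1),
              (l.choose p : ℝ) * (-1) ^ p * Real.log (baseConst K θ ρ γth) ^ (l - p) *
                (Real.log γ ^ p / γ)

/-- The leading-order term of the outage probability. -/
def riceLeading {M : ℕ} (K θ ρ : Fin (M + 1) → ℝ) (γth γ : ℝ) : ℝ :=
  ρ (Fin.last M) * γth / (M.factorial : ℝ) *
    (∏ n, (K n + 1) / (θ n * Real.exp (K n))) * (Real.log γ ^ M / γ)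

end MultihopRelay

end

/-!
Number the hops from `1` to `N` and put `ε = γth / γ`. Dividing the noise by `X₂ ⋯ X_N`, outage is
the event `X₁ < ε ∑ₙ Zₙ` with `Zₙ = ρₙ / (X₂ ⋯ Xₙ)`, so conditionally on the other hops its
probability is `F (ε ∑ₙ Zₙ)`, where `F` is the distribution function of `X₁`. Since `F` is
differentiable at `0` from the right, `F (ε ∑ₙ Zₙ)` is close to `∑ₙ F (ε Zₙ)`, and the mean of
`F (ε Zₙ)` is `P (X₁ ⋯ Xₙ < ρₙ ε)`, which is of order `(log γ) ^ (n - 1) / γ`; up to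
`o((log γ) ^ (N - 2) / γ)` only the last two of these products matter.

By Mellin inversion the distribution function of a product of the `Xₙ` is a contour integral of a
product of Gamma and Kummer functions, the same one that occurs for `ℓ = 0` in the contour-integral
expression. Moving the contour of the `ℓ`-integral into the strip `1 < Re s < 2` crosses a pole at
`0`, present only for `ℓ = 0` and compensating the `1`, and a pole at `1` whose order is the `r`
with `ℓ ∈ 𝓛_r`; its residue gives the powers of `log γ` in the expansion, and what remains is
`o(1 / γ)`.
The pole of order `N` at `ℓ = 0` gives the leading term. If all `Lₙ ≥ 2`, the index `(0, …, 0, 1)`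
contributes the leading term of the product of the first `N - 1` hops, whereas for `ℓ_{N-1} ≥ 2` the
top coefficient of the pole of order `N - 1` vanishes with `Γ(λ_{N-1} - s) / Γ(1 - s)`.
-/

namespace MultihopRelay

/-! ### The Gamma and Kummer functions -/

lemma norm_Gamma_le {s : ℂ} (hs : 0 < s.re) : ‖Complex.Gamma s‖ ≤ Real.Gamma s.re := by
  rw [Complex.Gamma_eq_integral hs, Complex.GammaIntegral, Real.Gamma_eq_integral hs]
  refine (norm_integral_le_integral_norm _).trans_eq ?_
  refine setIntegral_congr_fun measurableSet_Ioi fun x hx => ?_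
  simp only [norm_mul, Complex.norm_of_nonneg (Real.exp_pos _).le,
    Complex.norm_cpow_eq_rpow_re_of_pos hx, Complex.sub_re, Complex.one_re]

lemma norm_Gamma_le_div_pow (m : ℕ) {s : ℂ} (hs : 0 < s.re + m) (him : s.im ≠ 0) :
    ‖Complex.Gamma s‖ ≤ Real.Gamma (s.re + m) / |s.im| ^ m := by
  induction m generalizing s with
  | zero => simpa using norm_Gamma_le (s := s) (by simpa using hs)
  | succ m ih =>
    have hs_ne : s ≠ 0 := fun h => him (by simp [h])
    have hsucc := ih (s := s + 1) (by simpa [add_assoc, add_comm, add_left_comm] using hs)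
      (by simpa using him)
    have him_add : (s + 1).im = s.im := by simp
    rw [Complex.Gamma_add_one s hs_ne, norm_mul, him_add, le_div_iff₀ (by positivity)] at hsucc
    rw [le_div_iff₀ (by positivity)]
    calc ‖Complex.Gamma s‖ * |s.im| ^ (m + 1)
        = |s.im| * ‖Complex.Gamma s‖ * |s.im| ^ m := by ring
      _ ≤ ‖s‖ * ‖Complex.Gamma s‖ * |s.im| ^ m := by gcongr; exact Complex.abs_im_le_norm s
      _ ≤ Real.Gamma ((s + 1).re + m) := hsucc
      _ = Real.Gamma (s.re + (m + 1 : ℕ)) := by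
        congr 1
        push_cast
        rw [Complex.add_re, Complex.one_re]
        ring

lemma Gamma_add_natCast {a : ℝ} (ha : 0 < a) (k : ℕ) :
    Real.Gamma (a + k) = (ascPochhammer ℝ k).eval a * Real.Gamma a := by
  induction k with
  | zero => simp
  | succ k ih =>
    rw [Nat.cast_succ, ← add_assoc, Real.Gamma_add_one (by positivity), ih,
      ascPochhammer_succ_eval]
    ring

lemma ne_neg_natCast_of_re_pos {s : ℂ} (hs : 0 < s.re) (k : ℕ) : s ≠ -k := by
  rintro rfl
  simp only [Complex.neg_re, Complex.natCast_re, Left.neg_pos_iff] at hs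
  exact hs.not_ge k.cast_nonneg

/-- The Kummer function `₁F₁(s, 1; K)` as a function of a complex first parameter. -/
noncomputable def kummerC (K : ℝ) (s : ℂ) : ℂ :=
  ∑' k : ℕ, (ascPochhammer ℂ k).eval s * ((K : ℂ) ^ k / (k.factorial : ℂ) ^ 2)

lemma summable_pow_div_factorial_sq_mul_ascPochhammer (K R : ℝ) :
    Summable fun k : ℕ => K ^ k / (k.factorial : ℝ) ^ 2 * (ascPochhammer ℝ k).eval R := by
  have hratio : Tendsto (fun k : ℕ => |K| * ((|R| + k) / (k + 1) * (1 / (k + 1)))) atTop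
      (𝓝 (|K| * (1 * 0))) := by
    refine Tendsto.const_mul _ (Tendsto.mul ?_ tendsto_one_div_add_atTop_nhds_zero_nat)
    have h := (tendsto_one_div_add_atTop_nhds_zero_nat (𝕜 := ℝ)).const_mul (|R| - 1)
    refine ((h.const_add 1).congr fun k => ?_).trans_eq (by simp)
    field_simp
    ring
  rw [one_mul, mul_zero] at hratio
  refine summable_of_ratio_norm_eventually_le (r := 1 / 2) (by norm_num) ?_
  filter_upwards [hratio.eventually_le_const (by norm_num : (0 : ℝ) < 1 / 2)] with k hk
  have hstep : K ^ (k + 1) / ((k + 1).factorial : ℝ) ^ 2 * (ascPochhammer ℝ (k + 1)).eval R =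
      K * ((R + k) / (k + 1) * (1 / (k + 1))) *
        (K ^ k / (k.factorial : ℝ) ^ 2 * (ascPochhammer ℝ k).eval R) := by
    rw [ascPochhammer_succ_eval, Nat.factorial_succ]
    push_cast
    field_simp
    ring
  have hcast : |(k : ℝ) + 1| = k + 1 := abs_of_pos (by positivity)
  rw [hstep, norm_mul]
  refine mul_le_mul_of_nonneg_right (le_trans ?_ hk) (norm_nonneg _)
  simp only [Real.norm_eq_abs, abs_mul, abs_div, abs_one, hcast]
  gcongr
  exact (abs_add_le _ _).trans_eq (by rw [Nat.abs_cast])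

lemma summable_pow_div_factorial_sq_mul_Gamma (K : ℝ) {σ : ℝ} (hσ : 0 < σ) :
    Summable fun k : ℕ => K ^ k / (k.factorial : ℝ) ^ 2 * Real.Gamma (σ + k) := by
  simp only [Gamma_add_natCast hσ, ← mul_assoc]
  exact (summable_pow_div_factorial_sq_mul_ascPochhammer K σ).mul_right _

lemma norm_ascPochhammer_eval_le (k : ℕ) {s : ℂ} {R : ℝ} (hs : ‖s‖ ≤ R) :
    ‖(ascPochhammer ℂ k).eval s‖ ≤ (ascPochhammer ℝ k).eval R := by
  induction k with
  | zero => simp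
  | succ k ih =>
    rw [ascPochhammer_succ_eval, ascPochhammer_succ_eval, norm_mul]
    have hfactor : ‖s + k‖ ≤ R + k := (norm_add_le _ _).trans (by simpa using hs)
    exact mul_le_mul ih hfactor (norm_nonneg _) ((norm_nonneg _).trans ih)

lemma norm_kummerC_term_le (K : ℝ) (k : ℕ) {s : ℂ} {R : ℝ} (hs : ‖s‖ ≤ R) :
    ‖(ascPochhammer ℂ k).eval s * ((K : ℂ) ^ k / (k.factorial : ℂ) ^ 2)‖ ≤
      |K| ^ k / (k.factorial : ℝ) ^ 2 * (ascPochhammer ℝ k).eval R := by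
  rw [norm_mul, mul_comm, norm_div, norm_pow, norm_pow, Complex.norm_real, Real.norm_eq_abs,
    Complex.norm_natCast]
  exact mul_le_mul_of_nonneg_left (norm_ascPochhammer_eval_le k hs) (by positivity)

lemma hasSum_kummerC (K : ℝ) (s : ℂ) :
    HasSum (fun k : ℕ => (ascPochhammer ℂ k).eval s * ((K : ℂ) ^ k / (k.factorial : ℂ) ^ 2))
      (kummerC K s) :=
  (Summable.of_norm_bounded (summable_pow_div_factorial_sq_mul_ascPochhammer |K| ‖s‖)
    fun k => norm_kummerC_term_le K k le_rfl).hasSum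

lemma differentiable_kummerC (K : ℝ) : Differentiable ℂ (kummerC K) := by
  intro s
  have hball : DifferentiableOn ℂ (kummerC K) (Metric.ball 0 (‖s‖ + 1)) := by
    refine Complex.differentiableOn_tsum_of_summable_norm
      (summable_pow_div_factorial_sq_mul_ascPochhammer |K| (‖s‖ + 1))
      (fun k => ((Polynomial.differentiable _).mul_const _).differentiableOn)
      Metric.isOpen_ball fun k w hw => norm_kummerC_term_le K k ?_
    simpa using (Metric.mem_ball.mp hw).le
  exact hball.differentiableAt (Metric.isOpen_ball.mem_nhds (by simp))

lemma kummerC_zero (K : ℝ) : kummerC K 0 = 1 := by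
  rw [kummerC, tsum_eq_single 0]
  · simp
  · intro k hk
    rw [ascPochhammer_ne_zero_eval_zero _ hk, zero_mul]

lemma kummerC_one (K : ℝ) : kummerC K 1 = Complex.exp K := by
  rw [kummerC, Complex.exp_eq_exp_ℂ, NormedSpace.exp_eq_tsum_div]
  refine tsum_congr fun k => ?_
  rw [ascPochhammer_eval_one]
  have hfact : (k.factorial : ℂ) ≠ 0 := Nat.cast_ne_zero.mpr k.factorial_ne_zero
  field_simp

lemma ofReal_ascPochhammer_eval (k : ℕ) (a : ℝ) :
    (((ascPochhammer ℝ k).eval a : ℝ) : ℂ) = (ascPochhammer ℂ k).eval (a : ℂ) := by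
  rw [← Complex.ofRealHom_eq_coe, ← Complex.ofRealHom_eq_coe, ← Polynomial.eval_map_apply,
    ascPochhammer_map]

lemma ofReal_kummer (K a : ℝ) : ((kummer a 1 K : ℝ) : ℂ) = kummerC K a := by
  rw [kummer, kummerC, Complex.ofReal_tsum]
  refine tsum_congr fun k => ?_
  rw [ascPochhammer_eval_one]
  push_cast
  rw [ofReal_ascPochhammer_eval]
  ring

lemma kummer_pos {K a : ℝ} (hK : 0 ≤ K) (ha : 0 < a) : 0 < kummer a 1 K := by
  have hsum : Summable fun k : ℕ =>
      (ascPochhammer ℝ k).eval a / (ascPochhammer ℝ k).eval 1 * K ^ k / (k.factorial : ℝ) := by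
    refine (summable_pow_div_factorial_sq_mul_ascPochhammer K a).congr fun k => ?_
    rw [ascPochhammer_eval_one]
    ring
  refine hsum.tsum_pos (fun k => ?_) 0 (by simp)
  have := ascPochhammer_pos k a ha
  have := ascPochhammer_pos k (1 : ℝ) one_pos
  positivity

/-- `Γ(s) ₁F₁(s, 1; K)`, which is the Mellin transform of a Rician power density up to
elementary factors. -/
noncomputable def gammaKummer (K : ℝ) (s : ℂ) : ℂ := Complex.Gamma s * kummerC K s

lemma hasSum_gammaKummer (K : ℝ) {s : ℂ} (hs : ∀ k : ℕ, s ≠ -k) :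
    HasSum (fun k : ℕ => (K : ℂ) ^ k / (k.factorial : ℂ) ^ 2 * Complex.Gamma (s + k))
      (gammaKummer K s) := by
  have hGamma : Complex.Gamma s ≠ 0 := Complex.Gamma_ne_zero hs
  refine ((hasSum_kummerC K s).mul_left (Complex.Gamma s)).congr_fun fun k => ?_
  rw [← Complex.Gamma_add_nat_div_Gamma_eq s hs]
  field_simp

lemma differentiableAt_gammaKummer (K : ℝ) {s : ℂ} (hs : 0 < s.re) :
    DifferentiableAt ℂ (gammaKummer K) s :=
  (Complex.differentiableAt_Gamma s (ne_neg_natCast_of_re_pos hs)).mul (differentiable_kummerC K s)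

lemma gammaKummer_ofReal_ne_zero {K : ℝ} (hK : 0 ≤ K) {σ : ℝ} (hσ : 0 < σ) :
    gammaKummer K σ ≠ 0 := by
  rw [gammaKummer, Complex.Gamma_ofReal, ← ofReal_kummer]
  exact_mod_cast mul_ne_zero (Real.Gamma_pos_of_pos hσ).ne' (kummer_pos hK hσ).ne'

/-- Termwise, `Γ(s + k)` is `Γ(s + k + p)` divided by `p` factors of modulus at least `|im s|`. -/
lemma exists_norm_gammaKummer_le (K σ₁ σ₂ : ℝ) (m : ℕ) :
    ∃ C : ℝ, ∀ s : ℂ, σ₁ ≤ s.re → s.re ≤ σ₂ → 1 ≤ |s.im| →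
      ‖gammaKummer K s‖ ≤ C / |s.im| ^ m := by
  obtain hσ | hσ := lt_or_ge σ₂ σ₁
  · exact ⟨0, fun s h₁ h₂ => absurd (h₁.trans h₂) hσ.not_ge⟩
  obtain ⟨q, hq⟩ := exists_nat_ge (2 - σ₁)
  set p := m + q
  have hp : 2 ≤ σ₁ + p := by
    have : (q : ℝ) ≤ p := Nat.cast_le.mpr (Nat.le_add_left q m)
    linarith
  refine ⟨∑' k : ℕ, |K| ^ k / (k.factorial : ℝ) ^ 2 * Real.Gamma (σ₂ + p + k),
    fun s h₁ h₂ him => ?_⟩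
  have him_ne : s.im ≠ 0 := abs_pos.mp (one_pos.trans_le him)
  have hterm (k : ℕ) : ‖(K : ℂ) ^ k / (k.factorial : ℂ) ^ 2 * Complex.Gamma (s + k)‖ ≤
      |K| ^ k / (k.factorial : ℝ) ^ 2 * Real.Gamma (σ₂ + p + k) / |s.im| ^ m := by
    have : (0 : ℝ) ≤ k := k.cast_nonneg
    have hre : (s + k).re = s.re + k := by simp
    have him_add : (s + k).im = s.im := by simp
    rw [norm_mul, norm_div, norm_pow, norm_pow, Complex.norm_real, Real.norm_eq_abs,
      Complex.norm_natCast, mul_div_assoc]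
    gcongr
    calc ‖Complex.Gamma (s + k)‖
        ≤ Real.Gamma ((s + k).re + p) / |(s + k).im| ^ p :=
          norm_Gamma_le_div_pow p (by linarith) (by rwa [him_add])
      _ ≤ Real.Gamma (σ₂ + p + k) / |s.im| ^ m := by
          rw [hre, him_add]
          gcongr ?_ / ?_
          · exact Real.Gamma_nonneg_of_nonneg (by linarith)
          · exact Real.Gamma_strictMonoOn_Ici.monotoneOn (Set.mem_Ici.mpr (by linarith))
              (Set.mem_Ici.mpr (by linarith)) (by linarith)
          · exact pow_le_pow_right₀ him (Nat.le_add_right m q)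
  rw [← (hasSum_gammaKummer K fun k h => him_ne (by simp [h])).tsum_eq, ← tsum_div_const]
  exact tsum_of_norm_bounded ((summable_pow_div_factorial_sq_mul_Gamma |K|
    (by linarith : 0 < σ₂ + p)).div_const _).hasSum hterm

/-! ### The Rician power density and its Mellin transform -/

lemma hasSum_besselI0 (y : ℝ) :
    HasSum (fun k : ℕ => (y / 2) ^ (2 * k) / (k.factorial : ℝ) ^ 2) (besselI0 y) := by
  refine (Summable.of_nonneg_of_le (fun k => ?_) (fun k => ?_)
    (Real.summable_pow_div_factorial ((y / 2) ^ 2))).hasSum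
  · rw [pow_mul]
    positivity
  · rw [pow_mul]
    gcongr
    exact le_self_pow₀ (mod_cast k.factorial_pos) two_ne_zero

lemma besselI0_nonneg (y : ℝ) : 0 ≤ besselI0 y :=
  (hasSum_besselI0 y).nonneg fun k => by rw [pow_mul]; positivity

lemma continuous_besselI0 : Continuous besselI0 := by
  refine continuous_iff_continuousAt.mpr fun y => ?_
  have hball : ContinuousOn besselI0 (Metric.ball 0 (|y| + 1)) := by
    refine continuousOn_tsum (fun k => by fun_prop)
      (hasSum_besselI0 (|y| + 1)).summable fun k x hx => ?_
    have hx' : |x / 2| ≤ |(|y| + 1) / 2| := by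
      rw [abs_div, abs_div, abs_of_pos (by positivity : 0 < |y| + 1)]
      gcongr
      simpa using (Metric.mem_ball.mp hx).le
    rw [Real.norm_of_nonneg (by rw [pow_mul]; positivity), pow_mul, pow_mul]
    gcongr ?_ / _
    exact pow_le_pow_left₀ (sq_nonneg _) (sq_le_sq.mpr hx') k
  exact hball.continuousAt (Metric.isOpen_ball.mem_nhds (by simp))

lemma ricianPDF_nonneg {K θ : ℝ} (hK : 0 ≤ K) (hθ : 0 < θ) (x : ℝ) : 0 ≤ ricianPDF K θ x := by
  unfold ricianPDF
  split_ifs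
  · exact mul_nonneg (by positivity) (besselI0_nonneg _)
  · exact le_rfl

lemma continuousOn_ricianPDF (K θ : ℝ) : ContinuousOn (ricianPDF K θ) (Set.Ici 0) := by
  have hcont : Continuous fun x => θ⁻¹ * (K + 1) * Real.exp (-(K + θ⁻¹ * (K + 1) * x)) *
      besselI0 (Real.sqrt (4 * K * (K + 1) * x / θ)) :=
    Continuous.mul (by fun_prop) (continuous_besselI0.comp (by fun_prop))
  exact hcont.continuousOn.congr fun x hx => if_pos (Set.mem_Ici.mp hx)

lemma measurable_ricianPDF (K θ : ℝ) : Measurable (ricianPDF K θ) :=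
  Measurable.ite measurableSet_Ici
    (Measurable.mul (by fun_prop) (continuous_besselI0.measurable.comp (by fun_prop)))
    measurable_const

/-- A Rician power is a Poisson mixture of Gamma variables. -/
lemma hasSum_ricianPDF {K θ x : ℝ} (hK : 0 ≤ K) (hθ : 0 < θ) (hx : 0 ≤ x) :
    HasSum (fun k : ℕ => Real.exp (-K) * ((K + 1) / θ) * (K ^ k / (k.factorial : ℝ) ^ 2 *
      ((K + 1) / θ * x) ^ k * Real.exp (-((K + 1) / θ * x)))) (ricianPDF K θ x) := by
  rw [ricianPDF, if_pos hx]
  refine ((hasSum_besselI0 (Real.sqrt (4 * K * (K + 1) * x / θ))).mul_left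
    (θ⁻¹ * (K + 1) * Real.exp (-(K + θ⁻¹ * (K + 1) * x)))).congr_fun fun k => ?_
  rw [pow_mul, div_pow, Real.sq_sqrt (by positivity), neg_add, Real.exp_add,
    show 4 * K * (K + 1) * x / θ / 2 ^ 2 = K * ((K + 1) / θ * x) by ring, mul_pow K,
    show θ⁻¹ * (K + 1) = (K + 1) / θ by ring]
  ring

lemma hasSum_mellin_pow_mul_exp_neg {a : ℕ → ℂ} {f : ℝ → ℂ} {s : ℂ} (hs : 0 < s.re)
    (hf : ∀ t : ℝ, 0 < t → HasSum (fun k => a k * (t : ℂ) ^ k * Complex.exp (-t)) (f t))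
    (ha : Summable fun k : ℕ => ‖a k‖ * Real.Gamma (s.re + k)) :
    HasSum (fun k : ℕ => a k * Complex.Gamma (s + k)) (mellin f s) := by
  have hre (k : ℕ) : 0 < (s + k).re := by
    rw [Complex.add_re, Complex.natCast_re]
    positivity
  have hGamma (k : ℕ) := Complex.GammaIntegral_convergent (hre k)
  have hnorm (k : ℕ) : ∫ t in Set.Ioi (0 : ℝ), ‖a k * (Complex.exp (-t) * (t : ℂ) ^ (s + k - 1))‖ =
      ‖a k‖ * Real.Gamma (s.re + k) := by
    rw [Real.Gamma_eq_integral (by simpa using hre k), ← integral_const_mul]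
    refine setIntegral_congr_fun measurableSet_Ioi fun t ht => ?_
    simp [Complex.norm_exp, Complex.norm_cpow_eq_rpow_re_of_pos ht]
  have hsum := hasSum_integral_of_summable_integral_norm (μ := volume.restrict (Set.Ioi (0 : ℝ)))
    (F := fun k t => a k * (Complex.exp (-t) * (t : ℂ) ^ (s + k - 1)))
    (fun k => by simpa using (hGamma k).const_mul (a k)) (by simpa only [hnorm] using ha)
  simp only [integral_const_mul] at hsum
  convert! hsum using 2 with k
  · rw [Complex.Gamma_eq_integral (hre k), Complex.GammaIntegral]
    simp
  · refine setIntegral_congr_fun measurableSet_Ioi fun t ht => ?_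
    have ht_ne : (t : ℂ) ≠ 0 := Complex.ofReal_ne_zero.mpr (ne_of_gt ht)
    simp only [smul_eq_mul]
    rw [← (hf t ht).tsum_eq, ← tsum_mul_left]
    refine tsum_congr fun k => ?_
    rw [show s + k - 1 = s - 1 + k by ring, Complex.cpow_add _ _ ht_ne, Complex.cpow_natCast]
    ring

lemma mellin_ricianPDF {K θ : ℝ} (hK : 0 ≤ K) (hθ : 0 < θ) {s : ℂ} (hs : 0 < s.re) :
    mellin (fun x => (ricianPDF K θ x : ℂ)) s =
      Complex.exp (-K) * (((K + 1) / θ : ℝ) : ℂ) ^ (1 - s) * gammaKummer K s := by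
  set b : ℝ := (K + 1) / θ with hb
  have hb_pos : 0 < b := by positivity
  have hb_ne : (b : ℂ) ≠ 0 := Complex.ofReal_ne_zero.mpr hb_pos.ne'
  set g : ℝ → ℂ := fun t => ((b⁻¹ * Real.exp K * ricianPDF K θ (b⁻¹ * t) : ℝ) : ℂ) with hg
  have hscale (x : ℝ) : (ricianPDF K θ x : ℂ) = (Complex.exp (-K) * b) • g (b * x) := by
    simp only [hg, smul_eq_mul, inv_mul_cancel_left₀ hb_pos.ne']
    push_cast
    field_simp
    rw [mul_assoc, ← Complex.exp_add, neg_add_cancel, Complex.exp_zero, mul_one]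
  have hg_mellin : mellin g s = gammaKummer K s := by
    refine (hasSum_mellin_pow_mul_exp_neg hs (fun t ht => ?_) ?_).unique
      (hasSum_gammaKummer K (ne_neg_natCast_of_re_pos hs))
    · refine (Complex.hasSum_ofReal.mpr ((hasSum_ricianPDF hK hθ (x := b⁻¹ * t)
        (by positivity)).mul_left (b⁻¹ * Real.exp K))).congr_fun fun k => ?_
      rw [← hb, mul_inv_cancel_left₀ hb_pos.ne']
      push_cast
      rw [Complex.exp_neg K]
      field_simp [Complex.exp_ne_zero]
    · simpa [abs_of_nonneg hK] using summable_pow_div_factorial_sq_mul_Gamma K hs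
  calc mellin (fun x => (ricianPDF K θ x : ℂ)) s
      = (Complex.exp (-K) * b) • mellin (fun x => g (b * x)) s := by
        simp only [hscale]
        exact mellin_const_smul _ s _
    _ = Complex.exp (-K) * (b : ℂ) ^ (1 - s) * gammaKummer K s := by
        rw [mellin_comp_mul_left _ _ hb_pos, hg_mellin, smul_eq_mul, smul_eq_mul,
          Complex.cpow_sub _ _ hb_ne, Complex.cpow_one, Complex.cpow_neg]
        ring

/-! ### Integrals along vertical lines and residues -/

lemma integrable_of_norm_le_div_sq {f : ℝ → ℂ} (hf : Continuous f) {C : ℝ}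
    (hC : ∀ t : ℝ, 1 ≤ |t| → ‖f t‖ ≤ C / t ^ 2) : Integrable f := by
  have hlarge : ∀ᶠ t : ℝ in cocompact ℝ, 1 ≤ |t| :=
    (tendsto_norm_cocompact_atTop (E := ℝ)).eventually_ge_atTop 1
  refine hf.locallyIntegrable.integrable_of_isBigO_cocompact (g := fun t : ℝ => (1 + t ^ 2)⁻¹)
    (IsBigO.of_bound (2 * C) (hlarge.mono fun t ht => ?_))
    (integrable_inv_one_add_sq.integrableAtFilter _)
  have hC_nonneg : 0 ≤ C := by simpa using (norm_nonneg _).trans (hC 1 (by simp))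
  have ht_sq : 1 ≤ t ^ 2 := by simpa using (one_le_sq_iff_one_le_abs t).mpr ht
  rw [Real.norm_of_nonneg (by positivity), ← div_eq_mul_inv]
  refine (hC t ht).trans ((div_le_div_iff₀ (by positivity) (by positivity)).mpr ?_)
  nlinarith

lemma verticalIntegral_congr {F G : ℂ → ℂ} {c : ℝ} (h : ∀ s : ℂ, s.re = c → F s = G s) :
    verticalIntegral F c = verticalIntegral G c := by
  have hline (t : ℝ) : F (c + t * Complex.I) = G (c + t * Complex.I) := h _ (by simp)
  simp only [verticalIntegral, hline]

lemma verticalIntegral_const_mul (a : ℂ) (F : ℂ → ℂ) (c : ℝ) :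
    verticalIntegral (fun s => a * F s) c = a * verticalIntegral F c := by
  simp only [verticalIntegral, integral_const_mul, mul_left_comm]

lemma verticalIntegral_add {F G : ℂ → ℂ} {c : ℝ}
    (hF : Integrable fun t : ℝ => F (c + t * Complex.I))
    (hG : Integrable fun t : ℝ => G (c + t * Complex.I)) :
    verticalIntegral (fun s => F s + G s) c = verticalIntegral F c + verticalIntegral G c := by
  simp only [verticalIntegral, integral_add hF hG, mul_add]

lemma tendsto_integral_horizontal {F : ℂ → ℂ} {c₁ c₂ C : ℝ} (hc : c₁ ≤ c₂)
    (hdecay : ∀ s : ℂ, c₁ ≤ s.re → s.re ≤ c₂ → 1 ≤ |s.im| → ‖F s‖ ≤ C / s.im ^ 2) :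
    Tendsto (fun T : ℝ => ∫ x in c₁..c₂, F (x + T * Complex.I)) (cocompact ℝ) (𝓝 0) := by
  have hbound : Tendsto (fun T : ℝ => C / T ^ 2 * |c₂ - c₁|) (cocompact ℝ) (𝓝 0) := by
    have hsq : Tendsto (fun T : ℝ => T ^ 2) (cocompact ℝ) atTop := by
      refine ((tendsto_pow_atTop two_ne_zero).comp
        (tendsto_norm_cocompact_atTop (E := ℝ))).congr fun T => ?_
      simp
    simpa using ((tendsto_const_nhds (x := C)).div_atTop hsq).mul_const |c₂ - c₁|
  refine squeeze_zero_norm' ?_ hbound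
  filter_upwards [(tendsto_norm_cocompact_atTop (E := ℝ)).eventually_ge_atTop 1] with T hT
  refine intervalIntegral.norm_integral_le_of_norm_le_const fun x hx => ?_
  rw [Set.uIoc_of_le hc] at hx
  simpa using hdecay (x + T * Complex.I) (by simpa using hx.1.le) (by simpa using hx.2)
    (by simpa using hT)

lemma integrable_vertical {F : ℂ → ℂ} {c₁ c₂ c C : ℝ} (h₁ : c₁ ≤ c) (h₂ : c ≤ c₂)
    (hF : ContinuousOn F (Complex.re ⁻¹' Set.Icc c₁ c₂))
    (hdecay : ∀ s : ℂ, c₁ ≤ s.re → s.re ≤ c₂ → 1 ≤ |s.im| → ‖F s‖ ≤ C / s.im ^ 2) :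
    Integrable fun t : ℝ => F (c + t * Complex.I) :=
  integrable_of_norm_le_div_sq
    (hF.comp_continuous (by fun_prop) fun t => by simp [h₁, h₂])
    fun t ht => by simpa using hdecay (c + t * Complex.I) (by simpa) (by simpa) (by simpa)

lemma verticalIntegral_eq_of_differentiableOn {F : ℂ → ℂ} {c₁ c₂ C : ℝ} (hc : c₁ ≤ c₂)
    (hF : DifferentiableOn ℂ F (Complex.re ⁻¹' Set.Icc c₁ c₂))
    (hdecay : ∀ s : ℂ, c₁ ≤ s.re → s.re ≤ c₂ → 1 ≤ |s.im| → ‖F s‖ ≤ C / s.im ^ 2) :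
    verticalIntegral F c₂ = verticalIntegral F c₁ := by
  have hvertical {c : ℝ} (h₁ : c₁ ≤ c) (h₂ : c ≤ c₂) :
      Tendsto (fun T : ℝ => ∫ t in (-T)..T, F (c + t * Complex.I)) atTop
        (𝓝 (∫ t : ℝ, F (c + t * Complex.I))) :=
    intervalIntegral_tendsto_integral (integrable_vertical h₁ h₂ hF.continuousOn hdecay)
      tendsto_neg_atTop_atBot tendsto_id
  have hhorizontal := tendsto_integral_horizontal hc hdecay
  have hrect (T : ℝ) : (∫ x in c₁..c₂, F (x + (-T : ℝ) * Complex.I)) -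
      (∫ x in c₁..c₂, F (x + T * Complex.I)) +
      Complex.I • (∫ t in (-T)..T, F (c₂ + t * Complex.I)) -
      Complex.I • (∫ t in (-T)..T, F (c₁ + t * Complex.I)) = 0 := by
    simpa using Complex.integral_boundary_rect_eq_zero_of_differentiableOn F ⟨c₁, -T⟩ ⟨c₂, T⟩
      (hF.mono fun s hs => by simpa [Set.uIcc_of_le hc] using hs.1)
  have hlim := (((hhorizontal.comp (tendsto_neg_atTop_atBot.mono_right atBot_le_cocompact)).sub
    (hhorizontal.comp (tendsto_id.mono_right atTop_le_cocompact))).add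
    ((hvertical hc le_rfl).const_smul Complex.I)).sub ((hvertical le_rfl hc).const_smul Complex.I)
  have hzero := tendsto_nhds_unique (hlim.congr fun T => hrect T) tendsto_const_nhds
  rw [sub_self, zero_add, sub_eq_zero, smul_right_inj Complex.I_ne_zero] at hzero
  rw [verticalIntegral, verticalIntegral, hzero]

lemma vertical_sub_ne_zero {c p : ℝ} (hcp : c ≠ p) (t : ℝ) : (c : ℂ) + t * Complex.I - p ≠ 0 :=
  fun h => hcp (by simpa [sub_eq_zero] using congrArg Complex.re h)

lemma norm_inv_sub_pow_le (p : ℝ) (k : ℕ) {s : ℂ} (hs : 1 ≤ |s.im|) :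
    ‖((s - p) ^ (k + 2))⁻¹‖ ≤ 1 / s.im ^ 2 := by
  have him : |s.im| ≤ ‖s - p‖ := by simpa using Complex.abs_im_le_norm (s - p)
  rw [norm_inv, norm_pow, ← one_div, ← sq_abs]
  refine one_div_le_one_div_of_le (by positivity) ?_
  calc |s.im| ^ 2 ≤ |s.im| ^ (k + 2) := pow_le_pow_right₀ hs (Nat.le_add_left 2 k)
    _ ≤ ‖s - p‖ ^ (k + 2) := by gcongr

lemma integrable_vertical_inv_sub_pow {c p : ℝ} (hcp : c ≠ p) (k : ℕ) :
    Integrable fun t : ℝ => ((c + t * Complex.I - p : ℂ) ^ (k + 2))⁻¹ :=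
  integrable_of_norm_le_div_sq
    (Continuous.inv₀ (by fun_prop) fun t => pow_ne_zero _ (vertical_sub_ne_zero hcp t))
    (C := 1)
    fun t ht => by simpa using norm_inv_sub_pow_le p k (s := c + t * Complex.I) (by simpa using ht)

lemma tendsto_vertical_inv_sub_pow (c p : ℝ) (k : ℕ) :
    Tendsto (fun t : ℝ => ((c + t * Complex.I - p : ℂ) ^ (k + 1))⁻¹) (cocompact ℝ) (𝓝 0) := by
  have hnorm : Tendsto (fun t : ℝ => ‖(c + t * Complex.I - p : ℂ)‖) (cocompact ℝ) atTop := by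
    refine tendsto_atTop_mono (fun t => ?_) (tendsto_norm_cocompact_atTop (E := ℝ))
    simpa using Complex.abs_im_le_norm (c + t * Complex.I - p)
  rw [tendsto_zero_iff_norm_tendsto_zero]
  refine ((tendsto_pow_atTop k.succ_ne_zero).comp hnorm).inv_tendsto_atTop.congr fun t => ?_
  simp

lemma verticalIntegral_inv_sub_pow {c p : ℝ} (hcp : c ≠ p) (k : ℕ) :
    verticalIntegral (fun s => ((s - p) ^ (k + 2))⁻¹) c = 0 := by
  have hderiv (t : ℝ) : HasDerivAt
      (fun t : ℝ => (Complex.I / (k + 1)) * ((c + t * Complex.I - p : ℂ) ^ (k + 1))⁻¹)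
      ((c + t * Complex.I - p : ℂ) ^ (k + 2))⁻¹ t := by
    have hne := vertical_sub_ne_zero hcp t
    have hline : HasDerivAt (fun t : ℝ => (c + t * Complex.I - p : ℂ)) Complex.I t := by
      simpa using (((Complex.ofRealCLM.hasDerivAt (x := t)).mul_const Complex.I).const_add
        (c : ℂ)).sub_const (p : ℂ)
    convert! ((hline.fun_pow (k + 1)).fun_inv (pow_ne_zero _ hne)).const_mul
      (Complex.I / (k + 1)) using 1
    have hk : (k : ℂ) + 1 ≠ 0 := Nat.cast_add_one_ne_zero k
    simp only [Nat.add_sub_cancel, Nat.cast_add, Nat.cast_one]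
    field_simp
    rw [Complex.I_sq]
    ring
  have hlim : Tendsto
      (fun t : ℝ => (Complex.I / (k + 1)) * ((c + t * Complex.I - p : ℂ) ^ (k + 1))⁻¹)
      (cocompact ℝ) (𝓝 0) := by
    simpa using (tendsto_vertical_inv_sub_pow c p k).const_mul (Complex.I / (k + 1))
  rw [verticalIntegral, integral_of_hasDerivAt_of_tendsto hderiv
    (integrable_vertical_inv_sub_pow hcp k) (hlim.mono_left atBot_le_cocompact)
    (hlim.mono_left atTop_le_cocompact), sub_self, mul_zero]

lemma div_sq_add_sq_eq {a : ℝ} (ha : a ≠ 0) (t : ℝ) :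
    a / (a ^ 2 + t ^ 2) = a⁻¹ * (1 + (a⁻¹ * t) ^ 2)⁻¹ := by
  field_simp

lemma integrable_div_sq_add_sq {a : ℝ} (ha : a ≠ 0) :
    Integrable fun t : ℝ => a / (a ^ 2 + t ^ 2) := by
  simp only [div_sq_add_sq_eq ha]
  exact (integrable_inv_one_add_sq.comp_mul_left' (inv_ne_zero ha)).const_mul _

lemma integral_univ_div_sq_add_sq {a : ℝ} (ha : a ≠ 0) :
    ∫ t : ℝ, a / (a ^ 2 + t ^ 2) = Real.pi * SignType.sign a := by
  simp only [div_sq_add_sq_eq ha]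
  rw [integral_const_mul, Measure.integral_comp_mul_left (fun t => (1 + t ^ 2)⁻¹),
    integral_univ_inv_one_add_sq, inv_inv, smul_eq_mul, ← mul_assoc, mul_comm Real.pi]
  congr 1
  rw [inv_mul_eq_div, div_eq_iff ha, sign_mul_self]

lemma norm_inv_sub_sub_inv_sub_le (p q : ℝ) {s : ℂ} (hs : 1 ≤ |s.im|) :
    ‖(s - p)⁻¹ - (s - q)⁻¹‖ ≤ |p - q| / s.im ^ 2 := by
  have hnorm (a : ℝ) : |s.im| ≤ ‖s - a‖ := by simpa using Complex.abs_im_le_norm (s - a)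
  have hne (a : ℝ) : s - a ≠ 0 := norm_pos_iff.mp ((one_pos.trans_le hs).trans_le (hnorm a))
  have hpq : ‖(p : ℂ) - q‖ = |p - q| := by
    rw [← Complex.ofReal_sub, Complex.norm_real, Real.norm_eq_abs]
  rw [inv_sub_inv (hne p) (hne q), sub_sub_sub_cancel_left, norm_div, norm_mul, hpq, ← sq_abs,
    sq]
  gcongr <;> exact hnorm _

lemma integrable_vertical_inv_sub_sub_inv_sub {c p q : ℝ} (hp : c ≠ p) (hq : c ≠ q) :
    Integrable fun t : ℝ => (c + t * Complex.I - p : ℂ)⁻¹ - (c + t * Complex.I - q : ℂ)⁻¹ :=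
  integrable_of_norm_le_div_sq
    ((Continuous.inv₀ (by fun_prop) (vertical_sub_ne_zero hp)).sub
      (Continuous.inv₀ (by fun_prop) (vertical_sub_ne_zero hq)))
    fun t ht => by
      simpa using norm_inv_sub_sub_inv_sub_le p q (s := c + t * Complex.I) (by simpa using ht)

lemma inv_add_mul_I_add_inv_sub_mul_I {a : ℝ} (ha : a ≠ 0) (t : ℝ) :
    (a + t * Complex.I : ℂ)⁻¹ + (a + (-t : ℝ) * Complex.I : ℂ)⁻¹ =
      ((2 * (a / (a ^ 2 + t ^ 2)) : ℝ) : ℂ) := by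
  have hne (u : ℝ) : (a + u * Complex.I : ℂ) ≠ 0 := fun h =>
    ha (by simpa using congrArg Complex.re h)
  have hmul : (a + t * Complex.I : ℂ) * (a + (-t : ℝ) * Complex.I) = (a ^ 2 + t ^ 2 : ℝ) := by
    push_cast
    linear_combination -(t : ℂ) ^ 2 * Complex.I_sq
  rw [inv_add_inv (hne t) (hne (-t)), hmul]
  push_cast
  ring

/-- The odd imaginary part of the integrand is removed by averaging it with its reflection. -/
lemma verticalIntegral_inv_sub_sub_inv_sub {c p q : ℝ} (hp : c ≠ p) (hq : c ≠ q) :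
    verticalIntegral (fun s => (s - p)⁻¹ - (s - q)⁻¹) c =
      ((SignType.sign (c - p) : ℝ) - (SignType.sign (c - q) : ℝ)) / 2 := by
  set f : ℝ → ℂ := fun t => (c + t * Complex.I - p : ℂ)⁻¹ - (c + t * Complex.I - q : ℂ)⁻¹
  have hf : Integrable f := integrable_vertical_inv_sub_sub_inv_sub hp hq
  have hsymm (t : ℝ) : f t + f (-t) = ((2 * ((c - p) / ((c - p) ^ 2 + t ^ 2) -
      (c - q) / ((c - q) ^ 2 + t ^ 2)) : ℝ) : ℂ) := by
    rw [mul_sub, Complex.ofReal_sub, ← inv_add_mul_I_add_inv_sub_mul_I (sub_ne_zero.mpr hp),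
      ← inv_add_mul_I_add_inv_sub_mul_I (sub_ne_zero.mpr hq)]
    simp only [f, Complex.ofReal_sub, Complex.ofReal_neg, sub_add_eq_add_sub]
    ring
  have hdouble : 2 * ∫ t : ℝ, f t =
      2 * (Real.pi * ((SignType.sign (c - p) : ℝ) - (SignType.sign (c - q) : ℝ)) : ℂ) :=
    calc 2 * ∫ t : ℝ, f t = ∫ t : ℝ, f t + f (-t) := by
          rw [integral_add hf hf.comp_neg, integral_neg_eq_self, two_mul]
      _ = _ := by
          simp only [hsymm]
          rw [integral_complex_ofReal, integral_const_mul,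
            integral_sub (integrable_div_sq_add_sq (sub_ne_zero.mpr hp))
              (integrable_div_sq_add_sq (sub_ne_zero.mpr hq)),
            integral_univ_div_sq_add_sq (sub_ne_zero.mpr hp),
            integral_univ_div_sq_add_sq (sub_ne_zero.mpr hq)]
          push_cast
          ring
  have hpi : (Real.pi : ℂ) ≠ 0 := Complex.ofReal_ne_zero.mpr Real.pi_ne_zero
  rw [verticalIntegral, mul_left_cancel₀ two_ne_zero hdouble]
  field_simp

lemma iterate_dslope_eq_iteratedDeriv_div {h : ℂ → ℂ} {p : ℂ} (hh : AnalyticAt ℂ h p) (r : ℕ) :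
    ((Function.swap dslope p)^[r] h) p = iteratedDeriv r h p / r.factorial := by
  have hseries := hh.hasFPowerSeriesAt.has_fpower_series_iterate_dslope_fslope r
  rw [← hseries.coeff_zero 1, ← FormalMultilinearSeries.coeff,
    FormalMultilinearSeries.coeff_iterate_fslope, zero_add,
    FormalMultilinearSeries.coeff_ofScalars]

lemma div_sub_pow_succ_eq (h : ℂ → ℂ) {p s : ℂ} (hs : s ≠ p) (r : ℕ) :
    h s / (s - p) ^ (r + 1) = h p * ((s - p) ^ (r + 1))⁻¹ + dslope h p s / (s - p) ^ r := by
  have hsub : s - p ≠ 0 := sub_ne_zero.mpr hs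
  rw [dslope_of_ne _ hs, slope_def_field]
  field_simp
  ring

section Residue

variable {h : ℂ → ℂ} {c₁ c₂ p C : ℝ}

lemma differentiableOn_dslope_strip (h₁ : c₁ < p) (h₂ : p < c₂)
    (hh : DifferentiableOn ℂ h (Complex.re ⁻¹' Set.Icc c₁ c₂)) :
    DifferentiableOn ℂ (dslope h p) (Complex.re ⁻¹' Set.Icc c₁ c₂) :=
  (Complex.differentiableOn_dslope (Complex.continuous_re.continuousAt.preimage_mem_nhds
    (by simpa using Icc_mem_nhds h₁ h₂))).mpr hh

/-- Subtracting `h p (1 / (s - p) - 1 / (s - q))` with `q` outside the strip leaves a holomorphic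
function without spoiling the decay. -/
lemma verticalIntegral_div_sub_sub_verticalIntegral (h₁ : c₁ < p) (h₂ : p < c₂)
    (hh : DifferentiableOn ℂ h (Complex.re ⁻¹' Set.Icc c₁ c₂))
    (hdecay : ∀ s : ℂ, c₁ ≤ s.re → s.re ≤ c₂ → 1 ≤ |s.im| → ‖h s / (s - p)‖ ≤ C / s.im ^ 2) :
    verticalIntegral (fun s => h s / (s - p)) c₂ - verticalIntegral (fun s => h s / (s - p)) c₁ =
      h p := by
  set q := c₁ - 1
  set g : ℂ → ℂ := fun s => dslope h p s + h p * (s - q)⁻¹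
  have hsplit {s : ℂ} (hs : s ≠ p) :
      h s / (s - p) = h p * ((s - p)⁻¹ - (s - q)⁻¹) + g s := by
    rw [← pow_one (s - p), ← zero_add 1, div_sub_pow_succ_eq h hs]
    simp only [g]
    ring
  have hg : DifferentiableOn ℂ g (Complex.re ⁻¹' Set.Icc c₁ c₂) := by
    refine (differentiableOn_dslope_strip h₁ h₂ hh).add
      (((differentiableOn_id.sub_const _).inv fun s hs hsq => ?_).const_mul _)
    have hre : s.re = q := by simpa [sub_eq_zero] using congrArg Complex.re hsq
    linarith [(Set.mem_Icc.mp hs).1]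
  have hg_decay (s : ℂ) (hs₁ : c₁ ≤ s.re) (hs₂ : s.re ≤ c₂) (him : 1 ≤ |s.im|) :
      ‖g s‖ ≤ (C + ‖h p‖ * |p - q|) / s.im ^ 2 := by
    have hs : s ≠ p := by
      rintro rfl
      norm_num at him
    rw [← sub_eq_of_eq_add' (hsplit hs), add_div, mul_div_assoc]
    refine (norm_sub_le _ _).trans (add_le_add (hdecay s hs₁ hs₂ him) ?_)
    rw [norm_mul]
    gcongr
    exact norm_inv_sub_sub_inv_sub_le p q him
  have hline {c : ℝ} (hc₁ : c₁ ≤ c) (hc₂ : c ≤ c₂) (hcp : c ≠ p) :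
      verticalIntegral (fun s => h s / (s - p)) c =
        h p * (((SignType.sign (c - p) : ℝ) - (SignType.sign (c - q) : ℝ)) / 2) +
          verticalIntegral g c := by
    have hcq : c ≠ q := by linarith
    rw [verticalIntegral_congr fun s hs => hsplit fun hsp => hcp (by simp [← hs, hsp]),
      verticalIntegral_add ((integrable_vertical_inv_sub_sub_inv_sub hcp hcq).const_mul _)
        (integrable_vertical hc₁ hc₂ hg.continuousOn hg_decay),
      verticalIntegral_const_mul, verticalIntegral_inv_sub_sub_inv_sub hcp hcq]
  have hc : c₁ ≤ c₂ := (h₁.trans h₂).le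
  have hq₁ : q < c₁ := by simp [q]
  rw [hline hc le_rfl h₂.ne', hline le_rfl hc h₁.ne,
    verticalIntegral_eq_of_differentiableOn hc hg hg_decay, sign_pos (sub_pos.mpr h₂),
    sign_pos (sub_pos.mpr (hq₁.trans_le hc)), sign_neg (sub_neg.mpr h₁), sign_pos (sub_pos.mpr hq₁)]
  simp
  ring

lemma verticalIntegral_div_sub_pow_sub_verticalIntegral (h₁ : c₁ < p) (h₂ : p < c₂) (r : ℕ)
    (hh : DifferentiableOn ℂ h (Complex.re ⁻¹' Set.Icc c₁ c₂))
    (hdecay : ∀ s : ℂ, c₁ ≤ s.re → s.re ≤ c₂ → 1 ≤ |s.im| →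
      ‖h s / (s - p) ^ (r + 1)‖ ≤ C / s.im ^ 2) :
    verticalIntegral (fun s => h s / (s - p) ^ (r + 1)) c₂ -
      verticalIntegral (fun s => h s / (s - p) ^ (r + 1)) c₁ =
        (Function.swap dslope (p : ℂ))^[r] h p := by
  induction r generalizing h C with
  | zero =>
    simp only [zero_add, pow_one] at hdecay ⊢
    exact verticalIntegral_div_sub_sub_verticalIntegral h₁ h₂ hh hdecay
  | succ r ih =>
    have hd := differentiableOn_dslope_strip h₁ h₂ hh
    have hd_decay (s : ℂ) (hs₁ : c₁ ≤ s.re) (hs₂ : s.re ≤ c₂) (him : 1 ≤ |s.im|) :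
        ‖dslope h p s / (s - p) ^ (r + 1)‖ ≤ (C + ‖h p‖ * 1) / s.im ^ 2 := by
      have hs : s ≠ p := by
        rintro rfl
        norm_num at him
      rw [← sub_eq_of_eq_add' (div_sub_pow_succ_eq h hs (r + 1)), add_div, mul_div_assoc]
      refine (norm_sub_le _ _).trans (add_le_add (hdecay s hs₁ hs₂ him) ?_)
      rw [norm_mul]
      gcongr
      exact norm_inv_sub_pow_le p r him
    have hline {c : ℝ} (hc₁ : c₁ ≤ c) (hc₂ : c ≤ c₂) (hcp : c ≠ p) :
        verticalIntegral (fun s => h s / (s - p) ^ (r + 1 + 1)) c =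
          verticalIntegral (fun s => dslope h p s / (s - p) ^ (r + 1)) c := by
      have hint : Integrable fun t : ℝ =>
          dslope h p (c + t * Complex.I) / (c + t * Complex.I - p : ℂ) ^ (r + 1) :=
        integrable_of_norm_le_div_sq
          ((hd.continuousOn.comp_continuous (by fun_prop) fun t => by simp [hc₁, hc₂]).div
            (by fun_prop) fun t => pow_ne_zero _ (vertical_sub_ne_zero hcp t))
          fun t ht => by simpa using hd_decay (c + t * Complex.I) (by simpa) (by simpa) (by simpa)
      rw [verticalIntegral_congr fun s hs => div_sub_pow_succ_eq h (p := p)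
          (fun hsp => hcp (by simp [← hs, hsp])) (r + 1),
        verticalIntegral_add ((integrable_vertical_inv_sub_pow hcp r).const_mul _) hint,
        verticalIntegral_const_mul, verticalIntegral_inv_sub_pow hcp, mul_zero, zero_add]
    have hc : c₁ ≤ c₂ := (h₁.trans h₂).le
    rw [hline hc le_rfl h₂.ne', hline le_rfl hc h₁.ne, ih hd hd_decay,
      Function.iterate_succ_apply, Function.swap]

theorem verticalIntegral_sub_eq_iteratedDeriv (h₁ : c₁ < p) (h₂ : p < c₂) (r : ℕ)
    (hh : DifferentiableOn ℂ h (Complex.re ⁻¹' Set.Icc c₁ c₂))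
    (hdecay : ∀ s : ℂ, c₁ ≤ s.re → s.re ≤ c₂ → 1 ≤ |s.im| →
      ‖h s / (s - p) ^ (r + 1)‖ ≤ C / s.im ^ 2) :
    verticalIntegral (fun s => h s / (s - p) ^ (r + 1)) c₂ -
      verticalIntegral (fun s => h s / (s - p) ^ (r + 1)) c₁ =
        iteratedDeriv r h p / r.factorial := by
  rw [verticalIntegral_div_sub_pow_sub_verticalIntegral h₁ h₂ r hh hdecay,
    iterate_dslope_eq_iteratedDeriv_div]
  exact hh.analyticAt (Complex.continuous_re.continuousAt.preimage_mem_nhds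
    (by simpa using Icc_mem_nhds h₁ h₂))

end Residue

/-! ### Partial sums of multi-indices -/

section Index

variable {M : ℕ} {ℓ L : Fin M → ℕ}

lemma lam_zero (ℓ : Fin M → ℕ) : lam ℓ 0 = 0 := by simp [lam]

lemma lam_zero_fun (n : ℕ) : lam (0 : Fin M → ℕ) n = 0 := by simp [lam]

lemma lam_mono (ℓ : Fin M → ℕ) : Monotone (lam ℓ) := fun _ _ hab =>
  Finset.sum_le_sum_of_subset <| Finset.monotone_filter_right _ fun _ _ hk => hk.trans_le hab

lemma eq_zero_of_lam_eq_zero (h : lam ℓ M = 0) : ℓ = 0 := by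
  funext k
  exact Finset.sum_eq_zero_iff.mp h k (by simp)

/-- The number of hops `n` with `lam ℓ n = 0`, that is, the `r` with `ℓ ∈ 𝓛_r`. It is the order of
the pole at `s = 1` of the contour integrand with index `ℓ`. -/
def zeroCount (ℓ : Fin M → ℕ) : ℕ :=
  (Finset.univ.filter fun n : Fin (M + 1) => lam ℓ n = 0).card

lemma zero_mem_box (hL : ∀ k, 1 ≤ L k) : 0 ∈ box L :=
  Fintype.mem_piFinset.mpr fun k => Finset.mem_range.mpr (hL k)

lemma zeroCount_pos (ℓ : Fin M → ℕ) : 0 < zeroCount ℓ :=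
  Finset.card_pos.mpr ⟨0, by simp [lam_zero]⟩

lemma zeroCount_le (ℓ : Fin M → ℕ) : zeroCount ℓ ≤ M + 1 :=
  (Finset.card_le_univ _).trans (by simp)

lemma zeroCount_eq {r : ℕ} (hr : r ∈ Finset.Icc 1 (M + 1)) (hzero : lam ℓ (r - 1) = 0)
    (hpos : r ≤ M → 0 < lam ℓ r) : zeroCount ℓ = r := by
  rw [Finset.mem_Icc] at hr
  have hfilter : (Finset.univ.filter fun n : Fin (M + 1) => lam ℓ n = 0) =
      Finset.univ.filter fun n : Fin (M + 1) => (n : ℕ) < r := by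
    refine Finset.filter_congr fun n _ => ⟨fun hn => ?_, fun hn => ?_⟩
    · by_contra! hrn
      have hle := lam_mono ℓ hrn
      have := hpos (by omega)
      omega
    · have hle := lam_mono ℓ (show (n : ℕ) ≤ r - 1 by omega)
      omega
  rw [zeroCount, hfilter, Fin.card_filter_val_lt, min_eq_right hr.2]

lemma mem_indexSet_iff {r : ℕ} (hr : r ∈ Finset.Icc 1 (M + 1)) :
    ℓ ∈ indexSet L r ↔ ℓ ∈ box L ∧ zeroCount ℓ = r := by
  rw [indexSet, Finset.mem_filter]
  refine and_congr_right fun _ => ⟨fun h => zeroCount_eq hr h.1 h.2, ?_⟩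
  rintro rfl
  set m := Nat.findGreatest (fun n => lam ℓ n = 0) M
  have hmM : m ≤ M := Nat.findGreatest_le _
  have hzero : lam ℓ m = 0 :=
    Nat.findGreatest_spec (P := fun n => lam ℓ n = 0) (Nat.zero_le M) (lam_zero ℓ)
  have hpos : m + 1 ≤ M → 0 < lam ℓ (m + 1) := fun h =>
    Nat.pos_of_ne_zero (Nat.findGreatest_is_greatest (P := fun n => lam ℓ n = 0) (by omega) h)
  rw [zeroCount_eq (Finset.mem_Icc.mpr ⟨by omega, by omega⟩) hzero hpos]
  exact ⟨hzero, hpos⟩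

lemma sum_indexSet {β : Type*} [AddCommMonoid β] (L : Fin M → ℕ) (f : ℕ → (Fin M → ℕ) → β) :
    ∑ r ∈ Finset.Icc 1 (M + 1), ∑ ℓ ∈ indexSet L r, f r ℓ =
      ∑ ℓ ∈ box L, f (zeroCount ℓ) ℓ := by
  rw [← Finset.sum_fiberwise_of_maps_to (s := box L) (t := Finset.Icc 1 (M + 1))
    (g := zeroCount) fun ℓ _ => Finset.mem_Icc.mpr ⟨zeroCount_pos ℓ, zeroCount_le ℓ⟩]
  refine Finset.sum_congr rfl fun r hr => ?_
  have hset : indexSet L r = (box L).filter fun ℓ => zeroCount ℓ = r := by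
    ext ℓ
    rw [mem_indexSet_iff hr, Finset.mem_filter]
  rw [hset]
  refine Finset.sum_congr rfl fun ℓ hℓ => ?_
  rw [(Finset.mem_filter.mp hℓ).2]

end Index

/-! ### The continued integrand -/

/-- The polynomial `s Γ(j - s) / Γ(1 - s)`; the factor `s` removes the pole at `0` for `j = 0`. -/
noncomputable def gammaQuot : ℕ → Polynomial ℂ
  | 0 => -1
  | j + 1 => Polynomial.X * (ascPochhammer ℂ j).comp (1 - Polynomial.X)

lemma one_sub_ne_neg_natCast {s : ℂ} (hs : s.re < 2) (hs1 : s ≠ 1) (k : ℕ) : 1 - s ≠ -k := by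
  rcases k with - | k
  · simpa [sub_eq_zero] using hs1.symm
  · intro h
    have hre := congrArg Complex.re h
    simp only [Complex.sub_re, Complex.one_re, Nat.cast_succ, Complex.neg_re, Complex.add_re,
      Complex.natCast_re] at hre
    linarith [Nat.cast_nonneg (α := ℝ) k]

lemma Gamma_natCast_sub_div_Gamma (j : ℕ) {s : ℂ} (h0 : s ≠ 0) (h1 : ∀ k : ℕ, 1 - s ≠ -k) :
    Complex.Gamma (j - s) / Complex.Gamma (1 - s) = (gammaQuot j).eval s / s := by
  cases j with
  | zero =>
    have hrec := Complex.Gamma_add_one (-s) (neg_ne_zero.mpr h0)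
    rw [neg_add_eq_sub] at hrec
    have hne : Complex.Gamma (-s) ≠ 0 := fun h =>
      Complex.Gamma_ne_zero h1 (by rw [hrec, h, mul_zero])
    rw [gammaQuot, Nat.cast_zero, zero_sub, hrec, Polynomial.eval_neg, Polynomial.eval_one]
    field_simp
  | succ j =>
    rw [gammaQuot, Polynomial.eval_mul, Polynomial.eval_X, mul_div_cancel_left₀ _ h0,
      Polynomial.eval_comp, Polynomial.eval_sub, Polynomial.eval_one, Polynomial.eval_X,
      ← Complex.Gamma_add_nat_div_Gamma_eq _ h1]
    push_cast
    ring_nf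

lemma exists_norm_eval_le_mul_abs_im_pow (P : Polynomial ℂ) (σ₁ σ₂ : ℝ) :
    ∃ C, ∀ s : ℂ, σ₁ ≤ s.re → s.re ≤ σ₂ → 1 ≤ |s.im| →
      ‖P.eval s‖ ≤ C * |s.im| ^ P.natDegree := by
  set R := max |σ₁| |σ₂| + 1
  refine ⟨∑ i ∈ Finset.range (P.natDegree + 1), ‖P.coeff i‖ * R ^ i, fun s h₁ h₂ him => ?_⟩
  have hnorm : ‖s‖ ≤ R * |s.im| := by
    have hre : |s.re| ≤ max |σ₁| |σ₂| := abs_le_max_abs_abs h₁ h₂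
    have := le_mul_of_one_le_right ((abs_nonneg _).trans hre) him
    linarith [Complex.norm_le_abs_re_add_abs_im s]
  rw [Polynomial.eval_eq_sum_range, Finset.sum_mul]
  refine norm_sum_le_of_le _ fun i hi => ?_
  calc ‖P.coeff i * s ^ i‖ ≤ ‖P.coeff i‖ * (R * |s.im|) ^ i := by
        rw [norm_mul, norm_pow]
        gcongr
    _ = ‖P.coeff i‖ * R ^ i * |s.im| ^ i := by rw [mul_pow, mul_assoc]
    _ ≤ ‖P.coeff i‖ * R ^ i * |s.im| ^ P.natDegree := by
        gcongr
        exact Finset.mem_range_succ_iff.mp hi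

/-- The integrand `contourIntegrand`, continued to `re s < 2`, without the constant `hopConst`;
here `w` is `baseConst / γ`. -/
noncomputable def continuedIntegrand {M : ℕ} (K : Fin (M + 1) → ℝ) (ℓ : Fin M → ℕ) (w : ℝ)
    (s : ℂ) : ℂ :=
  (w : ℂ) ^ s *
    ((gammaQuot (lam ℓ M)).eval s / s * ∏ n : Fin (M + 1), gammaKummer (K n) (1 + lam ℓ n - s))

/-- The constant by which `contourIntegrand` and `continuedIntegrand` differ. -/
noncomputable def hopConst {M : ℕ} (K θ : Fin (M + 1) → ℝ) (ℓ : Fin M → ℕ) : ℝ :=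
  ∏ n : Fin (M + 1), Real.exp (-K n) * (θ n / (K n + 1)) ^ lam ℓ n

lemma prod_ofReal_cpow {ι : Type*} (t : Finset ι) {f : ι → ℝ} (hf : ∀ i, 0 ≤ f i) (s : ℂ) :
    ((∏ i ∈ t, f i : ℝ) : ℂ) ^ s = ∏ i ∈ t, (f i : ℂ) ^ s := by
  classical
  induction t using Finset.induction_on with
  | empty => simp
  | insert a t ha ih =>
    rw [Finset.prod_insert ha, Finset.prod_insert ha, Complex.ofReal_mul,
      Complex.mul_cpow_ofReal_nonneg (hf a) (Finset.prod_nonneg fun i _ => hf i), ih]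

lemma mellin_ricianPDF_one_add_natCast_sub {K θ : ℝ} (hK : 0 ≤ K) (hθ : 0 < θ) (j : ℕ) {s : ℂ}
    (hs : s.re < 1) :
    mellin (fun x => (ricianPDF K θ x : ℂ)) (1 + j - s) =
      ((Real.exp (-K) * (θ / (K + 1)) ^ j : ℝ) : ℂ) *
        ((((K + 1) / θ : ℝ) : ℂ) ^ s * gammaKummer K (1 + j - s)) := by
  have hne : (((K + 1) / θ : ℝ) : ℂ) ≠ 0 := Complex.ofReal_ne_zero.mpr (by positivity)
  have hre : 0 < (1 + j - s : ℂ).re := by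
    simp only [Complex.sub_re, Complex.add_re, Complex.one_re, Complex.natCast_re]
    linarith [Nat.cast_nonneg (α := ℝ) j]
  rw [mellin_ricianPDF hK hθ hre, show (1 : ℂ) - (1 + j - s) = s - j by ring,
    Complex.cpow_sub _ _ hne, Complex.cpow_natCast, ← inv_div (K + 1) θ]
  push_cast
  rw [inv_pow]
  ring

section Integrand

variable {M : ℕ} {K θ ρ : Fin (M + 1) → ℝ} {γth γ w : ℝ}

lemma baseConst_pos (hK : ∀ n, 0 ≤ K n) (hθ : ∀ n, 0 < θ n) (hρ : 0 < ρ (Fin.last M))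
    (hγth : 0 < γth) : 0 < baseConst K θ ρ γth :=
  div_pos (mul_pos (mul_pos hρ hγth) (Finset.prod_pos fun n _ => by linarith [hK n]))
    (Finset.prod_pos fun n _ => hθ n)

lemma contourIntegrand_eq (hK : ∀ n, 0 ≤ K n) (hθ : ∀ n, 0 < θ n)
    (hρ : 0 < ρ (Fin.last M)) (hγth : 0 < γth) (hγ : 0 < γ) (ℓ : Fin M → ℕ)
    {s : ℂ} (h0 : s ≠ 0) (hs : s.re < 1) :
    contourIntegrand K θ ρ γth ℓ γ s =
      hopConst K θ ℓ * continuedIntegrand K ℓ (baseConst K θ ρ γth / γ) s := by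
  have hs1 : s ≠ 1 := by
    rintro rfl
    simp at hs
  have hrate : ∀ n, 0 ≤ (K n + 1) / θ n := fun n =>
    div_nonneg (by linarith [hK n]) (hθ n).le
  have hbase : baseConst K θ ρ γth / γ = ρ (Fin.last M) * γth / γ * ∏ n, ((K n + 1) / θ n) := by
    rw [Finset.prod_div_distrib, baseConst]
    ring
  have hpow : ((baseConst K θ ρ γth / γ : ℝ) : ℂ) ^ s =
      ((ρ (Fin.last M) * γth / γ : ℝ) : ℂ) ^ s * ∏ n, (((K n + 1) / θ n : ℝ) : ℂ) ^ s := by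
    rw [hbase, Complex.ofReal_mul, Complex.mul_cpow_ofReal_nonneg (by positivity)
      (Finset.prod_nonneg fun n _ => hrate n), prod_ofReal_cpow _ hrate]
  rw [contourIntegrand, continuedIntegrand, hopConst,
    Gamma_natCast_sub_div_Gamma _ h0 (one_sub_ne_neg_natCast (by linarith) hs1), hpow,
    Finset.prod_congr rfl fun n _ => mellin_ricianPDF_one_add_natCast_sub (hK n) (hθ n) _ hs,
    Finset.prod_mul_distrib, Finset.prod_mul_distrib]
  push_cast
  ring

lemma norm_ofReal_cpow_le_add {σ₁ σ₂ : ℝ} (hw : 0 < w) {s : ℂ} (h₁ : σ₁ ≤ s.re) (h₂ : s.re ≤ σ₂) :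
    ‖(w : ℂ) ^ s‖ ≤ w ^ σ₁ + w ^ σ₂ := by
  rw [Complex.norm_cpow_eq_rpow_re_of_pos hw]
  have := Real.rpow_nonneg hw.le σ₁
  have := Real.rpow_nonneg hw.le σ₂
  rcases le_total w 1 with h | h
  · linarith [Real.rpow_le_rpow_of_exponent_ge hw h h₁]
  · linarith [Real.rpow_le_rpow_of_exponent_le h h₂]

lemma exists_norm_prod_gammaKummer_le (K : Fin (M + 1) → ℝ) (ℓ : Fin M → ℕ) (σ₁ σ₂ : ℝ) (m : ℕ) :
    ∃ C, ∀ s : ℂ, σ₁ ≤ s.re → s.re ≤ σ₂ → 1 ≤ |s.im| →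
      ‖∏ n : Fin (M + 1), gammaKummer (K n) (1 + lam ℓ n - s)‖ ≤ C / |s.im| ^ m := by
  choose D hD using fun n : Fin (M + 1) =>
    exists_norm_gammaKummer_le (K n) (1 + lam ℓ n - σ₂) (1 + lam ℓ n - σ₁) m
  refine ⟨∏ n, D n, fun s h₁ h₂ him => ?_⟩
  have hpow : 0 < |s.im| ^ m := by positivity
  have hfactor (n : Fin (M + 1)) :
      ‖gammaKummer (K n) (1 + lam ℓ n - s)‖ ≤ D n / |s.im| ^ m := by
    simpa using hD n (1 + lam ℓ n - s) (by simpa using by linarith)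
      (by simpa using by linarith) (by simpa)
  have hDnonneg (n : Fin (M + 1)) : 0 ≤ D n := by
    simpa using (le_div_iff₀ hpow).mp ((norm_nonneg _).trans (hfactor n))
  calc ‖∏ n : Fin (M + 1), gammaKummer (K n) (1 + lam ℓ n - s)‖
      ≤ ∏ n, D n / |s.im| ^ m := by
        rw [norm_prod]
        exact Finset.prod_le_prod (fun n _ => norm_nonneg _) fun n _ => hfactor n
    _ = (∏ n, D n) / (|s.im| ^ m) ^ (M + 1) := by simp [Finset.prod_div_distrib]
    _ ≤ (∏ n, D n) / |s.im| ^ m :=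
        div_le_div_of_nonneg_left (Finset.prod_nonneg fun n _ => hDnonneg n) hpow
          (le_self_pow₀ (one_le_pow₀ him) M.succ_ne_zero)

lemma exists_norm_continuedIntegrand_le (K : Fin (M + 1) → ℝ) (ℓ : Fin M → ℕ) (hw : 0 < w)
    (σ₁ σ₂ : ℝ) :
    ∃ C, ∀ s : ℂ, σ₁ ≤ s.re → s.re ≤ σ₂ → 1 ≤ |s.im| →
      ‖continuedIntegrand K ℓ w s‖ ≤ C / s.im ^ 2 := by
  set P := gammaQuot (lam ℓ M)
  obtain ⟨B, hB⟩ := exists_norm_eval_le_mul_abs_im_pow P σ₁ σ₂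
  obtain ⟨D, hD⟩ := exists_norm_prod_gammaKummer_le K ℓ σ₁ σ₂ (P.natDegree + 2)
  refine ⟨(w ^ σ₁ + w ^ σ₂) * (B * D), fun s h₁ h₂ him => ?_⟩
  have : 0 < |s.im| := by linarith
  have hquot : ‖P.eval s / s‖ ≤ B * |s.im| ^ P.natDegree := by
    rw [norm_div]
    exact (div_le_self (norm_nonneg _) (him.trans (Complex.abs_im_le_norm s))).trans
      (hB s h₁ h₂ him)
  calc ‖continuedIntegrand K ℓ w s‖
      ≤ (w ^ σ₁ + w ^ σ₂) *
          (B * |s.im| ^ P.natDegree * (D / |s.im| ^ (P.natDegree + 2))) := by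
        rw [continuedIntegrand, norm_mul, norm_mul]
        have hBnonneg := (norm_nonneg _).trans hquot
        exact mul_le_mul (norm_ofReal_cpow_le_add hw h₁ h₂)
          (mul_le_mul hquot (hD s h₁ h₂ him) (norm_nonneg _) hBnonneg) (by positivity)
          (by positivity)
    _ = (w ^ σ₁ + w ^ σ₂) * (B * D) / s.im ^ 2 := by
        rw [← sq_abs s.im, pow_add]
        field_simp

end Integrand

/-! ### The poles at `0` and `1` -/

/-- The `n`-th factor of `ϱ` for `λ_n = j`, with the sign absorbed for `j = 0`: the function
`gammaKummer K (1 + j - s)`, multiplied by `s - 1` if it has a pole at `s = 1`. -/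
noncomputable def hopFactor (K : ℝ) (j : ℕ) (s : ℂ) : ℂ :=
  if j = 0 then -(Complex.Gamma (2 - s) * kummerC K (1 - s)) else gammaKummer K (1 + j - s)

lemma gammaKummer_eq_hopFactor_div (K : ℝ) (j : ℕ) {s : ℂ} (hs : s ≠ 1) :
    gammaKummer K (1 + j - s) = hopFactor K j s / (if j = 0 then s - 1 else 1) := by
  rcases eq_or_ne j 0 with rfl | hj
  · have hrec := Complex.Gamma_add_one (1 - s) (sub_ne_zero.mpr hs.symm)
    have hne : s - 1 ≠ 0 := sub_ne_zero.mpr hs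
    rw [hopFactor, if_pos rfl, if_pos rfl, show (2 : ℂ) - s = 1 - s + 1 by ring, hrec, gammaKummer,
      Nat.cast_zero, add_zero]
    field_simp
    ring
  · simp [hopFactor, hj]

lemma differentiableAt_hopFactor (K : ℝ) (j : ℕ) {s : ℂ} (hs : s.re < 2) :
    DifferentiableAt ℂ (hopFactor K j) s := by
  unfold hopFactor
  split_ifs with hj
  · have hGamma : DifferentiableAt ℂ Complex.Gamma (2 - s) :=
      Complex.differentiableAt_Gamma _ (ne_neg_natCast_of_re_pos (by simpa))
    exact ((hGamma.comp s (by fun_prop)).mul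
      ((differentiable_kummerC K _).comp s (by fun_prop))).neg
  · refine DifferentiableAt.comp s (differentiableAt_gammaKummer K ?_) (by fun_prop)
    have : (1 : ℝ) ≤ j := by exact_mod_cast Nat.one_le_iff_ne_zero.mpr hj
    simp only [Complex.sub_re, Complex.add_re, Complex.one_re, Complex.natCast_re]
    linarith

lemma differentiable_ofReal_cpow {w : ℝ} (hw : w ≠ 0) :
    Differentiable ℂ fun s : ℂ => (w : ℂ) ^ s := fun _ =>
  differentiableAt_id.const_cpow (Or.inl (Complex.ofReal_ne_zero.mpr hw))

section Poles

variable {M : ℕ}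

/-- The function `ϱ` on the complex plane, with its singularity at `s = 1` removed. -/
noncomputable def varrhoC (K : Fin (M + 1) → ℝ) (ℓ : Fin M → ℕ) (s : ℂ) : ℂ :=
  (gammaQuot (lam ℓ M)).eval s / s * ∏ n : Fin (M + 1), hopFactor (K n) (lam ℓ n) s

lemma differentiableAt_varrhoC (K : Fin (M + 1) → ℝ) (ℓ : Fin M → ℕ) {s : ℂ} (h0 : s ≠ 0)
    (hs : s.re < 2) : DifferentiableAt ℂ (varrhoC K ℓ) s :=
  ((Polynomial.differentiable _ s).div differentiableAt_id h0).mul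
    (DifferentiableAt.fun_finsetProd fun n _ => differentiableAt_hopFactor (K n) _ hs)

lemma prod_gammaKummer_eq (K : Fin (M + 1) → ℝ) (ℓ : Fin M → ℕ) {s : ℂ} (hs : s ≠ 1) :
    ∏ n : Fin (M + 1), gammaKummer (K n) (1 + lam ℓ n - s) =
      (∏ n : Fin (M + 1), hopFactor (K n) (lam ℓ n) s) / (s - 1) ^ zeroCount ℓ := by
  rw [Finset.prod_congr rfl fun n _ => gammaKummer_eq_hopFactor_div (K n) (lam ℓ n) hs,
    Finset.prod_div_distrib, Finset.prod_ite, Finset.prod_const, Finset.prod_const_one, mul_one,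
    zeroCount]

lemma continuedIntegrand_eq_varrhoC_div (K : Fin (M + 1) → ℝ) (ℓ : Fin M → ℕ) (w : ℝ) {s : ℂ}
    (hs : s ≠ 1) :
    continuedIntegrand K ℓ w s = (w : ℂ) ^ s * varrhoC K ℓ s / (s - 1) ^ zeroCount ℓ := by
  rw [continuedIntegrand, prod_gammaKummer_eq K ℓ hs, varrhoC]
  ring

/-- The residue at `0` of `continuedIntegrand`. -/
noncomputable def residueZero (K : Fin (M + 1) → ℝ) (ℓ : Fin M → ℕ) : ℂ :=
  (gammaQuot (lam ℓ M)).eval 0 * ∏ n : Fin (M + 1), gammaKummer (K n) (1 + lam ℓ n)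

lemma hopConst_mul_residueZero (K θ : Fin (M + 1) → ℝ) (ℓ : Fin M → ℕ) :
    hopConst K θ ℓ * residueZero K ℓ = if ℓ = 0 then -1 else 0 := by
  split_ifs with h
  · subst h
    simp only [hopConst, residueZero, lam_zero_fun, gammaKummer, gammaQuot, pow_zero, mul_one,
      Nat.cast_zero, add_zero, Complex.Gamma_one, one_mul, kummerC_one, Polynomial.eval_neg,
      Polynomial.eval_one]
    push_cast
    rw [neg_one_mul, mul_neg, ← Finset.prod_mul_distrib, Finset.prod_eq_one]
    intro n _
    rw [← Complex.exp_add, neg_add_cancel, Complex.exp_zero]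
  · obtain ⟨j, hj⟩ := Nat.exists_eq_succ_of_ne_zero fun h0 => h (eq_zero_of_lam_eq_zero h0)
    simp [residueZero, hj, gammaQuot]

lemma verticalIntegral_continuedIntegrand_sub_of_neg (K : Fin (M + 1) → ℝ) (ℓ : Fin M → ℕ)
    {w : ℝ} (hw : 0 < w) {σ : ℝ} (hσ : σ < 0) :
    verticalIntegral (continuedIntegrand K ℓ w) (1 / 2 : ℝ) -
      verticalIntegral (continuedIntegrand K ℓ w) σ = residueZero K ℓ := by
  set h : ℂ → ℂ := fun s => (w : ℂ) ^ s * ((gammaQuot (lam ℓ M)).eval s *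
      ∏ n : Fin (M + 1), gammaKummer (K n) (1 + lam ℓ n - s)) with h_def
  have heq : continuedIntegrand K ℓ w = fun s => h s / (s - (0 : ℝ)) ^ (0 + 1) := by
    funext s
    rw [continuedIntegrand, h_def, Complex.ofReal_zero, sub_zero, zero_add, pow_one]
    ring
  have hdiff : DifferentiableOn ℂ h (Complex.re ⁻¹' Set.Icc σ (1 / 2)) := by
    intro s hs
    refine DifferentiableAt.differentiableWithinAt ((differentiable_ofReal_cpow hw.ne' s).mul
      ((Polynomial.differentiable _ s).mul (DifferentiableAt.fun_finsetProd fun n _ => ?_)))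
    refine DifferentiableAt.comp s (differentiableAt_gammaKummer (K n) ?_) (by fun_prop)
    simp only [Complex.sub_re, Complex.add_re, Complex.one_re, Complex.natCast_re]
    linarith [Nat.cast_nonneg (α := ℝ) (lam ℓ n), hs.2]
  obtain ⟨C, hC⟩ := exists_norm_continuedIntegrand_le K ℓ hw σ (1 / 2)
  rw [heq] at hC ⊢
  rw [verticalIntegral_sub_eq_iteratedDeriv hσ (by norm_num) 0 hdiff hC]
  simp [h_def, residueZero]

lemma verticalIntegral_continuedIntegrand_sub_half (K : Fin (M + 1) → ℝ) (ℓ : Fin M → ℕ)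
    {w : ℝ} (hw : 0 < w) :
    verticalIntegral (continuedIntegrand K ℓ w) (3 / 2 : ℝ) -
      verticalIntegral (continuedIntegrand K ℓ w) (1 / 2 : ℝ) =
      iteratedDeriv (zeroCount ℓ - 1) (fun s => (w : ℂ) ^ s * varrhoC K ℓ s) 1 /
        (zeroCount ℓ - 1).factorial := by
  set h : ℂ → ℂ := fun s => (w : ℂ) ^ s * varrhoC K ℓ s
  have heq (s : ℂ) (hs : s ≠ 1) :
      continuedIntegrand K ℓ w s = h s / (s - (1 : ℝ)) ^ (zeroCount ℓ - 1 + 1) := by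
    rw [continuedIntegrand_eq_varrhoC_div K ℓ w hs, Complex.ofReal_one,
      Nat.sub_add_cancel (zeroCount_pos ℓ)]
  have hdiff : DifferentiableOn ℂ h (Complex.re ⁻¹' Set.Icc (1 / 2) (3 / 2)) := by
    intro s hs
    obtain ⟨hs₁, hs₂⟩ := hs
    refine ((differentiable_ofReal_cpow hw.ne' s).mul (differentiableAt_varrhoC K ℓ ?_
      (by linarith))).differentiableWithinAt
    rintro rfl
    norm_num at hs₁
  obtain ⟨C, hC⟩ := exists_norm_continuedIntegrand_le K ℓ hw (1 / 2) (3 / 2)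
  have hres := verticalIntegral_sub_eq_iteratedDeriv (p := 1) (by norm_num) (by norm_num)
    (zeroCount ℓ - 1) hdiff fun s h₁ h₂ him => by
      rw [← heq s (by rintro rfl; norm_num at him)]
      exact hC s h₁ h₂ him
  rw [Complex.ofReal_one] at hres
  rw [← hres]
  congr 1 <;> refine verticalIntegral_congr fun s hs => heq s ?_ <;>
    · rintro rfl
      norm_num at hs

end Poles

/-! ### Shifting the contours -/

section Shift

variable {M : ℕ} {K θ ρ : Fin (M + 1) → ℝ} {γth γ : ℝ}

lemma verticalIntegral_contourIntegrand (hK : ∀ n, 0 ≤ K n) (hθ : ∀ n, 0 < θ n)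
    (hρ : 0 < ρ (Fin.last M)) (hγth : 0 < γth) (hγ : 0 < γ) (ℓ : Fin M → ℕ) {κ : ℝ} (hκ : 0 < κ) :
    verticalIntegral (contourIntegrand K θ ρ γth ℓ γ) (-κ) =
      hopConst K θ ℓ *
        (verticalIntegral (continuedIntegrand K ℓ (baseConst K θ ρ γth / γ)) (3 / 2 : ℝ) -
          iteratedDeriv (zeroCount ℓ - 1)
            (fun s => ((baseConst K θ ρ γth / γ : ℝ) : ℂ) ^ s * varrhoC K ℓ s) 1 /
            (zeroCount ℓ - 1).factorial) - if ℓ = 0 then -1 else 0 := by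
  have hw : 0 < baseConst K θ ρ γth / γ := div_pos (baseConst_pos hK hθ hρ hγth) hγ
  set w := baseConst K θ ρ γth / γ
  rw [verticalIntegral_congr (G := fun s => hopConst K θ ℓ * continuedIntegrand K ℓ w s)
      fun s hs => contourIntegrand_eq hK hθ hρ hγth hγ ℓ
        (by rintro rfl; simp [hκ.ne'] at hs) (by linarith),
    verticalIntegral_const_mul, ← hopConst_mul_residueZero K θ ℓ,
    ← verticalIntegral_continuedIntegrand_sub_of_neg K ℓ hw (neg_lt_zero.mpr hκ),
    ← verticalIntegral_continuedIntegrand_sub_half K ℓ hw]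
  ring

/-- The constant in front of the contour integral with index `ℓ`. -/
noncomputable def indexCoeff (ρ : Fin (M + 1) → ℝ) (ℓ : Fin M → ℕ) : ℝ :=
  (-1) ^ lam ℓ M *
    ∏ k : Fin M, (1 / ((ℓ k).factorial : ℝ)) * (ρ k.castSucc / ρ (Fin.last M)) ^ ℓ k

lemma contourOutage_eq (hK : ∀ n, 0 ≤ K n) (hθ : ∀ n, 0 < θ n) (hρ : 0 < ρ (Fin.last M))
    (hγth : 0 < γth) (hγ : 0 < γ) {L : Fin M → ℕ} (hL : ∀ k, 1 ≤ L k) {κ : (Fin M → ℕ) → ℝ}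
    (hκ : ∀ ℓ ∈ box L, 0 < κ ℓ) :
    contourOutage K θ ρ γth L κ γ =
      ∑ ℓ ∈ box L, indexCoeff ρ ℓ * hopConst K θ ℓ *
        (iteratedDeriv (zeroCount ℓ - 1)
          (fun s => ((baseConst K θ ρ γth / γ : ℝ) : ℂ) ^ s * varrhoC K ℓ s) 1 /
          (zeroCount ℓ - 1).factorial -
        verticalIntegral (continuedIntegrand K ℓ (baseConst K θ ρ γth / γ)) (3 / 2 : ℝ)) := by
  have hzero := zero_mem_box hL
  have hindex (ℓ : Fin M → ℕ) : (-1 : ℂ) ^ lam ℓ M * ∏ k : Fin M, (1 / ((ℓ k).factorial : ℂ)) *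
      ((ρ k.castSucc / ρ (Fin.last M) : ℝ) : ℂ) ^ ℓ k = indexCoeff ρ ℓ := by
    rw [indexCoeff]
    push_cast
    rfl
  have hindex_zero : indexCoeff ρ 0 = 1 := by simp [indexCoeff, lam_zero_fun]
  rw [contourOutage, Finset.sum_congr rfl fun ℓ hℓ => by
    rw [hindex, verticalIntegral_contourIntegrand hK hθ hρ hγth hγ ℓ (hκ ℓ hℓ)]]
  simp only [mul_sub, Finset.sum_sub_distrib, mul_ite, mul_zero, Finset.sum_ite_eq', hzero, if_true,
    hindex_zero, mul_assoc, Complex.ofReal_one]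
  ring

lemma norm_verticalIntegral_continuedIntegrand_le (K : Fin (M + 1) → ℝ) (ℓ : Fin M → ℕ)
    {w : ℝ} (hw : 0 < w) (c : ℝ) :
    ‖verticalIntegral (continuedIntegrand K ℓ w) c‖ ≤
      w ^ c * (‖(1 / (2 * Real.pi) : ℂ)‖ *
        ∫ t : ℝ, ‖continuedIntegrand K ℓ 1 (c + t * Complex.I)‖) := by
  have hnorm (t : ℝ) : ‖continuedIntegrand K ℓ w (c + t * Complex.I)‖ =
      w ^ c * ‖continuedIntegrand K ℓ 1 (c + t * Complex.I)‖ := by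
    rw [continuedIntegrand, continuedIntegrand, norm_mul, norm_mul,
      Complex.norm_cpow_eq_rpow_re_of_pos hw]
    simp
  rw [verticalIntegral, norm_mul, mul_left_comm, ← integral_const_mul]
  simp only [← hnorm]
  exact mul_le_mul_of_nonneg_left (norm_integral_le_integral_norm _) (norm_nonneg _)

lemma isLittleO_verticalIntegral_continuedIntegrand (K : Fin (M + 1) → ℝ) (ℓ : Fin M → ℕ)
    {a c : ℝ} (ha : 0 < a) (hc : 1 < c) :
    (fun γ : ℝ => verticalIntegral (continuedIntegrand K ℓ (a / γ)) c) =o[atTop]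
      (fun γ : ℝ => γ⁻¹) := by
  set D := ‖(1 / (2 * Real.pi) : ℂ)‖ * ∫ t : ℝ, ‖continuedIntegrand K ℓ 1 (c + t * Complex.I)‖
    with hD
  have hbound : (fun γ : ℝ => verticalIntegral (continuedIntegrand K ℓ (a / γ)) c) =O[atTop]
      fun γ => a ^ c * D * (γ ^ (-(c - 1)) * γ⁻¹) := by
    refine IsBigO.of_norm_eventuallyLE ?_
    filter_upwards [eventually_gt_atTop 0] with γ hγ
    refine (norm_verticalIntegral_continuedIntegrand_le K ℓ (div_pos ha hγ) c).trans_eq ?_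
    rw [← hD, Real.div_rpow ha.le hγ.le, Real.rpow_neg hγ.le, Real.rpow_sub_one hγ.ne']
    field_simp
  refine hbound.trans_isLittleO (IsLittleO.const_mul_left ?_ _)
  simpa only [one_mul] using ((isLittleO_one_iff ℝ).mpr
    (tendsto_rpow_neg_atTop (sub_pos.mpr hc))).mul_isBigO (isBigO_refl (fun γ : ℝ => γ⁻¹) atTop)

end Shift

/-! ### The derivatives of `ϱ` at its removable singularity -/

lemma eventually_ofReal_iteratedDeriv_eq {v : ℝ → ℝ} {V : ℂ → ℂ} {x : ℝ} (hV : AnalyticAt ℂ V x)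
    (hvV : ∀ᶠ y : ℝ in 𝓝 x, (v y : ℂ) = V y) (k : ℕ) :
    ∀ᶠ y : ℝ in 𝓝 x, ((iteratedDeriv k v y : ℝ) : ℂ) = iteratedDeriv k V y := by
  induction k with
  | zero => simpa using hvV
  | succ k ih =>
    filter_upwards [ih.eventually_nhds,
      Complex.continuous_ofReal.continuousAt.eventually hV.eventually_analyticAt] with y heq hVy
    have hanalytic : AnalyticAt ℂ (iteratedDeriv k V) y := by
      rw [iteratedDeriv_eq_iterate]
      exact hVy.iterated_deriv k
    have hderiv : HasDerivAt (iteratedDeriv k V) (iteratedDeriv (k + 1) V y) y := by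
      rw [iteratedDeriv_succ]
      exact hanalytic.differentiableAt.hasDerivAt
    have hreal : HasDerivAt (iteratedDeriv k v) (iteratedDeriv (k + 1) V y).re y :=
      hderiv.real_of_complex.congr_of_eventuallyEq <|
        heq.mono fun z hz => by simp only [← hz, Complex.ofReal_re]
    rw [iteratedDeriv_succ, hreal.deriv]
    exact hreal.ofReal_comp.unique (hderiv.comp_ofReal.congr_of_eventuallyEq heq)

lemma ofReal_limUnder_iteratedDeriv {v : ℝ → ℝ} {V : ℂ → ℂ} {x : ℝ} (hV : AnalyticAt ℂ V x)
    (hvV : ∀ᶠ y : ℝ in 𝓝[≠] x, (v y : ℂ) = V y) (k : ℕ) :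
    ((limUnder (𝓝[≠] x) (iteratedDeriv k v) : ℝ) : ℂ) = iteratedDeriv k V x := by
  have hofReal : Tendsto ((↑) : ℝ → ℂ) (𝓝[≠] x) (𝓝 x) :=
    Complex.continuous_ofReal.continuousAt.tendsto.mono_left nhdsWithin_le_nhds
  have heq : ∀ᶠ y : ℝ in 𝓝[≠] x, ((iteratedDeriv k v y : ℝ) : ℂ) = iteratedDeriv k V y := by
    filter_upwards [eventually_eventually_nhdsWithin.mpr hvV,
      hofReal.eventually hV.eventually_analyticAt, self_mem_nhdsWithin] with y hy hVy hyx
    rw [isOpen_compl_singleton.nhdsWithin_eq hyx] at hy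
    exact (eventually_ofReal_iteratedDeriv_eq hVy hy k).self_of_nhds
  have hcont : ContinuousAt (iteratedDeriv k V) x := by
    rw [iteratedDeriv_eq_iterate]
    exact (hV.iterated_deriv k).continuousAt
  have hlim : Tendsto (fun y : ℝ => ((iteratedDeriv k v y : ℝ) : ℂ)) (𝓝[≠] x)
      (𝓝 (iteratedDeriv k V x)) :=
    (hcont.tendsto.comp hofReal).congr' (heq.mono fun _ hy => hy.symm)
  have hlim_re : Tendsto (iteratedDeriv k v) (𝓝[≠] x) (𝓝 (iteratedDeriv k V x).re) := by
    simpa only [Function.comp_def, Complex.ofReal_re] using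
      (Complex.continuous_re.tendsto _).comp hlim
  rw [hlim_re.limUnder_eq]
  exact tendsto_nhds_unique ((Complex.continuous_ofReal.tendsto _).comp hlim_re) hlim

section VarrhoDeriv

variable {M : ℕ} (K : Fin (M + 1) → ℝ) (ℓ : Fin M → ℕ)

lemma ofReal_varrho {x : ℝ} (hx0 : x ≠ 0) (hx1 : x ≠ 1) (hx2 : x < 2) :
    (varrho K ℓ (zeroCount ℓ) x : ℂ) = varrhoC K ℓ x := by
  have hx0' : (x : ℂ) ≠ 0 := Complex.ofReal_ne_zero.mpr hx0
  have hx1' : (x : ℂ) ≠ 1 := Complex.ofReal_ne_one.mpr hx1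
  have hquot := Gamma_natCast_sub_div_Gamma (lam ℓ M) hx0'
    (one_sub_ne_neg_natCast (by simpa using hx2) hx1')
  have hprod := prod_gammaKummer_eq K ℓ hx1'
  rw [eq_div_iff (pow_ne_zero _ (sub_ne_zero.mpr hx1'))] at hprod
  rw [varrhoC, ← hprod, ← hquot, varrho]
  simp only [gammaKummer]
  push_cast
  simp only [← Complex.Gamma_ofReal, ofReal_kummer]
  push_cast
  ring

lemma analyticAt_varrhoC_one : AnalyticAt ℂ (varrhoC K ℓ) 1 := by
  refine Complex.analyticAt_iff_eventually_differentiableAt.mpr ?_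
  have hre : ∀ᶠ s : ℂ in 𝓝 1, s.re < 2 :=
    Complex.continuous_re.continuousAt.eventually_lt continuousAt_const (by norm_num)
  filter_upwards [eventually_ne_nhds one_ne_zero, hre] with s hs0 hs2
  exact differentiableAt_varrhoC K ℓ hs0 hs2

lemma ofReal_varrhoDeriv (k : ℕ) :
    (varrhoDeriv K ℓ (zeroCount ℓ) k : ℂ) = iteratedDeriv k (varrhoC K ℓ) 1 := by
  have hlim := ofReal_limUnder_iteratedDeriv (v := varrho K ℓ (zeroCount ℓ)) (x := 1)
    (by simpa using analyticAt_varrhoC_one K ℓ) ?_ k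
  · simpa [varrhoDeriv] using hlim
  · filter_upwards [self_mem_nhdsWithin,
      mem_nhdsWithin_of_mem_nhds (Ioo_mem_nhds zero_lt_one one_lt_two)] with x hx1 hx
    exact ofReal_varrho K ℓ hx.1.ne' hx1 hx.2

lemma ofReal_varrhoDeriv_zero :
    (varrhoDeriv K ℓ (zeroCount ℓ) 0 : ℂ) =
      (gammaQuot (lam ℓ M)).eval 1 * ∏ n : Fin (M + 1), hopFactor (K n) (lam ℓ n) 1 := by
  rw [ofReal_varrhoDeriv, iteratedDeriv_zero, varrhoC, div_one]

end VarrhoDeriv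

/-! ### The expansion of the contour integrals -/

section Expansion

variable {M : ℕ}

/-- The contribution of one index `ℓ` to `riceExpansion`, without its constant; `a` is `baseConst`.
It is the residue of the contour integrand at `s = 1`. -/
noncomputable def expansionTerm (K : Fin (M + 1) → ℝ) (ℓ : Fin M → ℕ) (a γ : ℝ) : ℝ :=
  a / γ * ∑ l ∈ Finset.range (zeroCount ℓ),
    varrhoDeriv K ℓ (zeroCount ℓ) (zeroCount ℓ - 1 - l) /
      (((zeroCount ℓ - 1 - l).factorial : ℝ) * (l.factorial : ℝ)) * Real.log (a / γ) ^ l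

lemma iteratedDeriv_cpow_mul_varrhoC (K : Fin (M + 1) → ℝ) (ℓ : Fin M → ℕ) {a γ : ℝ} (ha : 0 < a)
    (hγ : 0 < γ) :
    iteratedDeriv (zeroCount ℓ - 1) (fun s => ((a / γ : ℝ) : ℂ) ^ s * varrhoC K ℓ s) 1 /
      (zeroCount ℓ - 1).factorial = expansionTerm K ℓ a γ := by
  have hw : 0 < a / γ := div_pos ha hγ
  set w := a / γ with hwdef
  set r := zeroCount ℓ - 1 with hrdef
  have hcpow : (fun s : ℂ => (w : ℂ) ^ s) = fun s => Complex.exp ((Real.log w : ℝ) * s) := by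
    funext s
    rw [Complex.cpow_def_of_ne_zero (Complex.ofReal_ne_zero.mpr hw.ne'), Complex.ofReal_log hw.le]
  have hcontDiff : ContDiffAt ℂ (r : WithTop ℕ∞) (fun s : ℂ => (w : ℂ) ^ s) 1 := by
    rw [hcpow]
    fun_prop
  rw [iteratedDeriv_fun_mul hcontDiff (analyticAt_varrhoC_one K ℓ).contDiffAt, Finset.sum_div,
    expansionTerm, ← hwdef, ← hrdef, ← Nat.sub_add_cancel (zeroCount_pos ℓ), ← hrdef,
    Complex.ofReal_mul, Complex.ofReal_sum, Finset.mul_sum]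
  refine Finset.sum_congr rfl fun l hl => ?_
  have hexp : Complex.exp ((Real.log w : ℝ) * 1) = w := by
    rw [mul_one, ← Complex.ofReal_exp, Real.exp_log hw]
  rw [hcpow, iteratedDeriv_cexp_const_mul, ← ofReal_varrhoDeriv,
    Nat.cast_choose ℂ (Finset.mem_range_succ_iff.mp hl), hrdef,
    Nat.sub_add_cancel (zeroCount_pos ℓ)]
  simp only [hexp]
  push_cast
  have hfact (n : ℕ) : (n.factorial : ℂ) ≠ 0 := Nat.cast_ne_zero.mpr n.factorial_ne_zero
  field_simp [hfact]

lemma indexCoeff_mul_hopConst (K θ ρ : Fin (M + 1) → ℝ) (ℓ : Fin M → ℕ) :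
    indexCoeff ρ ℓ * hopConst K θ ℓ = (-1) ^ lam ℓ M * zetaCoeff K θ ρ ℓ := by
  rw [indexCoeff, hopConst, zetaCoeff, Finset.prod_mul_distrib, Finset.prod_mul_distrib,
    Fin.prod_univ_castSucc (n := M) (fun n => Real.exp (-K n)),
    Fin.prod_univ_succ (n := M) (fun n => (θ n / (K n + 1)) ^ lam ℓ n),
    Finset.prod_mul_distrib, Finset.prod_mul_distrib, Finset.prod_div_distrib,
    Finset.prod_div_distrib]
  simp only [Fin.val_zero, lam_zero, pow_zero, one_mul, Fin.val_succ, Finset.prod_const_one]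
  ring

lemma log_div_pow {a γ : ℝ} (ha : 0 < a) (hγ : 0 < γ) (l : ℕ) :
    Real.log (a / γ) ^ l = ∑ p ∈ Finset.range (l + 1),
      (l.choose p : ℝ) * (-1) ^ p * Real.log a ^ (l - p) * Real.log γ ^ p := by
  rw [Real.log_div ha.ne' hγ.ne', sub_eq_neg_add, add_pow]
  refine Finset.sum_congr rfl fun p _ => ?_
  rw [neg_pow (Real.log γ)]
  ring

variable {K θ ρ : Fin (M + 1) → ℝ} {γth γ : ℝ}

lemma riceExpansion_eq_sum_expansionTerm (hK : ∀ n, 0 ≤ K n) (hθ : ∀ n, 0 < θ n)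
    (hρ : 0 < ρ (Fin.last M)) (hγth : 0 < γth) (hγ : 0 < γ) (L : Fin M → ℕ) :
    riceExpansion K θ ρ γth L γ = ∑ ℓ ∈ box L, (-1) ^ lam ℓ M * zetaCoeff K θ ρ ℓ *
      expansionTerm K ℓ (baseConst K θ ρ γth) γ := by
  set a := baseConst K θ ρ γth with ha
  rw [riceExpansion, ← ha, sum_indexSet L fun r ℓ => (-1) ^ lam ℓ M * zetaCoeff K θ ρ ℓ *
    ∑ l ∈ Finset.range r,
      varrhoDeriv K ℓ r (r - 1 - l) / (((r - 1 - l).factorial : ℝ) * (l.factorial : ℝ)) *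
        ∑ p ∈ Finset.range (l + 1),
          (l.choose p : ℝ) * (-1) ^ p * Real.log a ^ (l - p) * (Real.log γ ^ p / γ),
    Finset.mul_sum]
  have hlog (l : ℕ) : ∑ p ∈ Finset.range (l + 1),
      (l.choose p : ℝ) * (-1) ^ p * Real.log a ^ (l - p) * (Real.log γ ^ p / γ) =
        Real.log (a / γ) ^ l / γ := by
    rw [log_div_pow (baseConst_pos hK hθ hρ hγth) hγ, Finset.sum_div]
    exact Finset.sum_congr rfl fun p _ => mul_div_assoc' _ _ _
  refine Finset.sum_congr rfl fun ℓ _ => ?_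
  simp only [hlog, expansionTerm, Finset.mul_sum]
  exact Finset.sum_congr rfl fun l _ => by ring

lemma isLittleO_contourOutage_sub_riceExpansion (hK : ∀ n, 0 ≤ K n) (hθ : ∀ n, 0 < θ n)
    (hρ : 0 < ρ (Fin.last M)) (hγth : 0 < γth) {L : Fin M → ℕ} (hL : ∀ k, 1 ≤ L k)
    {κ : (Fin M → ℕ) → ℝ} (hκ : ∀ ℓ ∈ box L, 0 < κ ℓ) :
    (fun γ : ℝ => contourOutage K θ ρ γth L κ γ - (riceExpansion K θ ρ γth L γ : ℂ))
      =o[atTop] (fun γ : ℝ => γ⁻¹) := by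
  have ha := baseConst_pos hK hθ hρ hγth
  have hrest : (fun γ : ℝ => -∑ ℓ ∈ box L, (indexCoeff ρ ℓ * hopConst K θ ℓ : ℂ) *
      verticalIntegral (continuedIntegrand K ℓ (baseConst K θ ρ γth / γ)) (3 / 2 : ℝ))
      =o[atTop] (fun γ : ℝ => γ⁻¹) :=
    (IsLittleO.fun_sum fun ℓ _ => (isLittleO_verticalIntegral_continuedIntegrand K ℓ ha
      (by norm_num)).const_mul_left _).neg_left
  refine hrest.congr' ?_ EventuallyEq.rfl
  filter_upwards [eventually_gt_atTop 0] with γ hγ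
  rw [contourOutage_eq hK hθ hρ hγth hγ hL hκ,
    riceExpansion_eq_sum_expansionTerm hK hθ hρ hγth hγ, Complex.ofReal_sum,
    ← Finset.sum_sub_distrib, ← Finset.sum_neg_distrib]
  refine Finset.sum_congr rfl fun ℓ _ => ?_
  rw [iteratedDeriv_cpow_mul_varrhoC K ℓ ha hγ, ← indexCoeff_mul_hopConst]
  push_cast
  ring

lemma differentiableAt_continuedIntegrand (K : Fin (M + 1) → ℝ) (ℓ : Fin M → ℕ) {w : ℝ}
    (hw : w ≠ 0) {s : ℂ} (h0 : s ≠ 0) (hs : s.re < 1) :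
    DifferentiableAt ℂ (continuedIntegrand K ℓ w) s := by
  refine (differentiable_ofReal_cpow hw s).mul
    (((Polynomial.differentiable _ s).div differentiableAt_id h0).mul
      (DifferentiableAt.fun_finsetProd fun n _ => ?_))
  refine DifferentiableAt.comp s (differentiableAt_gammaKummer (K n) ?_) (by fun_prop)
  simp only [Complex.sub_re, Complex.add_re, Complex.one_re, Complex.natCast_re]
  linarith [Nat.cast_nonneg (α := ℝ) (lam ℓ n)]

lemma integrable_contourIntegrand (hK : ∀ n, 0 ≤ K n) (hθ : ∀ n, 0 < θ n)
    (hρ : 0 < ρ (Fin.last M)) (hγth : 0 < γth) (hγ : 0 < γ) (ℓ : Fin M → ℕ) {σ : ℝ} (hσ : σ < 0) :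
    Integrable fun t : ℝ => contourIntegrand K θ ρ γth ℓ γ (σ + t * Complex.I) := by
  have hw : 0 < baseConst K θ ρ γth / γ := div_pos (baseConst_pos hK hθ hρ hγth) hγ
  have hne {s : ℂ} (hs : s.re = σ) : s ≠ 0 := by
    rintro rfl
    exact hσ.ne' hs
  have heq (t : ℝ) : contourIntegrand K θ ρ γth ℓ γ (σ + t * Complex.I) = hopConst K θ ℓ *
      continuedIntegrand K ℓ (baseConst K θ ρ γth / γ) (σ + t * Complex.I) :=
    contourIntegrand_eq hK hθ hρ hγth hγ ℓ (hne (by simp)) (by simp; linarith)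
  simp only [heq]
  obtain ⟨C, hC⟩ := exists_norm_continuedIntegrand_le K ℓ hw σ σ
  refine (integrable_vertical le_rfl le_rfl (fun s hs => ?_) hC).const_mul _
  have hre : s.re = σ := le_antisymm hs.2 hs.1
  exact (differentiableAt_continuedIntegrand K ℓ hw.ne' (hne hre)
    (by linarith)).continuousAt.continuousWithinAt

end Expansion

/-! ### Asymptotics of the expansion -/

section LogAsymptotics

variable {a : ℝ}

lemma isEquivalent_log_div (ha : 0 < a) :
    IsEquivalent atTop (fun γ : ℝ => Real.log (a / γ)) (fun γ : ℝ => -Real.log γ) := by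
  have hconst : (fun _ : ℝ => Real.log a) =o[atTop] (fun γ : ℝ => -Real.log γ) :=
    Real.isLittleO_const_log_atTop.neg_right
  refine IsLittleO.congr' hconst ?_ EventuallyEq.rfl
  filter_upwards [eventually_gt_atTop 0] with γ hγ
  simp [Real.log_div ha.ne' hγ.ne']

lemma isLittleO_log_pow_div {l m : ℕ} (h : l < m) :
    (fun γ : ℝ => Real.log γ ^ l / γ) =o[atTop] (fun γ : ℝ => Real.log γ ^ m / γ) := by
  have hpow : (fun γ : ℝ => Real.log γ ^ l) =o[atTop] (fun γ : ℝ => Real.log γ ^ m) :=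
    (isLittleO_pow_pow_atTop_of_lt h).comp_tendsto Real.tendsto_log_atTop
  simpa [div_eq_mul_inv] using hpow.mul_isBigO (isBigO_refl (fun γ : ℝ => γ⁻¹) atTop)

lemma isLittleO_div_mul_log_pow_sub (ha : 0 < a) (l : ℕ) :
    (fun γ : ℝ => a / γ * Real.log (a / γ) ^ l - (-1) ^ l * a * (Real.log γ ^ l / γ))
      =o[atTop] (fun γ : ℝ => Real.log γ ^ l / γ) := by
  have hequiv := (IsEquivalent.refl (u := fun γ : ℝ => a / γ) (l := atTop)).mul
    ((isEquivalent_log_div ha).pow l)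
  have heq : (fun γ : ℝ => a / γ) * (fun γ : ℝ => -Real.log γ) ^ l =
      fun γ : ℝ => (-1) ^ l * a * (Real.log γ ^ l / γ) := by
    funext γ
    simp only [Pi.mul_apply, Pi.pow_apply, neg_pow (Real.log γ)]
    ring
  rw [heq] at hequiv
  exact hequiv.isLittleO.trans_isBigO (isBigO_const_mul_self _ _ _)

end LogAsymptotics

section ExpansionTerm

variable {M : ℕ} (K : Fin (M + 1) → ℝ) {ℓ : Fin M → ℕ} {a : ℝ} {r : ℕ}

lemma isLittleO_expansionTerm_sub (ha : 0 < a) (hr : zeroCount ℓ = r + 1) :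
    (fun γ : ℝ => expansionTerm K ℓ a γ -
      varrhoDeriv K ℓ (zeroCount ℓ) 0 / r.factorial * ((-1) ^ r * a * (Real.log γ ^ r / γ)))
      =o[atTop] (fun γ : ℝ => Real.log γ ^ r / γ) := by
  have hlead := (isLittleO_div_mul_log_pow_sub ha r).const_mul_left
    (varrhoDeriv K ℓ (zeroCount ℓ) 0 / r.factorial)
  have hlower : ∀ l ∈ Finset.range r, (fun γ : ℝ => varrhoDeriv K ℓ (r + 1) (r - l) /
      (((r - l).factorial : ℝ) * (l.factorial : ℝ)) * (a / γ * Real.log (a / γ) ^ l))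
      =o[atTop] (fun γ : ℝ => Real.log γ ^ r / γ) := by
    intro l hl
    refine IsLittleO.const_mul_left ?_ _
    have hlr := isLittleO_log_pow_div (Finset.mem_range.mp hl)
    simpa using ((isLittleO_div_mul_log_pow_sub ha l).isBigO.trans_isLittleO hlr).add
      (hlr.const_mul_left ((-1) ^ l * a))
  refine ((IsLittleO.fun_sum hlower).add hlead).congr_left fun γ => ?_
  rw [expansionTerm, hr, Finset.sum_range_succ]
  simp only [Nat.add_sub_cancel, Nat.sub_self, Nat.factorial_zero, Nat.cast_one, one_mul, mul_add,
    Finset.mul_sum]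
  rw [Finset.sum_congr rfl fun l _ => mul_left_comm (a / γ) _ _]
  ring

lemma isBigO_expansionTerm (ha : 0 < a) (hr : zeroCount ℓ = r + 1) :
    expansionTerm K ℓ a =O[atTop] (fun γ : ℝ => Real.log γ ^ r / γ) := by
  have hlead : (fun γ : ℝ => varrhoDeriv K ℓ (zeroCount ℓ) 0 / r.factorial *
      ((-1) ^ r * a * (Real.log γ ^ r / γ))) =O[atTop] (fun γ : ℝ => Real.log γ ^ r / γ) :=
    ((isBigO_refl _ _).const_mul_left _).const_mul_left _
  simpa using (isLittleO_expansionTerm_sub K ha hr).isBigO.add hlead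

lemma isLittleO_expansionTerm (ha : 0 < a) (hr : zeroCount ℓ ≤ r) :
    expansionTerm K ℓ a =o[atTop] (fun γ : ℝ => Real.log γ ^ r / γ) := by
  obtain ⟨q, hq⟩ := Nat.exists_eq_succ_of_ne_zero (zeroCount_pos ℓ).ne'
  exact (isBigO_expansionTerm K ha hq).trans_isLittleO (isLittleO_log_pow_div (by omega))

end ExpansionTerm

lemma hopFactor_zero_one (K : ℝ) : hopFactor K 0 1 = -1 := by
  rw [hopFactor, if_pos rfl, sub_self, kummerC_zero, show (2 : ℂ) - 1 = 1 by norm_num,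
    Complex.Gamma_one, one_mul]

lemma hopFactor_one_one (K : ℝ) : hopFactor K 1 1 = Complex.exp K := by
  rw [hopFactor, if_neg one_ne_zero, Nat.cast_one, add_sub_cancel_right, gammaKummer,
    Complex.Gamma_one, one_mul, kummerC_one]

lemma gammaQuot_eval_one_of_two_le {j : ℕ} (hj : 2 ≤ j) : (gammaQuot j).eval 1 = 0 := by
  obtain ⟨i, rfl⟩ := Nat.exists_eq_add_of_le' hj
  simp [gammaQuot]

section ZeroIndex

variable {M : ℕ}

lemma zeroCount_zero : zeroCount (0 : Fin M → ℕ) = M + 1 := by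
  simp [zeroCount, lam_zero_fun]

lemma eq_zero_of_zeroCount_eq {ℓ : Fin M → ℕ} (h : zeroCount ℓ = M + 1) : ℓ = 0 := by
  have huniv : Finset.univ.filter (fun n : Fin (M + 1) => lam ℓ n = 0) = Finset.univ :=
    (Finset.card_eq_iff_eq_univ _).mp (by simpa [zeroCount] using h)
  exact eq_zero_of_lam_eq_zero
    (by simpa using Finset.filter_eq_self.mp huniv (Fin.last M) (Finset.mem_univ _))

lemma varrhoDeriv_zero_zero (K : Fin (M + 1) → ℝ) :
    varrhoDeriv K (0 : Fin M → ℕ) (zeroCount (0 : Fin M → ℕ)) 0 = (-1) ^ M := by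
  refine Complex.ofReal_injective ?_
  rw [ofReal_varrhoDeriv_zero]
  simp [lam_zero_fun, hopFactor_zero_one, gammaQuot, pow_succ]

lemma zetaCoeff_zero (K θ ρ : Fin (M + 1) → ℝ) :
    zetaCoeff K θ ρ 0 = ∏ n, Real.exp (-K n) := by
  rw [Fin.prod_univ_castSucc, zetaCoeff, mul_comm]
  simp [lam_zero_fun]

lemma riceLeading_eq (K θ ρ : Fin (M + 1) → ℝ) (γth γ : ℝ) :
    riceLeading K θ ρ γth γ = zetaCoeff K θ ρ 0 *
      (baseConst K θ ρ γth / M.factorial * (Real.log γ ^ M / γ)) := by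
  rw [riceLeading, zetaCoeff_zero, baseConst, Finset.prod_div_distrib, Finset.prod_mul_distrib]
  simp only [Real.exp_neg, Finset.prod_inv_distrib]
  field_simp

variable {K θ ρ : Fin (M + 1) → ℝ} {γth : ℝ}

lemma isLittleO_riceExpansion_sub_riceLeading (hK : ∀ n, 0 ≤ K n) (hθ : ∀ n, 0 < θ n)
    (hρ : 0 < ρ (Fin.last M)) (hγth : 0 < γth) {L : Fin M → ℕ} (hL : ∀ k, 1 ≤ L k) :
    (fun γ => riceExpansion K θ ρ γth L γ - riceLeading K θ ρ γth γ)
      =o[atTop] (fun γ : ℝ => Real.log γ ^ M / γ) := by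
  have ha := baseConst_pos hK hθ hρ hγth
  have hzero := (isLittleO_expansionTerm_sub K (ℓ := 0) ha zeroCount_zero).const_mul_left
    (zetaCoeff K θ ρ 0)
  have hother : ∀ ℓ ∈ (box L).erase 0, (fun γ : ℝ => (-1) ^ lam ℓ M * zetaCoeff K θ ρ ℓ *
      expansionTerm K ℓ (baseConst K θ ρ γth) γ) =o[atTop] (fun γ : ℝ => Real.log γ ^ M / γ) := by
    intro ℓ hℓ
    have hne : zeroCount ℓ ≠ M + 1 := mt eq_zero_of_zeroCount_eq (Finset.mem_erase.mp hℓ).1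
    have hle := zeroCount_le ℓ
    exact (isLittleO_expansionTerm K ha (by omega)).const_mul_left _
  refine ((IsLittleO.fun_sum hother).add hzero).congr' ?_ EventuallyEq.rfl
  filter_upwards [eventually_gt_atTop 0] with γ hγ
  rw [riceExpansion_eq_sum_expansionTerm hK hθ hρ hγth hγ L,
    ← Finset.sum_erase_add _ _ (zero_mem_box hL), riceLeading_eq, varrhoDeriv_zero_zero,
    lam_zero_fun]
  have hsign : (-1 : ℝ) ^ M * (-1) ^ M = 1 := by rw [← mul_pow]; simp
  linear_combination
    (-(zetaCoeff K θ ρ 0 * baseConst K θ ρ γth / M.factorial * (Real.log γ ^ M / γ))) * hsign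

end ZeroIndex

section LastIndex

variable {m : ℕ}

/-- The index `(0, …, 0, 1)`. -/
def lastIndex (m : ℕ) : Fin (m + 1) → ℕ := Pi.single (Fin.last m) 1

lemma lam_lastIndex (m n : ℕ) : lam (lastIndex m) n = if m < n then 1 else 0 := by
  simp [lam, lastIndex]

lemma zeroCount_lastIndex (m : ℕ) : zeroCount (lastIndex m) = m + 1 :=
  zeroCount_eq (by simp) (by simp [lam_lastIndex]) (by simp [lam_lastIndex])

lemma lastIndex_mem_box {L : Fin (m + 1) → ℕ} (hL : ∀ k, 2 ≤ L k) : lastIndex m ∈ box L := by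
  refine Fintype.mem_piFinset.mpr fun k => Finset.mem_range.mpr ((?_ : _ < 2).trans_le (hL k))
  rw [lastIndex, Pi.single_apply]
  split_ifs <;> norm_num

lemma lastIndex_ne_zero (m : ℕ) : lastIndex m ≠ 0 := by simp [lastIndex]

lemma varrhoDeriv_lastIndex (K : Fin (m + 1 + 1) → ℝ) :
    varrhoDeriv K (lastIndex m) (zeroCount (lastIndex m)) 0 =
      (-1) ^ (m + 1) * Real.exp (K (Fin.last (m + 1))) := by
  refine Complex.ofReal_injective ?_
  rw [ofReal_varrhoDeriv_zero, Fin.prod_univ_castSucc]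
  have hfirst (n : Fin (m + 1)) :
      hopFactor (K n.castSucc) (lam (lastIndex m) (n.castSucc : Fin (m + 2))) 1 = -1 := by
    rw [lam_lastIndex, if_neg (by simpa using n.is_le), hopFactor_zero_one]
  rw [Finset.prod_congr rfl fun n _ => hfirst n]
  simp [lam_lastIndex, hopFactor_one_one, gammaQuot]

lemma eq_single_last_of_lam_eq_zero {ℓ : Fin (m + 1) → ℕ} (h : lam ℓ m = 0) :
    ℓ = Pi.single (Fin.last m) (lam ℓ (m + 1)) := by
  have hzero (k : Fin m) : ℓ k.castSucc = 0 := Finset.sum_eq_zero_iff.mp h _ (by simp)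
  funext k
  induction k using Fin.lastCases with
  | last =>
    simp only [lam, Fin.is_lt, Finset.filter_true, Fin.sum_univ_castSucc, hzero,
      Finset.sum_const_zero, zero_add, Pi.single_eq_same]
  | cast k => simp [hzero]

lemma varrhoDeriv_eq_zero_of_ne_lastIndex (K : Fin (m + 1 + 1) → ℝ) {ℓ : Fin (m + 1) → ℕ}
    (h : zeroCount ℓ = m + 1) (hne : ℓ ≠ lastIndex m) :
    varrhoDeriv K ℓ (zeroCount ℓ) 0 = 0 := by
  have hmem : ℓ ∈ indexSet (fun k => ℓ k + 1) (m + 1) :=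
    (mem_indexSet_iff (by simp)).mpr ⟨by simp [box], h⟩
  obtain ⟨hzero, hpos⟩ := (Finset.mem_filter.mp hmem).2
  have htwo : 2 ≤ lam ℓ (m + 1) := by
    refine Nat.lt_of_le_of_ne (hpos le_rfl) fun hone => hne ?_
    rw [eq_single_last_of_lam_eq_zero hzero, ← hone, lastIndex]
  refine Complex.ofReal_injective ?_
  rw [ofReal_varrhoDeriv_zero, gammaQuot_eval_one_of_two_le htwo, zero_mul, Complex.ofReal_zero]

lemma isLittleO_expansionTerm_of_ne (K : Fin (m + 1 + 1) → ℝ) {ℓ : Fin (m + 1) → ℕ} {a : ℝ}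
    (ha : 0 < a) (hzero : ℓ ≠ 0) (hlast : ℓ ≠ lastIndex m) :
    expansionTerm K ℓ a =o[atTop] (fun γ : ℝ => Real.log γ ^ m / γ) := by
  rcases eq_or_ne (zeroCount ℓ) (m + 1) with hcount | hcount
  · simpa [varrhoDeriv_eq_zero_of_ne_lastIndex K hcount hlast] using
      isLittleO_expansionTerm_sub K ha hcount
  · have hne : zeroCount ℓ ≠ m + 1 + 1 := mt eq_zero_of_zeroCount_eq hzero
    have hle := zeroCount_le ℓ
    exact isLittleO_expansionTerm K ha (by omega)

variable {K θ ρ : Fin (m + 1 + 1) → ℝ} {γth : ℝ}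

lemma zetaCoeff_lastIndex (K θ ρ : Fin (m + 1 + 1) → ℝ) :
    zetaCoeff K θ ρ (lastIndex m) = (∏ n, Real.exp (-K n)) *
      (ρ (Fin.last m).castSucc / ρ (Fin.last (m + 1))) *
      (θ (Fin.last (m + 1)) / (K (Fin.last (m + 1)) + 1)) := by
  have hfact (k : Fin (m + 1)) : (lastIndex m k).factorial = 1 := by
    rw [lastIndex, Pi.single_apply]
    split_ifs <;> rfl
  have hρprod : ∏ k : Fin (m + 1), (ρ k.castSucc / ρ (Fin.last (m + 1))) ^ lastIndex m k =
      ρ (Fin.last m).castSucc / ρ (Fin.last (m + 1)) := by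
    simp [lastIndex, Fin.prod_univ_castSucc]
  have hθprod : ∏ k : Fin (m + 1), (θ k.succ / (K k.succ + 1)) ^ lam (lastIndex m) (k + 1) =
      θ (Fin.last (m + 1)) / (K (Fin.last (m + 1)) + 1) := by
    simp [lam_lastIndex, Fin.prod_univ_castSucc, fun k : Fin m => k.is_lt.not_ge]
  rw [zetaCoeff, Finset.prod_mul_distrib, Finset.prod_mul_distrib, hρprod, hθprod,
    Fin.prod_univ_castSucc (fun n => Real.exp (-K n))]
  simp only [hfact, Nat.cast_one, div_one]
  ring

lemma riceLeading_castSucc (hK : 0 ≤ K (Fin.last (m + 1))) (hθ : 0 < θ (Fin.last (m + 1)))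
    (hρ : 0 < ρ (Fin.last (m + 1))) (γ : ℝ) :
    riceLeading (fun n => K n.castSucc) (fun n => θ n.castSucc) (fun n => ρ n.castSucc) γth γ =
      zetaCoeff K θ ρ (lastIndex m) * Real.exp (K (Fin.last (m + 1))) *
        (baseConst K θ ρ γth / m.factorial * (Real.log γ ^ m / γ)) := by
  have hK1 : K (Fin.last (m + 1)) + 1 ≠ 0 := by linarith
  rw [riceLeading_eq, zetaCoeff_zero, zetaCoeff_lastIndex, baseConst, baseConst]
  simp only [Fin.prod_univ_castSucc (n := m + 1), Real.exp_neg (K (Fin.last (m + 1)))]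
  field_simp

lemma box_one (n : ℕ) : box (fun _ : Fin n => 1) = {0} := by
  ext ℓ
  simp [box, funext_iff]

lemma isLittleO_riceExpansion_sub_riceExpansion_one (hK : ∀ n, 0 ≤ K n) (hθ : ∀ n, 0 < θ n)
    (hρ : 0 < ρ (Fin.last (m + 1))) (hγth : 0 < γth) {L : Fin (m + 1) → ℕ} (hL : ∀ k, 2 ≤ L k) :
    (fun γ => riceExpansion K θ ρ γth L γ - riceExpansion K θ ρ γth (fun _ => 1) γ -
      riceLeading (fun n => K n.castSucc) (fun n => θ n.castSucc) (fun n => ρ n.castSucc) γth γ)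
      =o[atTop] (fun γ : ℝ => Real.log γ ^ m / γ) := by
  have ha := baseConst_pos hK hθ hρ hγth
  have hlast := (isLittleO_expansionTerm_sub K ha (zeroCount_lastIndex m)).const_mul_left
    (-zetaCoeff K θ ρ (lastIndex m))
  have hother : ∀ ℓ ∈ ((box L).erase 0).erase (lastIndex m), (fun γ : ℝ =>
      (-1) ^ lam ℓ (m + 1) * zetaCoeff K θ ρ ℓ * expansionTerm K ℓ (baseConst K θ ρ γth) γ)
      =o[atTop] (fun γ : ℝ => Real.log γ ^ m / γ) := by
    intro ℓ hℓ
    rw [Finset.mem_erase, Finset.mem_erase] at hℓ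
    exact (isLittleO_expansionTerm_of_ne K ha hℓ.2.1 hℓ.1).const_mul_left _
  refine ((IsLittleO.fun_sum hother).add hlast).congr' ?_ EventuallyEq.rfl
  filter_upwards [eventually_gt_atTop 0] with γ hγ
  have hmem : lastIndex m ∈ (box L).erase 0 :=
    Finset.mem_erase.mpr ⟨lastIndex_ne_zero m, lastIndex_mem_box hL⟩
  rw [riceExpansion_eq_sum_expansionTerm hK hθ hρ hγth hγ L,
    riceExpansion_eq_sum_expansionTerm hK hθ hρ hγth hγ, box_one, Finset.sum_singleton,
    ← Finset.sum_erase_add _ _ (zero_mem_box fun k => one_le_two.trans (hL k)),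
    add_sub_cancel_right, ← Finset.sum_erase_add _ _ hmem,
    riceLeading_castSucc (hK _) (hθ _) hρ, varrhoDeriv_lastIndex, lam_lastIndex,
    if_pos (Nat.lt_succ_self m)]
  have hsign : (-1 : ℝ) ^ m * (-1) ^ m = 1 := by rw [← mul_pow]; simp
  linear_combination (-zetaCoeff K θ ρ (lastIndex m) * Real.exp (K (Fin.last (m + 1))) *
    (baseConst K θ ρ γth / m.factorial * (Real.log γ ^ m / γ))) * hsign

end LastIndex

/-! ### The Rician power law -/

section RicianLaw

variable {K θ : ℝ}

lemma integral_ricianLaw (hK : 0 ≤ K) (hθ : 0 < θ) (g : ℝ → ℂ) :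
    ∫ x, g x ∂(ricianLaw K θ) = ∫ x in Set.Ioi 0, g x * (ricianPDF K θ x : ℂ) := by
  rw [ricianLaw, integral_withDensity_eq_integral_toReal_smul
    (measurable_ricianPDF K θ).ennreal_ofReal (ae_of_all _ fun x => ENNReal.ofReal_lt_top),
    ← integral_Ici_eq_integral_Ioi, ← integral_indicator measurableSet_Ici]
  congr 1
  funext x
  rw [ENNReal.toReal_ofReal (ricianPDF_nonneg hK hθ x), Complex.real_smul, mul_comm]
  by_cases hx : 0 ≤ x
  · rw [Set.indicator_of_mem (Set.mem_Ici.mpr hx)]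
  · rw [Set.indicator_of_notMem (by simpa using hx), ricianPDF, if_neg hx]
    simp

lemma integral_cpow_ricianLaw (hK : 0 ≤ K) (hθ : 0 < θ) (s : ℂ) :
    ∫ x, (x : ℂ) ^ s ∂(ricianLaw K θ) = mellin (fun x => (ricianPDF K θ x : ℂ)) (1 + s) := by
  rw [integral_ricianLaw hK hθ, mellin]
  simp

lemma mellin_ricianPDF_one (hK : 0 ≤ K) (hθ : 0 < θ) :
    mellin (fun x => (ricianPDF K θ x : ℂ)) 1 = 1 := by
  rw [mellin_ricianPDF hK hθ (by simp), sub_self, Complex.cpow_zero, gammaKummer,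
    Complex.Gamma_one, kummerC_one, mul_one, one_mul, ← Complex.exp_add]
  simp

lemma mellin_ricianPDF_ofReal_ne_zero (hK : 0 ≤ K) (hθ : 0 < θ) {σ : ℝ} (hσ : 0 < σ) :
    mellin (fun x => (ricianPDF K θ x : ℂ)) σ ≠ 0 := by
  have hb : (((K + 1) / θ : ℝ) : ℂ) ≠ 0 := Complex.ofReal_ne_zero.mpr (by positivity)
  rw [mellin_ricianPDF hK hθ (by simpa using hσ)]
  refine mul_ne_zero (mul_ne_zero (Complex.exp_ne_zero _) ?_) (gammaKummer_ofReal_ne_zero hK hσ)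
  simp only [ne_eq, Complex.cpow_eq_zero_iff, hb, false_and, not_false_iff]

lemma isProbabilityMeasure_ricianLaw (hK : 0 ≤ K) (hθ : 0 < θ) :
    IsProbabilityMeasure (ricianLaw K θ) := by
  have hmass := integral_cpow_ricianLaw hK hθ 0
  simp only [Complex.cpow_zero, add_zero, mellin_ricianPDF_one hK hθ, integral_const,
    Complex.real_smul, mul_one] at hmass
  exact ⟨(ENNReal.toReal_eq_one_iff _).mp (by exact_mod_cast hmass)⟩

lemma ricianLaw_absolutelyContinuous (K θ : ℝ) : ricianLaw K θ ≪ volume :=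
  withDensity_absolutelyContinuous _ _

lemma ricianLaw_singleton (K θ x : ℝ) : ricianLaw K θ {x} = 0 :=
  ricianLaw_absolutelyContinuous K θ (by simp)

lemma ae_pos_ricianLaw (K θ : ℝ) : ∀ᵐ x ∂(ricianLaw K θ), 0 < x := by
  have hnonneg : ∀ᵐ x ∂(ricianLaw K θ), 0 ≤ x := by
    rw [ricianLaw, ae_withDensity_iff (measurable_ricianPDF K θ).ennreal_ofReal]
    refine ae_of_all _ fun x hx => not_lt.mp fun hneg => hx ?_
    rw [ricianPDF, if_neg hneg.not_ge, ENNReal.ofReal_zero]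
  filter_upwards [hnonneg, (ricianLaw_absolutelyContinuous K θ).ae_le (Measure.ae_ne volume 0)]
    with x hx hne
  exact lt_of_le_of_ne hx hne.symm

end RicianLaw

/-! ### Mellin inversion of a distribution function -/

section Tail

/-- The kernel `(z, y) ↦ z ^ (s - 1) 1{z ≤ y}`: integrating out `y` against a law gives the
integrand of the Mellin transform of its tail, integrating out `z > 0` gives `y ^ s / s`. -/
noncomputable def tailKernel (s : ℂ) : ℝ × ℝ → ℂ :=
  Set.indicator {p | p.1 ≤ p.2} fun p => (p.1 : ℂ) ^ (s - 1)

lemma measurable_tailKernel (s : ℂ) : Measurable (tailKernel s) :=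
  Measurable.indicator (by fun_prop) (measurableSet_le measurable_fst measurable_snd)

lemma tailKernel_left (s : ℂ) (y : ℝ) :
    (fun z => tailKernel s (z, y)) = Set.indicator (Set.Iic y) fun z => (z : ℂ) ^ (s - 1) := rfl

lemma integral_tailKernel_right (ν : Measure ℝ) (s : ℂ) (z : ℝ) :
    ∫ y, tailKernel s (z, y) ∂ν = (z : ℂ) ^ (s - 1) * (ν.real (Set.Ici z) : ℂ) := by
  have hsection : (fun y => tailKernel s (z, y)) =
      Set.indicator (Set.Ici z) fun _ => (z : ℂ) ^ (s - 1) := rfl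
  rw [hsection, integral_indicator measurableSet_Ici, setIntegral_const, Complex.real_smul,
    mul_comm]

variable {s : ℂ}

lemma integrableOn_tailKernel_left (hs : 0 < s.re) {y : ℝ} (hy : 0 < y) :
    IntegrableOn (fun z => tailKernel s (z, y)) (Set.Ioi 0) := by
  have hcpow := intervalIntegral.intervalIntegrable_cpow' (a := 0) (b := y) (r := s - 1)
    (by simpa using hs)
  rw [intervalIntegrable_iff_integrableOn_Ioc_of_le hy.le] at hcpow
  rwa [tailKernel_left, IntegrableOn, integrable_indicator_iff measurableSet_Iic, IntegrableOn,
    Measure.restrict_restrict measurableSet_Iic, Set.inter_comm, Set.Ioi_inter_Iic]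

lemma setIntegral_tailKernel_left (hs : 0 < s.re) {y : ℝ} (hy : 0 < y) :
    ∫ z in Set.Ioi (0 : ℝ), tailKernel s (z, y) = (y : ℂ) ^ s / s := by
  have hs_ne : s ≠ 0 := by
    rintro rfl
    simp at hs
  rw [tailKernel_left, setIntegral_indicator measurableSet_Iic, Set.Ioi_inter_Iic,
    ← intervalIntegral.integral_of_le hy.le, integral_cpow (Or.inl (by simpa using hs))]
  simp [hs_ne]

lemma norm_tailKernel (s : ℂ) {z : ℝ} (hz : 0 < z) (y : ℝ) :
    ((‖tailKernel s (z, y)‖ : ℝ) : ℂ) = tailKernel s.re (z, y) := by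
  simp only [tailKernel, Set.indicator, Set.mem_ofPred_eq]
  split_ifs
  · simp [Complex.norm_cpow_eq_rpow_re_of_pos hz, Complex.ofReal_cpow hz.le]
  · simp

lemma setIntegral_norm_tailKernel_left (hs : 0 < s.re) {y : ℝ} (hy : 0 < y) :
    ∫ z in Set.Ioi (0 : ℝ), ‖tailKernel s (z, y)‖ = y ^ s.re / s.re := by
  have hcomplex : ∫ z in Set.Ioi (0 : ℝ), ((‖tailKernel s (z, y)‖ : ℝ) : ℂ) =
      (y : ℂ) ^ (s.re : ℂ) / s.re := by
    rw [← setIntegral_tailKernel_left (s := s.re) (by simpa using hs) hy]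
    exact setIntegral_congr_fun measurableSet_Ioi fun z hz => norm_tailKernel s hz y
  rw [integral_complex_ofReal, ← Complex.ofReal_cpow hy.le] at hcomplex
  exact_mod_cast hcomplex

variable {ν : Measure ℝ} [IsFiniteMeasure ν]

lemma integrable_tailKernel (hν : ∀ᵐ y ∂ν, 0 < y) (hs : 0 < s.re)
    (hint : Integrable (fun y => y ^ s.re) ν) :
    Integrable (tailKernel s) ((volume.restrict (Set.Ioi (0 : ℝ))).prod ν) := by
  refine (integrable_prod_iff' (measurable_tailKernel s).aestronglyMeasurable).mpr ⟨?_, ?_⟩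
  · filter_upwards [hν] with y hy
    exact integrableOn_tailKernel_left hs hy
  · refine (hint.div_const s.re).congr ?_
    filter_upwards [hν] with y hy
    exact (setIntegral_norm_tailKernel_left hs hy).symm

lemma mellinConvergent_measureReal_Ici (hν : ∀ᵐ y ∂ν, 0 < y) (hs : 0 < s.re)
    (hint : Integrable (fun y => y ^ s.re) ν) :
    MellinConvergent (fun z => (ν.real (Set.Ici z) : ℂ)) s :=
  (integrable_tailKernel hν hs hint).integral_prod_left.congr
    (ae_of_all _ fun z => integral_tailKernel_right ν s z)

lemma mellin_measureReal_Ici (hν : ∀ᵐ y ∂ν, 0 < y) (hs : 0 < s.re)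
    (hint : Integrable (fun y => y ^ s.re) ν) :
    mellin (fun z => (ν.real (Set.Ici z) : ℂ)) s = (∫ y : ℝ, (y : ℂ) ^ s ∂ν) / s := by
  have hswap := integral_integral_swap (f := fun z y => tailKernel s (z, y))
    (integrable_tailKernel hν hs hint)
  simp only [integral_tailKernel_right] at hswap
  rw [mellin, ← integral_div]
  refine hswap.trans (integral_congr_ae ?_)
  filter_upwards [hν] with y hy
  exact setIntegral_tailKernel_left hs hy

lemma continuousAt_measureReal_Ici {z : ℝ} (hz : ν {z} = 0) :
    ContinuousAt (fun z => ν.real (Set.Ici z)) z := by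
  have hindicator (x : ℝ) : ν.real (Set.Ici x) = ∫ y, Set.indicator (Set.Ici x) 1 y ∂ν :=
    (integral_indicator_one measurableSet_Ici).symm
  simp only [hindicator]
  refine continuousAt_of_dominated (bound := fun _ => 1)
    (Eventually.of_forall fun x =>
      (measurable_one.indicator measurableSet_Ici).aestronglyMeasurable)
    (Eventually.of_forall fun x => ae_of_all _ fun y => ?_) (integrable_const _) ?_
  · exact (norm_indicator_le_norm_self _ _).trans (by simp)
  · have hne : ∀ᵐ y ∂ν, y ≠ z := compl_mem_ae_iff.mpr hz
    filter_upwards [hne] with y hy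
    refine (continuousAt_const (y := Set.indicator (Set.Ici z) (1 : ℝ → ℝ) y)).congr ?_
    rcases lt_or_gt_of_ne hy with hlt | hgt
    · filter_upwards [eventually_gt_nhds hlt] with t ht
      simp [Set.indicator, hlt.not_ge, ht.not_ge]
    · filter_upwards [eventually_lt_nhds hgt] with t ht
      simp [Set.indicator, hgt.le, ht.le]

lemma measureReal_Iio_eq_one_sub_mellinInv {ν : Measure ℝ} [IsProbabilityMeasure ν]
    (hν : ∀ᵐ y ∂ν, 0 < y) {σ : ℝ} (hσ : 0 < σ) (hint : Integrable (fun y => y ^ σ) ν)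
    (hvert : Complex.VerticalIntegrable (fun s => (∫ y : ℝ, (y : ℂ) ^ s ∂ν) / s) σ) {z : ℝ}
    (hz : 0 < z) (hz_null : ν {z} = 0) :
    (ν.real (Set.Iio z) : ℂ) = 1 - mellinInv σ (fun s => (∫ y : ℝ, (y : ℂ) ^ s ∂ν) / s) z := by
  have hmellin (t : ℝ) : mellin (fun x => (ν.real (Set.Ici x) : ℂ)) (σ + t * Complex.I) =
      (∫ y : ℝ, (y : ℂ) ^ (σ + t * Complex.I) ∂ν) / (σ + t * Complex.I) :=
    mellin_measureReal_Ici hν (by simpa using hσ) (by simpa using hint)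
  have hinv := mellinInv_mellin_eq σ (fun x => (ν.real (Set.Ici x) : ℂ)) hz
    (mellinConvergent_measureReal_Ici hν (by simpa using hσ) (by simpa using hint))
    (hvert.congr (ae_of_all _ fun t => (hmellin t).symm))
    (Complex.continuous_ofReal.continuousAt.comp (continuousAt_measureReal_Ici hz_null))
  simp only [mellinInv, hmellin] at hinv ⊢
  rw [hinv, ← Set.compl_Iio, probReal_compl_eq_one_sub measurableSet_Iio]
  push_cast
  ring

end Tail

/-! ### Families of independent Rician powers -/

section IsRicianFamily

/-- The random variables `X n` are independent and `X n` has the Rician power law with parameters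
`K n ≥ 0` and `θ n > 0`. -/
structure IsRicianFamily {ι Ω : Type*} [MeasurableSpace Ω] (X : ι → Ω → ℝ) (K θ : ι → ℝ)
    (μ : Measure Ω) : Prop where
  nonneg : ∀ n, 0 ≤ K n
  pos : ∀ n, 0 < θ n
  map_eq : ∀ n, μ.map (X n) = ricianLaw (K n) (θ n)
  indep : iIndepFun X μ

variable {ι Ω : Type*} [MeasurableSpace Ω] {μ : Measure Ω} {X : ι → Ω → ℝ} {K θ : ι → ℝ}

namespace IsRicianFamily

lemma precomp (hX : IsRicianFamily X K θ μ) {ι' : Type*} {g : ι' → ι} (hg : g.Injective) :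
    IsRicianFamily (fun i => X (g i)) (fun i => K (g i)) (fun i => θ (g i)) μ where
  nonneg i := hX.nonneg (g i)
  pos i := hX.pos (g i)
  map_eq i := hX.map_eq (g i)
  indep := hX.indep.precomp hg

lemma aemeasurable (hX : IsRicianFamily X K θ μ) (n : ι) : AEMeasurable (X n) μ := by
  have := isProbabilityMeasure_ricianLaw (hX.nonneg n) (hX.pos n)
  refine AEMeasurable.of_map_ne_zero ?_
  rw [hX.map_eq n]
  exact IsProbabilityMeasure.ne_zero _

lemma ae_pos [Countable ι] (hX : IsRicianFamily X K θ μ) : ∀ᵐ ω ∂μ, ∀ n, 0 < X n ω :=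
  ae_all_iff.mpr fun n => ae_of_ae_map (hX.aemeasurable n)
    (hX.map_eq n ▸ ae_pos_ricianLaw (K n) (θ n))

variable [Fintype ι]

lemma aemeasurable_prod (hX : IsRicianFamily X K θ μ) : AEMeasurable (fun ω => ∏ n, X n ω) μ :=
  Finset.aemeasurable_fun_prod _ fun n _ => hX.aemeasurable n

lemma ae_map_prod_pos (hX : IsRicianFamily X K θ μ) :
    ∀ᵐ y ∂(μ.map fun ω => ∏ n, X n ω), 0 < y := by
  rw [ae_map_iff hX.aemeasurable_prod measurableSet_Ioi]
  filter_upwards [hX.ae_pos] with ω hω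
  exact Finset.prod_pos fun n _ => hω n

lemma integral_cpow_map_prod (hX : IsRicianFamily X K θ μ) (s : ℂ) :
    ∫ y : ℝ, (y : ℂ) ^ s ∂(μ.map fun ω => ∏ n, X n ω) =
      ∏ n, mellin (fun x => (ricianPDF (K n) (θ n) x : ℂ)) (1 + s) := by
  have hmeas : Measurable fun x : ℝ => (x : ℂ) ^ s := by fun_prop
  calc ∫ y : ℝ, (y : ℂ) ^ s ∂(μ.map fun ω => ∏ n, X n ω)
      = ∫ ω, ((∏ n, X n ω : ℝ) : ℂ) ^ s ∂μ :=
        integral_map hX.aemeasurable_prod hmeas.aestronglyMeasurable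
    _ = ∫ ω, ∏ n, (X n ω : ℂ) ^ s ∂μ := by
        refine integral_congr_ae ?_
        filter_upwards [hX.ae_pos] with ω hω
        exact prod_ofReal_cpow _ (fun n => (hω n).le) s
    _ = ∏ n, ∫ ω, (X n ω : ℂ) ^ s ∂μ :=
        hX.indep.integral_fun_prod_comp (f := fun _ (x : ℝ) => (x : ℂ) ^ s) hX.aemeasurable
          fun _ => hmeas.aestronglyMeasurable
    _ = ∏ n, mellin (fun x => (ricianPDF (K n) (θ n) x : ℂ)) (1 + s) := by
        refine Finset.prod_congr rfl fun n _ => ?_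
        rw [← integral_cpow_ricianLaw (hX.nonneg n) (hX.pos n), ← hX.map_eq n,
          integral_map (hX.aemeasurable n) hmeas.aestronglyMeasurable]

lemma integrable_rpow_map_prod (hX : IsRicianFamily X K θ μ) {σ : ℝ} (hσ : 0 < σ) :
    Integrable (fun y => y ^ σ) (μ.map fun ω => ∏ n, X n ω) := by
  have hne : ∏ n, mellin (fun x => (ricianPDF (K n) (θ n) x : ℂ)) (1 + σ) ≠ 0 :=
    Finset.prod_ne_zero_iff.mpr fun n _ => by
      exact_mod_cast mellin_ricianPDF_ofReal_ne_zero (hX.nonneg n) (hX.pos n)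
        (by linarith : 0 < 1 + σ)
  rw [← hX.integral_cpow_map_prod] at hne
  refine (Integrable.of_integral_ne_zero hne).re.congr ?_
  filter_upwards [hX.ae_map_prod_pos] with y hy
  simp [← Complex.ofReal_cpow hy.le]

end IsRicianFamily

lemma measure_preimage_prodMk_of_indepFun {α β : Type*} [MeasurableSpace α] [MeasurableSpace β]
    [IsFiniteMeasure μ] {Z : Ω → α} {Y : Ω → β} (hZ : AEMeasurable Z μ) (hY : AEMeasurable Y μ)
    (hZY : IndepFun Z Y μ) {s : Set (α × β)} (hs : MeasurableSet s) :
    μ {ω | (Z ω, Y ω) ∈ s} = ∫⁻ ω, μ.map Y (Prod.mk (Z ω) ⁻¹' s) ∂μ := by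
  calc μ {ω | (Z ω, Y ω) ∈ s}
      = ((μ.map Z).prod (μ.map Y)) s := by
        rw [← (indepFun_iff_map_prod_eq_prod_map_map hZ hY).mp hZY,
          Measure.map_apply_of_aemeasurable (hZ.prodMk hY) hs]
        rfl
    _ = ∫⁻ z, μ.map Y (Prod.mk z ⁻¹' s) ∂(μ.map Z) := Measure.prod_apply hs
    _ = ∫⁻ ω, μ.map Y (Prod.mk (Z ω) ⁻¹' s) ∂μ :=
        lintegral_map' (measurable_measure_prodMk_left hs).aemeasurable hZ

lemma measureReal_lt_of_indepFun [IsFiniteMeasure μ] {Y Z : Ω → ℝ} (hY : AEMeasurable Y μ)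
    (hZ : AEMeasurable Z μ) (hZY : IndepFun Z Y μ) :
    μ.real {ω | Y ω < Z ω} = ∫ ω, (μ.map Y).real (Set.Iio (Z ω)) ∂μ := by
  have hs : MeasurableSet {p : ℝ × ℝ | p.2 < p.1} := measurableSet_lt measurable_snd measurable_fst
  rw [measureReal_def]
  exact (congrArg ENNReal.toReal (measure_preimage_prodMk_of_indepFun hZ hY hZY hs)).trans
    (integral_toReal ((measurable_measure_prodMk_left hs).comp_aemeasurable hZ)
      (ae_of_all _ fun ω => measure_lt_top _ _)).symm

lemma measure_mul_eq_zero_of_indepFun [IsFiniteMeasure μ] {Y Z : Ω → ℝ} (hZ : AEMeasurable Z μ)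
    (hY : AEMeasurable Y μ) (hZY : IndepFun Z Y μ) (hatoms : ∀ x, μ.map Y {x} = 0) {z : ℝ}
    (hz : z ≠ 0) : μ {ω | Z ω * Y ω = z} = 0 := by
  refine (measure_preimage_prodMk_of_indepFun (s := {p | p.1 * p.2 = z}) hZ hY hZY
    (measurableSet_eq_fun (by fun_prop) (by fun_prop))).trans ?_
  refine (lintegral_congr fun ω => measure_mono_null (fun x hx => ?_)
    (hatoms (z / Z ω))).trans lintegral_zero
  have hmul : Z ω * x = z := hx
  exact eq_div_of_mul_eq (left_ne_zero_of_mul (hmul ▸ hz)) (by rw [mul_comm, hmul])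

lemma IsRicianFamily.map_prod_singleton [Fintype ι] [Nonempty ι] [IsFiniteMeasure μ]
    (hX : IsRicianFamily X K θ μ) {z : ℝ} (hz : z ≠ 0) :
    (μ.map fun ω => ∏ n, X n ω) {z} = 0 := by
  classical
  obtain ⟨i⟩ := ‹Nonempty ι›
  have hothers : AEMeasurable (∏ j ∈ Finset.univ.erase i, X j) μ :=
    Finset.aemeasurable_prod _ fun j _ => hX.aemeasurable j
  rw [Measure.map_apply_of_aemeasurable hX.aemeasurable_prod (measurableSet_singleton z)]
  refine Eq.trans ?_ (measure_mul_eq_zero_of_indepFun hothers (hX.aemeasurable i)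
    (hX.indep.indepFun_finsetProd_of_notMem₀ hX.aemeasurable (Finset.notMem_erase i Finset.univ))
    (hX.map_eq i ▸ ricianLaw_singleton (K i) (θ i)) hz)
  congr 1
  ext ω
  simp [Finset.prod_erase_mul _ _ (Finset.mem_univ i)]

end IsRicianFamily

/-! ### The distribution of a product of independent Rician powers -/

section ProductLaw

variable {M : ℕ} {Ω : Type*} [MeasurableSpace Ω] {μ : Measure Ω} {X : Fin (M + 1) → Ω → ℝ}
  {K θ ρ : Fin (M + 1) → ℝ} {γth γ : ℝ}

lemma contourIntegrand_zero_neg (K θ ρ : Fin (M + 1) → ℝ) (γth γ : ℝ) {s : ℂ} (hs : 0 < s.re) :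
    contourIntegrand K θ ρ γth (0 : Fin M → ℕ) γ (-s) =
      ((ρ (Fin.last M) * γth / γ : ℝ) : ℂ) ^ (-s) *
        ((∏ n, mellin (fun x => (ricianPDF (K n) (θ n) x : ℂ)) (1 + s)) / s) := by
  have hs_ne : s ≠ 0 := by
    rintro rfl
    simp at hs
  have hGamma := Complex.Gamma_ne_zero_of_re_pos hs
  simp only [contourIntegrand, lam_zero_fun, Nat.cast_zero, zero_add, add_zero, sub_neg_eq_add]
  rw [add_comm 1 s, Complex.Gamma_add_one s hs_ne]
  field_simp

lemma contourIntegrand_zero_neg_line (hX : IsRicianFamily X K θ μ) (ρ : Fin (M + 1) → ℝ)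
    (γth γ : ℝ) {σ : ℝ} (hσ : 0 < σ) (t : ℝ) :
    contourIntegrand K θ ρ γth (0 : Fin M → ℕ) γ ((-σ : ℝ) + (-t : ℝ) * Complex.I) =
      ((ρ (Fin.last M) * γth / γ : ℝ) : ℂ) ^ (-(σ + t * Complex.I)) *
        ((∫ y : ℝ, (y : ℂ) ^ (σ + t * Complex.I) ∂(μ.map fun ω => ∏ n, X n ω)) /
          (σ + t * Complex.I)) := by
  rw [hX.integral_cpow_map_prod, ← contourIntegrand_zero_neg K θ ρ γth γ (by simpa using hσ)]
  congr 1
  push_cast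
  ring

lemma verticalIntegrable_integral_cpow_map_prod (hX : IsRicianFamily X K θ μ) {σ : ℝ}
    (hσ : 0 < σ) :
    Complex.VerticalIntegrable
      (fun s => (∫ y : ℝ, (y : ℂ) ^ s ∂(μ.map fun ω => ∏ n, X n ω)) / s) σ := by
  have hint := (integrable_contourIntegrand (ρ := 1) (γth := 1) hX.nonneg hX.pos one_pos one_pos
    one_pos (0 : Fin M → ℕ) (neg_lt_zero.mpr hσ)).comp_neg
  refine hint.congr (ae_of_all _ fun t => ?_)
  exact (contourIntegrand_zero_neg_line hX 1 1 1 hσ t).trans (by simp)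

lemma verticalIntegral_contourIntegrand_zero (hX : IsRicianFamily X K θ μ)
    (ρ : Fin (M + 1) → ℝ) (γth γ : ℝ) {σ : ℝ} (hσ : 0 < σ) :
    verticalIntegral (contourIntegrand K θ ρ γth (0 : Fin M → ℕ) γ) (-σ) =
      mellinInv σ (fun s => (∫ y : ℝ, (y : ℂ) ^ s ∂(μ.map fun ω => ∏ n, X n ω)) / s)
        (ρ (Fin.last M) * γth / γ) := by
  rw [verticalIntegral, mellinInv, ← integral_neg_eq_self, Complex.real_smul]
  simp only [smul_eq_mul, contourIntegrand_zero_neg_line hX ρ γth γ hσ]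
  push_cast
  rfl

variable [IsProbabilityMeasure μ]

lemma measureReal_prod_lt_eq_contourOutage (hX : IsRicianFamily X K θ μ)
    (hρ : 0 < ρ (Fin.last M)) (hγth : 0 < γth) (hγ : 0 < γ) {κ : (Fin M → ℕ) → ℝ} (hκ : 0 < κ 0) :
    (μ.real {ω | ∏ n, X n ω < ρ (Fin.last M) * γth / γ} : ℂ) =
      contourOutage K θ ρ γth (fun _ => 1) κ γ := by
  have hz : 0 < ρ (Fin.last M) * γth / γ := by positivity
  have := Measure.isProbabilityMeasure_map (μ := μ) hX.aemeasurable_prod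
  have hcdf := measureReal_Iio_eq_one_sub_mellinInv hX.ae_map_prod_pos hκ
    (hX.integrable_rpow_map_prod hκ) (verticalIntegrable_integral_cpow_map_prod hX hκ) hz
    (hX.map_prod_singleton hz.ne')
  rw [← verticalIntegral_contourIntegrand_zero hX ρ γth γ hκ, map_measureReal_apply_of_aemeasurable
    hX.aemeasurable_prod measurableSet_Iio] at hcdf
  rw [contourOutage, box_one, Finset.sum_singleton]
  simpa [lam_zero_fun, Set.preimage] using hcdf

lemma isBigO_inv_log_pow_div (m : ℕ) :
    (fun γ : ℝ => γ⁻¹) =O[atTop] (fun γ : ℝ => Real.log γ ^ m / γ) := by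
  rcases Nat.eq_zero_or_pos m with rfl | hm
  · simpa using isBigO_refl (fun γ : ℝ => γ⁻¹) atTop
  · simpa using (isLittleO_log_pow_div hm).isBigO

lemma isLittleO_measureReal_prod_lt_sub_riceExpansion (hX : IsRicianFamily X K θ μ)
    (hρ : 0 < ρ (Fin.last M)) (hγth : 0 < γth) :
    (fun γ : ℝ => μ.real {ω | ∏ n, X n ω < ρ (Fin.last M) * γth / γ} -
      riceExpansion K θ ρ γth (fun _ => 1) γ) =o[atTop] (fun γ : ℝ => γ⁻¹) := by
  have hcontour := isLittleO_contourOutage_sub_riceExpansion hX.nonneg hX.pos hρ hγth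
    (L := fun _ => 1) (fun _ => le_rfl) (κ := fun _ => 1) (fun _ _ => one_pos)
  refine Complex.isLittleO_ofReal_left.mp (hcontour.congr' ?_ EventuallyEq.rfl)
  filter_upwards [eventually_gt_atTop 0] with γ hγ
  rw [← measureReal_prod_lt_eq_contourOutage hX hρ hγth hγ one_pos, Complex.ofReal_sub]

lemma isLittleO_measureReal_prod_lt_sub_riceLeading (hX : IsRicianFamily X K θ μ)
    (hρ : 0 < ρ (Fin.last M)) (hγth : 0 < γth) :
    (fun γ : ℝ => μ.real {ω | ∏ n, X n ω < ρ (Fin.last M) * γth / γ} -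
      riceLeading K θ ρ γth γ) =o[atTop] (fun γ : ℝ => Real.log γ ^ M / γ) := by
  simpa using ((isLittleO_measureReal_prod_lt_sub_riceExpansion hX hρ hγth).trans_isBigO
    (isBigO_inv_log_pow_div M)).add
    (isLittleO_riceExpansion_sub_riceLeading hX.nonneg hX.pos hρ hγth (L := fun _ => 1)
      fun _ => le_rfl)

lemma isBigO_riceLeading (K θ ρ : Fin (M + 1) → ℝ) (γth : ℝ) :
    riceLeading K θ ρ γth =O[atTop] (fun γ : ℝ => Real.log γ ^ M / γ) :=
  (isBigO_refl _ _).const_mul_left _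

lemma isBigO_measureReal_prod_lt (hX : IsRicianFamily X K θ μ) {c : ℝ} (hc : 0 < c) :
    (fun γ : ℝ => μ.real {ω | ∏ n, X n ω < c / γ}) =O[atTop]
      (fun γ : ℝ => Real.log γ ^ M / γ) := by
  simpa using (isLittleO_measureReal_prod_lt_sub_riceLeading hX (ρ := 1) one_pos hc).isBigO.add
    (isBigO_riceLeading K θ 1 c)

lemma isBigO_measureReal_finsetProd_lt {ι : Type*} {X : ι → Ω → ℝ} {K θ : ι → ℝ}
    (hX : IsRicianFamily X K θ μ) {s : Finset ι} (hs : s.card = M + 1) {c : ℝ} (hc : 0 < c) :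
    (fun γ : ℝ => μ.real {ω | ∏ n ∈ s, X n ω < c / γ}) =O[atTop]
      (fun γ : ℝ => Real.log γ ^ M / γ) := by
  have hinj : Function.Injective fun i => ((s.equivFinOfCardEq hs).symm i : ι) :=
    Subtype.val_injective.comp (Equiv.injective _)
  have hprod (ω : Ω) : ∏ i, X ((s.equivFinOfCardEq hs).symm i) ω = ∏ n ∈ s, X n ω :=
    (Equiv.prod_comp (s.equivFinOfCardEq hs).symm fun n : s => X n ω).trans
      (Finset.prod_coe_sort s fun n => X n ω)
  simpa only [hprod] using isBigO_measureReal_prod_lt (hX.precomp hinj) hc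

lemma isLittleO_measureReal_finsetProd_lt {ι : Type*} {X : ι → Ω → ℝ} {K θ : ι → ℝ}
    (hX : IsRicianFamily X K θ μ) {m : ℕ} {s : Finset ι} (hs : s.card ≤ m) {c : ℝ} (hc : 0 < c) :
    (fun γ : ℝ => μ.real {ω | ∏ n ∈ s, X n ω < c / γ}) =o[atTop]
      (fun γ : ℝ => Real.log γ ^ m / γ) := by
  rcases s.eq_empty_or_nonempty with rfl | hs_nonempty
  · refine (isLittleO_zero _ _).congr' ?_ EventuallyEq.rfl
    filter_upwards [eventually_gt_atTop 0, eventually_ge_atTop c] with γ hγ hγc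
    simp [((div_le_one hγ).mpr hγc).not_gt]
  · obtain ⟨k, hk⟩ := Nat.exists_eq_succ_of_ne_zero hs_nonempty.card_ne_zero
    exact (isBigO_measureReal_finsetProd_lt hX hk hc).trans_isLittleO
      (isLittleO_log_pow_div (by omega))

end ProductLaw

/-! ### The distribution function of a Rician power near zero -/

section RicianCDF

variable {K θ : ℝ}

lemma ricianPDF_le (hK : 0 ≤ K) (hθ : 0 < θ) {x : ℝ} (hx : 0 ≤ x) :
    ricianPDF K θ x ≤ (K + 1) / θ := by
  have hexp : HasSum (fun k : ℕ => Real.exp (-K) * ((K + 1) / θ) * (K ^ k / (k.factorial : ℝ)))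
      (Real.exp (-K) * ((K + 1) / θ) * Real.exp K) := by
    rw [Real.exp_eq_exp_ℝ]
    exact (NormedSpace.expSeries_div_hasSum_exp K).mul_left _
  have hpoisson (k : ℕ) : ((K + 1) / θ * x) ^ k / (k.factorial : ℝ) *
      Real.exp (-((K + 1) / θ * x)) ≤ 1 := by
    rw [Real.exp_neg, ← div_eq_mul_inv, div_le_one (Real.exp_pos _)]
    exact Real.pow_div_factorial_le_exp _ (by positivity) k
  calc ricianPDF K θ x ≤ Real.exp (-K) * ((K + 1) / θ) * Real.exp K := by
        refine hasSum_le (fun k => ?_) (hasSum_ricianPDF hK hθ hx) hexp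
        refine le_of_eq_of_le ?_ (mul_le_of_le_one_right (by positivity) (hpoisson k))
        ring
    _ = (K + 1) / θ := by
        rw [mul_right_comm, ← Real.exp_add, neg_add_cancel, Real.exp_zero, one_mul]

lemma ricianPDF_zero_pos (hK : 0 ≤ K) (hθ : 0 < θ) : 0 < ricianPDF K θ 0 := by
  have hbessel : besselI0 0 = 1 := by
    rw [besselI0, tsum_eq_single 0 fun k hk => by simp [hk]]
    simp
  simp only [ricianPDF, mul_zero, zero_div, Real.sqrt_zero, hbessel, le_refl, if_true]
  positivity

/-- The distribution function of the Rician power law. It is taken with a strict inequality, to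
match the outage event; the law has no atoms, so this makes no difference. -/
noncomputable def ricianCDF (K θ t : ℝ) : ℝ := (ricianLaw K θ).real (Set.Iio t)

lemma ricianCDF_nonneg (K θ t : ℝ) : 0 ≤ ricianCDF K θ t := measureReal_nonneg

lemma ricianCDF_zero (K θ : ℝ) : ricianCDF K θ 0 = 0 := by
  have hIic : ricianLaw K θ {x | ¬ 0 < x} = 0 := ae_iff.mp (ae_pos_ricianLaw K θ)
  have hIio : ricianLaw K θ (Set.Iio 0) = 0 :=
    measure_mono_null (fun _ hx => not_lt.mpr (le_of_lt hx)) hIic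
  rw [ricianCDF, measureReal_def, hIio, ENNReal.toReal_zero]

lemma ricianCDF_le_one (hK : 0 ≤ K) (hθ : 0 < θ) (t : ℝ) : ricianCDF K θ t ≤ 1 :=
  have := isProbabilityMeasure_ricianLaw hK hθ
  measureReal_le_one

lemma ricianCDF_mono (hK : 0 ≤ K) (hθ : 0 < θ) : Monotone (ricianCDF K θ) :=
  have := isProbabilityMeasure_ricianLaw hK hθ
  fun _ _ hst => measureReal_mono (Set.Iio_subset_Iio hst)

lemma ricianLaw_Ico (K θ x y : ℝ) :
    ricianLaw K θ (Set.Ico x y) = ∫⁻ t in Set.Ico x y, ENNReal.ofReal (ricianPDF K θ t) := by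
  rw [ricianLaw, withDensity_apply _ measurableSet_Ico]

lemma ricianCDF_sub (hK : 0 ≤ K) (hθ : 0 < θ) {x y : ℝ} (hxy : x ≤ y) :
    ricianCDF K θ y - ricianCDF K θ x = (ricianLaw K θ).real (Set.Ico x y) := by
  have := isProbabilityMeasure_ricianLaw hK hθ
  have hdisj : Disjoint (Set.Iio x) (Set.Ico x y) :=
    Set.disjoint_left.mpr fun _ hlt hmem => not_lt.mpr hmem.1 hlt
  rw [ricianCDF, ricianCDF, ← Set.Iio_union_Ico_eq_Iio hxy,
    measureReal_union hdisj measurableSet_Ico, add_sub_cancel_left]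

lemma ricianCDF_sub_le_of_ricianPDF_le (hK : 0 ≤ K) (hθ : 0 < θ) {x y B : ℝ} (hxy : x ≤ y)
    (hB : 0 ≤ B) (hle : ∀ t ∈ Set.Ico x y, ricianPDF K θ t ≤ B) :
    ricianCDF K θ y - ricianCDF K θ x ≤ B * (y - x) := by
  rw [ricianCDF_sub hK hθ hxy, measureReal_def]
  refine ENNReal.toReal_le_of_le_ofReal (mul_nonneg hB (sub_nonneg.mpr hxy)) ?_
  rw [ricianLaw_Ico, ENNReal.ofReal_mul hB, ← Real.volume_Ico, ← setLIntegral_const]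
  exact setLIntegral_mono measurable_const fun t ht => ENNReal.ofReal_le_ofReal (hle t ht)

lemma le_ricianCDF_sub_of_le_ricianPDF (hK : 0 ≤ K) (hθ : 0 < θ) {x y B : ℝ} (hxy : x ≤ y)
    (hle : ∀ t ∈ Set.Ico x y, B ≤ ricianPDF K θ t) :
    B * (y - x) ≤ ricianCDF K θ y - ricianCDF K θ x := by
  have := isProbabilityMeasure_ricianLaw hK hθ
  rw [ricianCDF_sub hK hθ hxy, measureReal_def]
  refine (ENNReal.ofReal_le_iff_le_toReal (measure_ne_top _ _)).mp ?_
  rw [ricianLaw_Ico, ENNReal.ofReal_mul' (sub_nonneg.mpr hxy), ← Real.volume_Ico,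
    ← setLIntegral_const]
  exact setLIntegral_mono (measurable_ricianPDF K θ).ennreal_ofReal
    fun t ht => ENNReal.ofReal_le_ofReal (hle t ht)

lemma ricianCDF_add_sub_le (hK : 0 ≤ K) (hθ : 0 < θ) {x y : ℝ} (hx : 0 ≤ x) (hy : 0 ≤ y) :
    ricianCDF K θ (x + y) - ricianCDF K θ x ≤ (K + 1) / θ * y := by
  simpa using ricianCDF_sub_le_of_ricianPDF_le hK hθ (le_add_of_nonneg_right hy) (by positivity)
    fun t ht => ricianPDF_le hK hθ (hx.trans ht.1)

lemma ricianCDF_le_mul (hK : 0 ≤ K) (hθ : 0 < θ) {y : ℝ} (hy : 0 ≤ y) :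
    ricianCDF K θ y ≤ (K + 1) / θ * y := by
  simpa [ricianCDF_zero] using ricianCDF_add_sub_le hK hθ le_rfl hy

lemma exists_abs_ricianCDF_sub_sub_le (hK : 0 ≤ K) (hθ : 0 < θ) {η : ℝ} (hη : 0 < η) :
    ∃ δ > 0, ∀ x y, 0 ≤ x → x ≤ y → y ≤ δ →
      |ricianCDF K θ y - ricianCDF K θ x - ricianPDF K θ 0 * (y - x)| ≤ η * (y - x) := by
  obtain ⟨δ, hδ, hclose⟩ := Metric.continuousWithinAt_iff.mp
    (continuousOn_ricianPDF K θ 0 Set.self_mem_Ici) η hη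
  refine ⟨δ, hδ, fun x y hx hxy hyδ => ?_⟩
  have hpdf : ∀ t ∈ Set.Ico x y, |ricianPDF K θ t - ricianPDF K θ 0| ≤ η := fun t ht => by
    have ht_nonneg : 0 ≤ t := hx.trans ht.1
    refine (hclose ht_nonneg ?_).le
    rw [Real.dist_eq, sub_zero, abs_of_nonneg ht_nonneg]
    exact ht.2.trans_le hyδ
  have hupper := ricianCDF_sub_le_of_ricianPDF_le hK hθ hxy
    (add_nonneg (ricianPDF_zero_pos hK hθ).le hη.le)
    fun t ht => sub_le_iff_le_add'.mp (abs_le.mp (hpdf t ht)).2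
  have hlower := le_ricianCDF_sub_of_le_ricianPDF hK hθ (B := ricianPDF K θ 0 - η) hxy
    fun t ht => by linarith [(abs_le.mp (hpdf t ht)).1]
  rw [abs_le]
  constructor <;> linarith

lemma exists_mul_le_ricianCDF (hK : 0 ≤ K) (hθ : 0 < θ) :
    ∃ δ > 0, ∀ y, 0 ≤ y → y ≤ δ → ricianPDF K θ 0 / 2 * y ≤ ricianCDF K θ y := by
  obtain ⟨δ, hδ, hlin⟩ :=
    exists_abs_ricianCDF_sub_sub_le hK hθ (half_pos (ricianPDF_zero_pos hK hθ))
  refine ⟨δ, hδ, fun y hy hyδ => ?_⟩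
  have hlower := (abs_le.mp (hlin 0 y le_rfl hy hyδ)).1
  rw [ricianCDF_zero] at hlower
  linarith

lemma exists_ricianCDF_add_sub_le (hK : 0 ≤ K) (hθ : 0 < θ) :
    ∃ C > 0, ∀ x y, 0 ≤ x → 0 ≤ y →
      ricianCDF K θ (x + y) - ricianCDF K θ x ≤ C * ricianCDF K θ y := by
  have hpdf := ricianPDF_zero_pos hK hθ
  obtain ⟨δ, hδ, hlower⟩ := exists_mul_le_ricianCDF hK hθ
  have hFδ : 0 < ricianCDF K θ δ := (mul_pos (half_pos hpdf) hδ).trans_le (hlower δ hδ.le le_rfl)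
  set C := max ((K + 1) / θ / (ricianPDF K θ 0 / 2)) (1 / ricianCDF K θ δ)
  have hC : 0 < C := lt_max_of_lt_right (by positivity)
  refine ⟨C, hC, fun x y hx hy => ?_⟩
  rcases le_total y δ with hyδ | hδy
  · calc ricianCDF K θ (x + y) - ricianCDF K θ x
        ≤ (K + 1) / θ * y := ricianCDF_add_sub_le hK hθ hx hy
      _ ≤ C * (ricianPDF K θ 0 / 2) * y :=
        mul_le_mul_of_nonneg_right ((div_le_iff₀ (by positivity)).mp (le_max_left _ _)) hy
      _ ≤ C * ricianCDF K θ y := by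
        rw [mul_assoc]
        exact mul_le_mul_of_nonneg_left (hlower y hy hyδ) hC.le
  · calc ricianCDF K θ (x + y) - ricianCDF K θ x
        ≤ 1 := (sub_le_self _ (ricianCDF_nonneg _ _ _)).trans (ricianCDF_le_one hK hθ _)
      _ ≤ C * ricianCDF K θ δ := (div_le_iff₀ hFδ).mp (le_max_right _ _)
      _ ≤ C * ricianCDF K θ y := mul_le_mul_of_nonneg_left (ricianCDF_mono hK hθ hδy) hC.le

lemma exists_abs_ricianCDF_add_sub_le (hK : 0 ≤ K) (hθ : 0 < θ) {η : ℝ} (hη : 0 < η) :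
    ∃ δ > 0, ∀ x y, 0 ≤ x → 0 ≤ y → x ≤ δ → y ≤ δ →
      |ricianCDF K θ (x + y) - ricianCDF K θ x - ricianCDF K θ y| ≤ η * ricianCDF K θ y := by
  have hpdf := ricianPDF_zero_pos hK hθ
  obtain ⟨δ₁, hδ₁, hlower⟩ := exists_mul_le_ricianCDF hK hθ
  obtain ⟨δ₂, hδ₂, hlin⟩ :=
    exists_abs_ricianCDF_sub_sub_le hK hθ (η := η * (ricianPDF K θ 0 / 2) / 2) (by positivity)
  refine ⟨min δ₁ (δ₂ / 2), by positivity, fun x y hx hy hxδ hyδ => ?_⟩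
  rw [le_min_iff] at hxδ hyδ
  have hincr := abs_le.mp (hlin x (x + y) hx (by linarith) (by linarith))
  have hzero := abs_le.mp (hlin 0 y le_rfl hy (by linarith))
  rw [ricianCDF_zero] at hzero
  calc |ricianCDF K θ (x + y) - ricianCDF K θ x - ricianCDF K θ y|
      ≤ η * (ricianPDF K θ 0 / 2 * y) := by
        rw [abs_le]
        constructor <;> linarith
    _ ≤ η * ricianCDF K θ y := mul_le_mul_of_nonneg_left (hlower y hy hyδ.1) hη.le

end RicianCDF

lemma add_sum_sub_le_of_add_sub_le {F : ℝ → ℝ} {C : ℝ}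
    (hF : ∀ x y, 0 ≤ x → 0 ≤ y → F (x + y) - F x ≤ C * F y) {ι : Type*} (s : Finset ι)
    {a : ι → ℝ} (ha : ∀ i, 0 ≤ a i) {x : ℝ} (hx : 0 ≤ x) :
    F (x + ∑ i ∈ s, a i) - F x ≤ C * ∑ i ∈ s, F (a i) := by
  classical
  induction s using Finset.induction_on with
  | empty => simp
  | insert i s hi ih =>
    have hstep := hF (x + ∑ j ∈ s, a j) (a i)
      (add_nonneg hx (Finset.sum_nonneg fun j _ => ha j)) (ha i)
    rw [Finset.sum_insert hi, Finset.sum_insert hi, add_comm (a i), ← add_assoc]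
    linarith

section NearAdditivity

variable {K θ : ℝ}

lemma abs_ricianCDF_add_sub_le_of_add_sub_le (hK : 0 ≤ K) (hθ : 0 < θ) {C : ℝ} (hC : 1 ≤ C)
    (hF : ∀ x y, 0 ≤ x → 0 ≤ y →
      ricianCDF K θ (x + y) - ricianCDF K θ x ≤ C * ricianCDF K θ y) {x y : ℝ} (hx : 0 ≤ x)
    (hy : 0 ≤ y) :
    |ricianCDF K θ (x + y) - ricianCDF K θ x - ricianCDF K θ y| ≤ C * ricianCDF K θ y := by
  have hmono : ricianCDF K θ x ≤ ricianCDF K θ (x + y) :=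
    ricianCDF_mono hK hθ (le_add_of_nonneg_right hy)
  have hCF := le_mul_of_one_le_left (ricianCDF_nonneg K θ y) hC
  have hFy := ricianCDF_nonneg K θ y
  rw [abs_le]
  constructor <;> linarith [hF x y hx hy]

lemma abs_ricianCDF_add_sub_le_one (hK : 0 ≤ K) (hθ : 0 < θ) (x : ℝ) {y : ℝ} (hy : 0 ≤ y) :
    |ricianCDF K θ (x + y) - ricianCDF K θ x - ricianCDF K θ y| ≤ 1 := by
  have hmono : ricianCDF K θ x ≤ ricianCDF K θ (x + y) :=
    ricianCDF_mono hK hθ (le_add_of_nonneg_right hy)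
  rw [abs_le]
  constructor <;> linarith [ricianCDF_nonneg K θ x, ricianCDF_nonneg K θ y,
    ricianCDF_le_one hK hθ (x + y), ricianCDF_le_one hK hθ y]

/-- Both `y * r / u` and `y` are small unless `u` is small or `y` is large. The two indicators pay
for the cruder bounds of these exceptional cases. -/
lemma exists_abs_ricianCDF_div_add_sub_le (hK : 0 ≤ K) (hθ : 0 < θ) {C : ℝ} (hC : 1 ≤ C)
    (hF : ∀ x y, 0 ≤ x → 0 ≤ y → ricianCDF K θ (x + y) - ricianCDF K θ x ≤ C * ricianCDF K θ y)
    {η r τ : ℝ} (hη : 0 < η) (hr : 0 < r) (hτ : 0 < τ) :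
    ∃ δ > 0, ∀ y u, 0 ≤ y → 0 < u →
      |ricianCDF K θ (y * r / u + y) - ricianCDF K θ (y * r / u) - ricianCDF K θ y| ≤
        η * ricianCDF K θ y + C * (ricianCDF K θ y * (Set.Iio τ).indicator 1 u) +
          (Set.Ioi δ).indicator 1 y := by
  obtain ⟨δ, hδ, hsmall⟩ := exists_abs_ricianCDF_add_sub_le hK hθ hη
  refine ⟨min δ (δ * τ / r), by positivity, fun y u hy hu => ?_⟩
  have hx : 0 ≤ y * r / u := by positivity
  have hFy := ricianCDF_nonneg K θ y
  have hηF := mul_nonneg hη.le hFy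
  have hCF := mul_nonneg (zero_le_one.trans hC) hFy
  simp only [Set.indicator, Set.mem_Iio, Set.mem_Ioi, Pi.one_apply, mul_ite, mul_one, mul_zero]
  by_cases hy_large : min δ (δ * τ / r) < y
  · rw [if_pos hy_large]
    split_ifs <;> linarith [abs_ricianCDF_add_sub_le_one hK hθ (y * r / u) hy]
  rw [if_neg hy_large]
  by_cases hu_small : u < τ
  · rw [if_pos hu_small]
    linarith [abs_ricianCDF_add_sub_le_of_add_sub_le hK hθ hC hF hx hy]
  · rw [if_neg hu_small, add_zero, add_zero]
    rw [not_lt, le_min_iff] at hy_large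
    refine hsmall _ _ hx hy ?_ hy_large.1
    calc y * r / u ≤ y * r / τ := by gcongr; exact not_lt.mp hu_small
      _ ≤ δ := (div_le_iff₀ hτ).mpr ((le_div_iff₀ hr).mp hy_large.2)

end NearAdditivity

/-! ### The noise terms and the outage event -/

section Noise

/-- The `n`-th summand of the end-to-end noise divided by the product of all channel powers but the
first: the factors of hops `n + 1, …, M` cancel, so those of hops `1, …, n` remain in the
denominator. -/
noncomputable def noiseTerm {M : ℕ} (ρ : Fin (M + 1) → ℝ) (n : Fin (M + 1)) (x : Fin (M + 1) → ℝ) :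
    ℝ :=
  ρ n / ∏ j ∈ Finset.Ioc 0 n, x j

variable {M : ℕ} {ρ x : Fin (M + 1) → ℝ}

@[fun_prop]
lemma measurable_noiseTerm (ρ : Fin (M + 1) → ℝ) (n : Fin (M + 1)) :
    Measurable (noiseTerm ρ n) := by
  unfold noiseTerm
  fun_prop

lemma dependsOn_noiseTerm (ρ : Fin (M + 1) → ℝ) (n : Fin (M + 1)) :
    DependsOn (noiseTerm ρ n) (Set.Ioc 0 n) := fun x y hxy => by
  rw [noiseTerm, noiseTerm, Finset.prod_congr rfl fun j hj => hxy j (Finset.mem_Ioc.mp hj)]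

lemma noiseTerm_pos (hρ : ∀ n, 0 < ρ n) (hx : ∀ n, 0 < x n) (n : Fin (M + 1)) :
    0 < noiseTerm ρ n x :=
  div_pos (hρ n) (Finset.prod_pos fun j _ => hx j)

lemma noiseTerm_last {m : ℕ} {ρ : Fin (m + 2) → ℝ} (hρ : ∀ n, 0 < ρ n) (x : Fin (m + 2) → ℝ) :
    noiseTerm ρ (Fin.last (m + 1)) x = noiseTerm ρ (Fin.last m).castSucc x *
      (ρ (Fin.last (m + 1)) / ρ (Fin.last m).castSucc) / x (Fin.last (m + 1)) := by
  have hIoc : Finset.Ioc 0 (Fin.last (m + 1)) =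
      insert (Fin.last (m + 1)) (Finset.Ioc 0 (Fin.last m).castSucc) := by
    ext j
    simp only [Finset.mem_insert, Finset.mem_Ioc, Fin.ext_iff, Fin.lt_def, Fin.le_def,
      Fin.val_last, Fin.val_castSucc, Fin.val_zero]
    omega
  have hρ_ne := (hρ (Fin.last m).castSucc).ne'
  have hnotMem : Fin.last (m + 1) ∉ Finset.Ioc 0 (Fin.last m).castSucc := by
    simp [Fin.le_def]
  rw [noiseTerm, noiseTerm, hIoc, Finset.prod_insert hnotMem]
  field_simp

lemma sum_mul_prod_Ioi_eq (ρ : Fin (M + 1) → ℝ) (hx : ∀ n, 0 < x n) :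
    ∑ n, ρ n * ∏ j ∈ Finset.Ioi n, x j = (∏ j ∈ Finset.Ioi 0, x j) * ∑ n, noiseTerm ρ n x := by
  rw [Finset.mul_sum]
  refine Finset.sum_congr rfl fun n _ => ?_
  have hdisj : Disjoint (Finset.Ioc 0 n) (Finset.Ioi n) :=
    Finset.disjoint_left.mpr fun j hj hj' =>
      (Finset.mem_Ioi.mp hj').not_ge (Finset.mem_Ioc.mp hj).2
  have hunion : Finset.Ioi 0 = Finset.Ioc 0 n ∪ Finset.Ioi n := by
    ext j
    simp only [Finset.mem_Ioi, Finset.mem_union, Finset.mem_Ioc, Fin.lt_def, Fin.le_def,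
      Fin.val_zero]
    omega
  have hne : ∏ j ∈ Finset.Ioc 0 n, x j ≠ 0 := (Finset.prod_pos fun j _ => hx j).ne'
  rw [noiseTerm, hunion, Finset.prod_union hdisj]
  field_simp

lemma snr_lt_iff (hρ : ∀ n, 0 < ρ n) (hx : ∀ n, 0 < x n) {γth γ : ℝ} (hγ : 0 < γ) :
    (∏ n, x n) / (∑ n, ρ n * ∏ j ∈ Finset.Ioi n, x j) * γ < γth ↔
      x 0 < γth / γ * ∑ n, noiseTerm ρ n x := by
  have hprod : 0 < ∏ j ∈ Finset.Ioi 0, x j := Finset.prod_pos fun j _ => hx j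
  have hsum : 0 < ∑ n, noiseTerm ρ n x :=
    Finset.sum_pos (fun n _ => noiseTerm_pos hρ hx n) Finset.univ_nonempty
  have hsplit : ∏ n, x n = (∏ j ∈ Finset.Ioi 0, x j) * x 0 := by
    rw [Finset.prod_Ioi_mul_eq_prod_Ici, ← bot_eq_zero, Finset.Ici_bot]
  rw [sum_mul_prod_Ioi_eq ρ hx, hsplit, mul_div_mul_left _ _ hprod.ne', div_mul_eq_mul_div,
    div_lt_iff₀ hsum, div_mul_eq_mul_div, lt_div_iff₀ hγ]

lemma lt_mul_noiseTerm_iff (ρ : Fin (M + 1) → ℝ) (hx : ∀ n, 0 < x n) (n : Fin (M + 1)) (ε : ℝ) :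
    x 0 < ε * noiseTerm ρ n x ↔ ∏ j ∈ Finset.Iic n, x j < ρ n * ε := by
  have hprod : 0 < ∏ j ∈ Finset.Ioc 0 n, x j := Finset.prod_pos fun j _ => hx j
  have hIic : ∏ j ∈ Finset.Iic n, x j = x 0 * ∏ j ∈ Finset.Ioc 0 n, x j := by
    rw [Finset.mul_prod_Ioc_eq_prod_Icc (Fin.zero_le n), ← bot_eq_zero, Finset.Icc_bot]
  rw [noiseTerm, ← mul_div_assoc, lt_div_iff₀ hprod, hIic, mul_comm ε]

lemma lt_mul_noiseTerm_iff_prod_Ioc (ρ : Fin (M + 1) → ℝ) (hx : ∀ n, 0 < x n) (n : Fin (M + 1))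
    (ε : ℝ) {δ : ℝ} (hδ : 0 < δ) :
    δ < ε * noiseTerm ρ n x ↔ ∏ j ∈ Finset.Ioc 0 n, x j < ρ n * ε / δ := by
  have hprod : 0 < ∏ j ∈ Finset.Ioc 0 n, x j := Finset.prod_pos fun j _ => hx j
  rw [noiseTerm, ← mul_div_assoc, lt_div_iff₀ hprod, lt_div_iff₀ hδ, mul_comm ε, mul_comm δ]

end Noise

/-! ### Splitting the outage probability -/

section Splitting

lemma indepFun_comp_of_dependsOn {ι Ω β : Type*} [Finite ι] [MeasurableSpace Ω]
    [MeasurableSpace β] {μ : Measure Ω} {X : ι → Ω → ℝ} (hindep : iIndepFun X μ)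
    (hX : ∀ n, AEMeasurable (X n) μ) {f : (ι → ℝ) → β} (hf : Measurable f) {s : Set ι}
    (hfs : DependsOn f s) {i : ι} (hi : i ∉ s) :
    IndepFun (fun ω => f fun n => X n ω) (X i) μ := by
  classical
  have := Fintype.ofFinite ι
  let extend (v : ↥(Finset.univ.erase i) → ℝ) (n : ι) : ℝ :=
    if hn : n ∈ Finset.univ.erase i then v ⟨n, hn⟩ else 0
  have hextend : Measurable extend := measurable_pi_lambda _ fun n => by
    by_cases hn : n ∈ Finset.univ.erase i
    · simpa only [extend, dif_pos hn] using measurable_pi_apply (⟨n, hn⟩ : ↥(Finset.univ.erase i))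
    · simpa only [extend, dif_neg hn] using measurable_const
  have hsplit := hindep.indepFun_finset₀ (Finset.univ.erase i) {i}
    (Finset.disjoint_singleton_right.mpr (Finset.notMem_erase i _)) hX
  have heq : (fun ω => f fun n => X n ω) =
      (f ∘ extend) ∘ fun ω (n : ↥(Finset.univ.erase i)) => X n ω := by
    funext ω
    refine hfs fun n hn => ?_
    have hne : n ≠ i := fun h => hi (h ▸ hn)
    simp [extend, hne]
  rw [heq]
  exact hsplit.comp (hf.comp hextend) (measurable_pi_apply ⟨i, Finset.mem_singleton_self i⟩)

lemma abs_integral_sub_sub_le {Ω : Type*} [MeasurableSpace Ω] {μ : Measure Ω} {f g h b : Ω → ℝ}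
    (hf : Integrable f μ) (hg : Integrable g μ) (hh : Integrable h μ) (hb : Integrable b μ)
    (hle : ∀ᵐ ω ∂μ, |f ω - g ω - h ω| ≤ b ω) :
    |∫ ω, f ω ∂μ - ∫ ω, g ω ∂μ - ∫ ω, h ω ∂μ| ≤ ∫ ω, b ω ∂μ := by
  have hfg : Integrable (fun ω => f ω - g ω) μ := hf.sub hg
  rw [← integral_sub hf hg, ← integral_sub hfg hh]
  exact abs_integral_le_integral_abs.trans (integral_mono_ae (hfg.sub hh).abs hb hle)

lemma integrable_ricianCDF_comp {Ω : Type*} [MeasurableSpace Ω] {μ : Measure Ω} [IsFiniteMeasure μ]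
    {K θ : ℝ} (hK : 0 ≤ K) (hθ : 0 < θ) {f : Ω → ℝ} (hf : AEMeasurable f μ) :
    Integrable (fun ω => ricianCDF K θ (f ω)) μ :=
  Integrable.of_bound ((ricianCDF_mono hK hθ).measurable.comp_aemeasurable hf).aestronglyMeasurable
    1 (ae_of_all _ fun ω => by
      rw [Real.norm_of_nonneg (ricianCDF_nonneg _ _ _)]
      exact ricianCDF_le_one hK hθ _)

lemma integrable_mul_indicator_comp {Ω : Type*} [MeasurableSpace Ω] {μ : Measure Ω} {f g : Ω → ℝ}
    (hf : Integrable f μ) (hg : AEMeasurable g μ) {s : Set ℝ} (hs : MeasurableSet s) :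
    Integrable (fun ω => f ω * s.indicator 1 (g ω)) μ :=
  hf.mul_bdd (c := 1) ((measurable_one.indicator hs).comp_aemeasurable hg).aestronglyMeasurable
    (ae_of_all _ fun ω => norm_indicator_le_norm_self (1 : ℝ → ℝ) (g ω) |>.trans (by simp))

section Family

variable {M : ℕ} {Ω : Type*} [MeasurableSpace Ω] {μ : Measure Ω} {X : Fin (M + 1) → Ω → ℝ}
  {K θ ρ : Fin (M + 1) → ℝ}

lemma IsRicianFamily.aemeasurable_noiseTerm (hX : IsRicianFamily X K θ μ) (ρ : Fin (M + 1) → ℝ)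
    (n : Fin (M + 1)) : AEMeasurable (fun ω => noiseTerm ρ n fun j => X j ω) μ :=
  (measurable_noiseTerm ρ n).comp_aemeasurable (aemeasurable_pi_lambda _ hX.aemeasurable)

lemma integral_comp_mul_indicator_lt (hX : IsRicianFamily X K θ μ) {f : (Fin (M + 1) → ℝ) → ℝ}
    (hf : Measurable f) {s : Set (Fin (M + 1))} (hfs : DependsOn f s) {i : Fin (M + 1)}
    (hi : i ∉ s) (τ : ℝ) :
    ∫ ω, f (fun n => X n ω) * (Set.Iio τ).indicator 1 (X i ω) ∂μ =
      (∫ ω, f (fun n => X n ω) ∂μ) * ricianCDF (K i) (θ i) τ := by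
  have hind : Measurable ((Set.Iio τ).indicator (1 : ℝ → ℝ)) :=
    measurable_one.indicator measurableSet_Iio
  have hcdf : ∫ ω, (Set.Iio τ).indicator 1 (X i ω) ∂μ = ricianCDF (K i) (θ i) τ := by
    rw [← integral_map (hX.aemeasurable i) hind.aestronglyMeasurable, hX.map_eq i,
      integral_indicator_one measurableSet_Iio, ricianCDF]
  rw [← hcdf]
  exact ((indepFun_comp_of_dependsOn hX.indep hX.aemeasurable hf hfs hi).comp measurable_id
    hind).integral_fun_mul_eq_mul_integral
    (hf.comp_aemeasurable (aemeasurable_pi_lambda _ hX.aemeasurable)).aestronglyMeasurable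
    (hind.comp_aemeasurable (hX.aemeasurable i)).aestronglyMeasurable

lemma integral_ricianCDF_noiseTerm_mul_indicator (hX : IsRicianFamily X K θ μ)
    (ρ : Fin (M + 1) → ℝ) {n i : Fin (M + 1)} (hi : i ∉ Set.Ioc 0 n) (ε τ : ℝ) :
    ∫ ω, ricianCDF (K 0) (θ 0) (ε * noiseTerm ρ n fun j => X j ω) *
        (Set.Iio τ).indicator 1 (X i ω) ∂μ =
      (∫ ω, ricianCDF (K 0) (θ 0) (ε * noiseTerm ρ n fun j => X j ω) ∂μ) *
        ricianCDF (K i) (θ i) τ :=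
  integral_comp_mul_indicator_lt hX
    (f := fun x => ricianCDF (K 0) (θ 0) (ε * noiseTerm ρ n x))
    ((ricianCDF_mono (hX.nonneg 0) (hX.pos 0)).measurable.comp (by fun_prop))
    (fun x y hxy => congrArg (fun t => ricianCDF (K 0) (θ 0) (ε * t))
      (dependsOn_noiseTerm ρ n hxy)) hi τ

lemma integral_indicator_lt_noiseTerm (hX : IsRicianFamily X K θ μ) (ρ : Fin (M + 1) → ℝ)
    (n : Fin (M + 1)) (ε : ℝ) {δ : ℝ} (hδ : 0 < δ) :
    ∫ ω, (Set.Ioi δ).indicator (1 : ℝ → ℝ) (ε * noiseTerm ρ n fun j => X j ω) ∂μ =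
      μ.real {ω | ∏ j ∈ Finset.Ioc 0 n, X j ω < ρ n * ε / δ} := by
  have hmeas := (hX.aemeasurable_noiseTerm ρ n).const_mul ε
  rw [← integral_map hmeas (measurable_one.indicator measurableSet_Ioi).aestronglyMeasurable,
    integral_indicator_one measurableSet_Ioi,
    map_measureReal_apply_of_aemeasurable hmeas measurableSet_Ioi]
  refine measureReal_congr ?_
  filter_upwards [hX.ae_pos] with ω hω
  exact propext (lt_mul_noiseTerm_iff_prod_Ioc ρ hω n ε hδ)

variable [IsProbabilityMeasure μ]

lemma measureReal_lt_comp (hX : IsRicianFamily X K θ μ) {f : (Fin (M + 1) → ℝ) → ℝ}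
    (hf : Measurable f) {s : Set (Fin (M + 1))} (hfs : DependsOn f s) {i : Fin (M + 1)}
    (hi : i ∉ s) :
    μ.real {ω | X i ω < f fun n => X n ω} = ∫ ω, ricianCDF (K i) (θ i) (f fun n => X n ω) ∂μ := by
  rw [measureReal_lt_of_indepFun (Z := fun ω => f fun n => X n ω) (hX.aemeasurable i)
    (hf.comp_aemeasurable (aemeasurable_pi_lambda _ hX.aemeasurable))
    (indepFun_comp_of_dependsOn hX.indep hX.aemeasurable hf hfs hi), hX.map_eq i]
  rfl

lemma integral_ricianCDF_noiseTerm (hX : IsRicianFamily X K θ μ) (ρ : Fin (M + 1) → ℝ)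
    (n : Fin (M + 1)) (ε : ℝ) :
    ∫ ω, ricianCDF (K 0) (θ 0) (ε * noiseTerm ρ n fun j => X j ω) ∂μ =
      μ.real {ω | ∏ j ∈ Finset.Iic n, X j ω < ρ n * ε} := by
  rw [← measureReal_lt_comp hX (f := fun x => ε * noiseTerm ρ n x) (by fun_prop)
    (fun x y hxy => congrArg (ε * ·) (dependsOn_noiseTerm ρ n hxy)) Set.left_notMem_Ioc]
  refine measureReal_congr ?_
  filter_upwards [hX.ae_pos] with ω hω
  exact propext (lt_mul_noiseTerm_iff ρ hω n ε)

lemma measureReal_snr_lt (hX : IsRicianFamily X K θ μ) (hρ : ∀ n, 0 < ρ n) {γth γ : ℝ}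
    (hγ : 0 < γ) :
    μ.real {ω | (∏ n, X n ω) / (∑ n, ρ n * ∏ j ∈ Finset.Ioi n, X j ω) * γ < γth} =
      ∫ ω, ricianCDF (K 0) (θ 0) (γth / γ * ∑ n, noiseTerm ρ n fun j => X j ω) ∂μ := by
  rw [← measureReal_lt_comp hX (f := fun x => γth / γ * ∑ n, noiseTerm ρ n x) (s := Set.Ioi 0)
    (by fun_prop) (fun x y hxy => congrArg (γth / γ * ·) (Finset.sum_congr rfl fun n _ =>
      dependsOn_noiseTerm ρ n fun j hj => hxy j hj.1)) Set.self_notMem_Ioi]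
  refine measureReal_congr ?_
  filter_upwards [hX.ae_pos] with ω hω
  exact propext (snr_lt_iff hρ hω hγ)

end Family

variable {m : ℕ} {Ω : Type*} [MeasurableSpace Ω] {μ : Measure Ω} [IsProbabilityMeasure μ]
  {X : Fin (m + 2) → Ω → ℝ} {ρ K θ : Fin (m + 2) → ℝ}

lemma exists_abs_ricianCDF_sum_noiseTerm_sub_le {K₀ θ₀ : ℝ} (hK : 0 ≤ K₀) (hθ : 0 < θ₀)
    (hρ : ∀ n, 0 < ρ n) :
    ∃ C > 0, ∀ η > 0, ∀ τ > 0, ∃ δ > 0, ∀ ε > 0, ∀ x : Fin (m + 2) → ℝ, (∀ n, 0 < x n) →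
      |ricianCDF K₀ θ₀ (ε * ∑ n, noiseTerm ρ n x) -
          ricianCDF K₀ θ₀ (ε * noiseTerm ρ (Fin.last (m + 1)) x) -
          ricianCDF K₀ θ₀ (ε * noiseTerm ρ (Fin.last m).castSucc x)| ≤
        C * ∑ i : Fin m, ricianCDF K₀ θ₀ (ε * noiseTerm ρ i.castSucc.castSucc x) +
          (η * ricianCDF K₀ θ₀ (ε * noiseTerm ρ (Fin.last m).castSucc x) +
            C * (ricianCDF K₀ θ₀ (ε * noiseTerm ρ (Fin.last m).castSucc x) *
              (Set.Iio τ).indicator 1 (x (Fin.last (m + 1)))) +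
            (Set.Ioi δ).indicator 1 (ε * noiseTerm ρ (Fin.last m).castSucc x)) := by
  obtain ⟨C₀, -, hF₀⟩ := exists_ricianCDF_add_sub_le hK hθ
  set F := ricianCDF K₀ θ₀
  have hF (x y : ℝ) (hx : 0 ≤ x) (hy : 0 ≤ y) : F (x + y) - F x ≤ max C₀ 1 * F y :=
    (hF₀ x y hx hy).trans
      (mul_le_mul_of_nonneg_right (le_max_left _ _) (ricianCDF_nonneg _ _ _))
  refine ⟨max C₀ 1, by positivity, fun η hη τ hτ => ?_⟩
  obtain ⟨δ, hδ, hpair⟩ := exists_abs_ricianCDF_div_add_sub_le hK hθ (le_max_right C₀ 1) hF hη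
    (div_pos (hρ (Fin.last (m + 1))) (hρ (Fin.last m).castSucc)) hτ
  refine ⟨δ, hδ, fun ε hε x hx => ?_⟩
  have hpos (n : Fin (m + 2)) : 0 ≤ ε * noiseTerm ρ n x :=
    (mul_pos hε (noiseTerm_pos hρ hx n)).le
  have hlast := hpair (ε * noiseTerm ρ (Fin.last m).castSucc x) (x (Fin.last (m + 1)))
    (hpos _) (hx _)
  rw [mul_assoc ε, mul_div_assoc ε, ← noiseTerm_last hρ x] at hlast
  set a := fun n => ε * noiseTerm ρ n x
  have hsum : ε * ∑ n, noiseTerm ρ n x =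
      a (Fin.last (m + 1)) + a (Fin.last m).castSucc + ∑ i : Fin m, a i.castSucc.castSucc := by
    rw [Finset.mul_sum, Fin.sum_univ_castSucc, Fin.sum_univ_castSucc]
    ring
  have hpair_nonneg := add_nonneg (hpos (Fin.last (m + 1))) (hpos (Fin.last m).castSucc)
  have hothers := add_sum_sub_le_of_add_sub_le hF (a := fun i : Fin m => a i.castSucc.castSucc)
    Finset.univ (fun i => hpos _) hpair_nonneg
  have hmono : F (a (Fin.last (m + 1)) + a (Fin.last m).castSucc) ≤ F (ε * ∑ n, noiseTerm ρ n x) :=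
    ricianCDF_mono hK hθ
      (hsum ▸ le_add_of_nonneg_right (Finset.sum_nonneg fun i _ => hpos _))
  rw [← hsum] at hothers
  rw [abs_le] at hlast ⊢
  constructor <;> linarith

lemma exists_pos_mul_ricianCDF_le {K₀ θ₀ : ℝ} (hK : 0 ≤ K₀) (hθ : 0 < θ₀) {C η : ℝ} (hC : 0 < C)
    (hη : 0 < η) : ∃ τ > 0, C * ricianCDF K₀ θ₀ τ ≤ η := by
  refine ⟨η / C / ((K₀ + 1) / θ₀), by positivity, ?_⟩
  calc C * ricianCDF K₀ θ₀ (η / C / ((K₀ + 1) / θ₀))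
      ≤ C * ((K₀ + 1) / θ₀ * (η / C / ((K₀ + 1) / θ₀))) :=
        mul_le_mul_of_nonneg_left (ricianCDF_le_mul hK hθ (by positivity)) hC.le
    _ = η := by field_simp

lemma exists_abs_measureReal_snr_lt_sub_le (hX : IsRicianFamily X K θ μ) (hρ : ∀ n, 0 < ρ n)
    {γth : ℝ} (hγth : 0 < γth) :
    ∃ C, ∀ η > 0, ∃ δ > 0, ∀ γ > 0,
      |μ.real {ω | (∏ n, X n ω) / (∑ n, ρ n * ∏ j ∈ Finset.Ioi n, X j ω) * γ < γth} -
          μ.real {ω | ∏ j ∈ Finset.Iic (Fin.last (m + 1)), X j ω <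
            ρ (Fin.last (m + 1)) * (γth / γ)} -
          μ.real {ω | ∏ j ∈ Finset.Iic (Fin.last m).castSucc, X j ω <
            ρ (Fin.last m).castSucc * (γth / γ)}| ≤
        C * ∑ i : Fin m, μ.real {ω | ∏ j ∈ Finset.Iic i.castSucc.castSucc, X j ω <
            ρ i.castSucc.castSucc * (γth / γ)} +
          η * μ.real {ω | ∏ j ∈ Finset.Iic (Fin.last m).castSucc, X j ω <
            ρ (Fin.last m).castSucc * (γth / γ)} +
          μ.real {ω | ∏ j ∈ Finset.Ioc 0 (Fin.last m).castSucc, X j ω <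
            ρ (Fin.last m).castSucc * (γth / γ) / δ} := by
  obtain ⟨C, hC, hbound⟩ :=
    exists_abs_ricianCDF_sum_noiseTerm_sub_le (hX.nonneg 0) (hX.pos 0) hρ
  refine ⟨C, fun η hη => ?_⟩
  obtain ⟨τ, hτ, hFτ⟩ := exists_pos_mul_ricianCDF_le (hX.nonneg (Fin.last (m + 1)))
    (hX.pos (Fin.last (m + 1))) hC (half_pos hη)
  obtain ⟨δ, hδ, hbound⟩ := hbound (η / 2) (half_pos hη) τ hτ
  refine ⟨δ, hδ, fun γ hγ => ?_⟩
  rw [measureReal_snr_lt hX hρ hγ, ← integral_indicator_lt_noiseTerm hX ρ _ _ hδ]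
  simp only [← integral_ricianCDF_noiseTerm hX]
  set G := fun n ω => ricianCDF (K 0) (θ 0) (γth / γ * noiseTerm ρ n fun j => X j ω)
  have hG (n : Fin (m + 2)) : Integrable (G n) μ :=
    integrable_ricianCDF_comp (hX.nonneg 0) (hX.pos 0) ((hX.aemeasurable_noiseTerm ρ n).const_mul _)
  have hG_small := integrable_mul_indicator_comp (hG (Fin.last m).castSucc)
    (hX.aemeasurable (Fin.last (m + 1))) (measurableSet_Iio (a := τ))
  have hlarge := integrable_mul_indicator_comp (integrable_const (1 : ℝ))
    ((hX.aemeasurable_noiseTerm ρ (Fin.last m).castSucc).const_mul (γth / γ))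
    (measurableSet_Ioi (a := δ))
  simp only [one_mul] at hlarge
  have hsum := (integrable_finsetSum Finset.univ fun (i : Fin m) _ =>
    hG i.castSucc.castSucc).const_mul C
  have hsmall := ((hG (Fin.last m).castSucc).const_mul (η / 2)).add (hG_small.const_mul C)
  refine (abs_integral_sub_sub_le (integrable_ricianCDF_comp (hX.nonneg 0) (hX.pos 0) ?_)
    (hG _) (hG _) (hsum.add (hsmall.add hlarge))
    (hX.ae_pos.mono fun ω hω => hbound (γth / γ) (by positivity) _ hω)).trans ?_
  · exact (Finset.aemeasurable_fun_sum _ fun n _ => hX.aemeasurable_noiseTerm ρ n).const_mul _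
  have hfactor := integral_ricianCDF_noiseTerm_mul_indicator hX ρ (n := (Fin.last m).castSucc)
    (i := Fin.last (m + 1)) (by simp [Fin.le_def]) (γth / γ) τ
  rw [integral_add' hsum (hsmall.add hlarge), integral_add' hsmall hlarge,
    integral_add' ((hG _).const_mul _) (hG_small.const_mul C), integral_const_mul,
    integral_const_mul, integral_const_mul, integral_finsetSum _ fun _ _ => hG _, hfactor]
  have hG_nonneg : 0 ≤ ∫ ω, G (Fin.last m).castSucc ω ∂μ :=
    integral_nonneg fun ω => ricianCDF_nonneg _ _ _
  nlinarith [mul_le_mul_of_nonneg_left hFτ hG_nonneg]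

end Splitting

/-! ### Asymptotics of the outage probability -/

lemma isLittleO_of_forall_abs_le_mul_add {α : Type*} {l : Filter α} {f g b : α → ℝ} (hb : b =O[l] g)
    (h : ∀ η > 0, ∃ r : α → ℝ, r =o[l] g ∧ ∀ᶠ x in l, |f x| ≤ η * b x + r x) : f =o[l] g := by
  obtain ⟨B, hB, hb⟩ := hb.exists_pos
  refine isLittleO_iff.mpr fun c hc => ?_
  obtain ⟨r, hr, hle⟩ := h (c / 2 / B) (by positivity)
  filter_upwards [hle, hb.bound, hr.def (half_pos hc)] with x hle hbx hrx
  calc ‖f x‖ ≤ c / 2 / B * b x + r x := hle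
    _ ≤ c / 2 / B * (B * ‖g x‖) + c / 2 * ‖g x‖ := by
        gcongr
        exacts [(Real.le_norm_self _).trans hbx, (Real.le_norm_self _).trans hrx]
    _ = c * ‖g x‖ := by
        field_simp
        ring

section OutageAsymptotics

variable {m : ℕ} {Ω : Type*} [MeasurableSpace Ω] {μ : Measure Ω} [IsProbabilityMeasure μ]
  {X : Fin (m + 2) → Ω → ℝ} {K θ ρ : Fin (m + 2) → ℝ} {γth : ℝ}

lemma isLittleO_measureReal_snr_lt_sub (hX : IsRicianFamily X K θ μ) (hρ : ∀ n, 0 < ρ n)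
    (hγth : 0 < γth) :
    (fun γ : ℝ =>
      μ.real {ω | (∏ n, X n ω) / (∑ n, ρ n * ∏ j ∈ Finset.Ioi n, X j ω) * γ < γth} -
        μ.real {ω | ∏ n, X n ω < ρ (Fin.last (m + 1)) * γth / γ} -
        μ.real {ω | ∏ n : Fin (m + 1), X n.castSucc ω < ρ (Fin.last m).castSucc * γth / γ})
      =o[atTop] (fun γ : ℝ => Real.log γ ^ m / γ) := by
  obtain ⟨C, hbound⟩ := exists_abs_measureReal_snr_lt_sub_le hX hρ hγth
  simp only [← mul_div_assoc] at hbound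
  have hIic (ω : Ω) : ∏ j ∈ Finset.Iic (Fin.last m).castSucc, X j ω =
      ∏ n : Fin (m + 1), X n.castSucc ω := by
    rw [Fin.prod_Iic_castSucc, ← Fin.top_eq_last, Finset.Iic_top]
  have hIic_last (ω : Ω) : ∏ j ∈ Finset.Iic (Fin.last (m + 1)), X j ω = ∏ n, X n ω := by
    rw [← Fin.top_eq_last, Finset.Iic_top]
  simp only [hIic, hIic_last] at hbound
  have hothers : (fun γ : ℝ => ∑ i : Fin m, μ.real {ω | ∏ j ∈ Finset.Iic i.castSucc.castSucc,
      X j ω < ρ i.castSucc.castSucc * γth / γ}) =o[atTop] (fun γ : ℝ => Real.log γ ^ m / γ) :=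
    IsLittleO.fun_sum fun i _ => isLittleO_measureReal_finsetProd_lt hX
      (by simp [Fin.card_Iic]) (mul_pos (hρ _) hγth)
  have hlarge (δ : ℝ) (hδ : 0 < δ) : (fun γ : ℝ => μ.real {ω | ∏ j ∈ Finset.Ioc 0
      (Fin.last m).castSucc, X j ω < ρ (Fin.last m).castSucc * γth / δ / γ})
      =o[atTop] (fun γ : ℝ => Real.log γ ^ m / γ) :=
    isLittleO_measureReal_finsetProd_lt hX (by simp [Fin.card_Ioc])
      (div_pos (mul_pos (hρ _) hγth) hδ)
  refine isLittleO_of_forall_abs_le_mul_add (isBigO_measureReal_prod_lt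
    (hX.precomp (Fin.castSucc_injective _)) (mul_pos (hρ (Fin.last m).castSucc) hγth))
    fun η hη => ?_
  obtain ⟨δ, hδ, hle⟩ := hbound η hη
  refine ⟨_, (hothers.const_mul_left C).add (hlarge δ hδ), ?_⟩
  filter_upwards [eventually_gt_atTop 0] with γ hγ
  refine (hle γ hγ).trans_eq ?_
  rw [div_right_comm]
  ring

lemma isLittleO_measureReal_snr_lt_sub_riceLeading (hX : IsRicianFamily X K θ μ)
    (hρ : ∀ n, 0 < ρ n) (hγth : 0 < γth) :
    (fun γ : ℝ =>
      μ.real {ω | (∏ n, X n ω) / (∑ n, ρ n * ∏ j ∈ Finset.Ioi n, X j ω) * γ < γth} -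
        riceLeading K θ ρ γth γ) =o[atTop] (fun γ : ℝ => Real.log γ ^ (m + 1) / γ) := by
  have hsplit := (isLittleO_measureReal_snr_lt_sub hX hρ hγth).trans
    (isLittleO_log_pow_div (Nat.lt_succ_self m))
  have hlast := isLittleO_measureReal_prod_lt_sub_riceLeading hX (hρ _) hγth
  have hsecond := (isBigO_measureReal_prod_lt (hX.precomp (Fin.castSucc_injective _))
    (mul_pos (hρ (Fin.last m).castSucc) hγth)).trans_isLittleO
    (isLittleO_log_pow_div (Nat.lt_succ_self m))
  refine ((hsplit.add hlast).add hsecond).congr_left fun γ => ?_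
  ring

lemma isLittleO_measureReal_snr_lt_sub_riceExpansion (hX : IsRicianFamily X K θ μ)
    (hρ : ∀ n, 0 < ρ n) (hγth : 0 < γth) {L : Fin (m + 1) → ℕ} (hL : ∀ k, 2 ≤ L k) :
    (fun γ : ℝ =>
      μ.real {ω | (∏ n, X n ω) / (∑ n, ρ n * ∏ j ∈ Finset.Ioi n, X j ω) * γ < γth} -
        riceExpansion K θ ρ γth L γ) =o[atTop] (fun γ : ℝ => Real.log γ ^ m / γ) := by
  have hsplit := isLittleO_measureReal_snr_lt_sub hX hρ hγth
  have hlast := (isLittleO_measureReal_prod_lt_sub_riceExpansion hX (hρ _) hγth).trans_isBigO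
    (isBigO_inv_log_pow_div m)
  have hsecond := isLittleO_measureReal_prod_lt_sub_riceLeading
    (hX.precomp (Fin.castSucc_injective _)) (ρ := fun n => ρ n.castSucc) (hρ _) hγth
  have hexpansion := isLittleO_riceExpansion_sub_riceExpansion_one hX.nonneg hX.pos (hρ _) hγth hL
  refine (((hsplit.add hlast).add hsecond).sub hexpansion).congr_left fun γ => ?_
  ring

end OutageAsymptotics

section Leading

variable {M : ℕ} {K θ ρ : Fin (M + 1) → ℝ} {γth : ℝ}

lemma isBigO_log_pow_div_riceLeading (hK : ∀ n, 0 ≤ K n) (hθ : ∀ n, 0 < θ n)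
    (hρ : 0 < ρ (Fin.last M)) (hγth : 0 < γth) :
    (fun γ : ℝ => Real.log γ ^ M / γ) =O[atTop] riceLeading K θ ρ γth := by
  have hprod : 0 < ∏ n, (K n + 1) / (θ n * Real.exp (K n)) :=
    Finset.prod_pos fun n _ => div_pos (by linarith [hK n]) (mul_pos (hθ n) (Real.exp_pos _))
  exact (isBigO_refl _ _).const_mul_right
    (mul_pos (div_pos (mul_pos hρ hγth) (by positivity)) hprod).ne'

lemma isEquivalent_riceExpansion_riceLeading (hK : ∀ n, 0 ≤ K n) (hθ : ∀ n, 0 < θ n)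
    (hρ : 0 < ρ (Fin.last M)) (hγth : 0 < γth) {L : Fin M → ℕ} (hL : ∀ k, 1 ≤ L k) :
    IsEquivalent atTop (riceExpansion K θ ρ γth L) (riceLeading K θ ρ γth) :=
  (isLittleO_riceExpansion_sub_riceLeading hK hθ hρ hγth hL).trans_isBigO
    (isBigO_log_pow_div_riceLeading hK hθ hρ hγth)

lemma isEquivalent_ofReal {α : Type*} {l : Filter α} {f g : α → ℝ} (h : IsEquivalent l f g) :
    IsEquivalent l (fun x => (f x : ℂ)) fun x => (g x : ℂ) :=
  (Complex.isLittleO_ofReal_left.mpr (Complex.isLittleO_ofReal_right.mpr h.isLittleO)).congr_left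
    fun x => Complex.ofReal_sub (f x) (g x)

lemma isEquivalent_contourOutage_riceExpansion (hK : ∀ n, 0 ≤ K n) (hθ : ∀ n, 0 < θ n)
    (hρ : 0 < ρ (Fin.last M)) (hγth : 0 < γth) {L : Fin M → ℕ} (hL : ∀ k, 1 ≤ L k)
    {κ : (Fin M → ℕ) → ℝ} (hκ : ∀ ℓ ∈ box L, 0 < κ ℓ) :
    IsEquivalent atTop (contourOutage K θ ρ γth L κ)
      (fun γ => (riceExpansion K θ ρ γth L γ : ℂ)) := by
  have hlog := (isBigO_log_pow_div_riceLeading hK hθ hρ hγth).trans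
    (isEquivalent_riceExpansion_riceLeading hK hθ hρ hγth hL).isBigO_symm
  exact ((isLittleO_contourOutage_sub_riceExpansion hK hθ hρ hγth hL hκ).trans_isBigO
    (isBigO_inv_log_pow_div M)).trans_isBigO (Complex.isBigO_ofReal_right.mpr hlog)

end Leading

end MultihopRelay

/-- High-SNR expansion of the outage probability of a fixed-gain amplify-and-forward link with
`N = M + 1 ≥ 2` independent Rician hops. -/
theorem mainTheorem5 {M : ℕ} (hM : 1 ≤ M)
    {Ω : Type*} [MeasurableSpace Ω] (μ : Measure Ω) [IsProbabilityMeasure μ]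
    (A : Fin (M + 1) → ℝ) (h : Fin (M + 1) → Ω → ℂ)
    (K θ ρ : Fin (M + 1) → ℝ) (γth : ℝ)
    (hK : ∀ n, 0 ≤ K n) (hθ : ∀ n, 0 < θ n) (hρ : ∀ n, 0 < ρ n) (hγth : 0 < γth)
    (hlaw : ∀ n, μ.map (MultihopRelay.channelPower A h n) = MultihopRelay.ricianLaw (K n) (θ n))
    (hindep : iIndepFun (MultihopRelay.channelPower A h) μ)
    (L : Fin M → ℕ) (hL : ∀ k, 1 ≤ L k)
    (κ : (Fin M → ℕ) → ℝ) (hκ : ∀ ℓ ∈ MultihopRelay.box L, (MultihopRelay.lam ℓ M : ℝ) < κ ℓ) :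
    -- the contour integrals converge absolutely
    (∀ ℓ ∈ MultihopRelay.box L, ∀ γ : ℝ, 0 < γ →
      Integrable fun t : ℝ =>
        MultihopRelay.contourIntegrand K θ ρ γth ℓ γ (((-κ ℓ : ℝ) : ℂ) + t * Complex.I)) ∧
    -- the outage probability is asymptotically equivalent to the contour-integral expression
    IsEquivalent atTop
      (fun γ : ℝ => (MultihopRelay.outageProb μ A h ρ γth γ : ℂ))
      (MultihopRelay.contourOutage K θ ρ γth L κ) ∧
    -- which equals the expansion up to `o(1 / γ)`
    (fun γ : ℝ => MultihopRelay.contourOutage K θ ρ γth L κ γ -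
        (MultihopRelay.riceExpansion K θ ρ γth L γ : ℂ)) =o[atTop] (fun γ : ℝ => γ⁻¹) ∧
    -- so the outage probability is asymptotically equivalent to the expansion
    IsEquivalent atTop
      (MultihopRelay.outageProb μ A h ρ γth) (MultihopRelay.riceExpansion K θ ρ γth L) ∧
    -- with an additive remainder `o((log γ) ^ (N - 2) / γ)` as soon as all orders are at least two
    ((∀ k, 2 ≤ L k) →
      (fun γ : ℝ => MultihopRelay.outageProb μ A h ρ γth γ -
          MultihopRelay.riceExpansion K θ ρ γth L γ)
        =o[atTop] (fun γ : ℝ => Real.log γ ^ (M - 1) / γ)) ∧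
    -- the leading order
    IsEquivalent atTop
      (MultihopRelay.outageProb μ A h ρ γth) (MultihopRelay.riceLeading K θ ρ γth) := by
  obtain ⟨m, rfl⟩ : ∃ m, M = m + 1 := ⟨M - 1, by omega⟩
  have hX : MultihopRelay.IsRicianFamily (MultihopRelay.channelPower A h) K θ μ :=
    ⟨hK, hθ, hlaw, hindep⟩
  have hκ_pos : ∀ ℓ ∈ MultihopRelay.box L, 0 < κ ℓ := fun ℓ hℓ =>
    (Nat.cast_nonneg _).trans_lt (hκ ℓ hℓ)
  have hleading : IsEquivalent atTop (MultihopRelay.outageProb μ A h ρ γth)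
      (MultihopRelay.riceLeading K θ ρ γth) :=
    (MultihopRelay.isLittleO_measureReal_snr_lt_sub_riceLeading hX hρ hγth).trans_isBigO
      (MultihopRelay.isBigO_log_pow_div_riceLeading hK hθ (hρ _) hγth)
  have hexpansion : IsEquivalent atTop (MultihopRelay.outageProb μ A h ρ γth)
      (MultihopRelay.riceExpansion K θ ρ γth L) :=
    hleading.trans
      (MultihopRelay.isEquivalent_riceExpansion_riceLeading hK hθ (hρ _) hγth hL).symm
  exact ⟨fun ℓ hℓ γ hγ => MultihopRelay.integrable_contourIntegrand hK hθ (hρ _) hγth hγ ℓ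
      (neg_lt_zero.mpr (hκ_pos ℓ hℓ)),
    (MultihopRelay.isEquivalent_ofReal hexpansion).trans
      (MultihopRelay.isEquivalent_contourOutage_riceExpansion hK hθ (hρ _) hγth hL hκ_pos).symm,
    MultihopRelay.isLittleO_contourOutage_sub_riceExpansion hK hθ (hρ _) hγth hL hκ_pos,
    hexpansion,
    MultihopRelay.isLittleO_measureReal_snr_lt_sub_riceExpansion hX hρ hγth, hleading⟩
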